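/- Let $(b_\mu)$, $(a_\nu)$, $(\beta_m)$, $(\alpha_n)$ be four families (finite or infinite, some possibly empty) of positive real numbers with $\sum_\mu b_\mu^{-1}+\sum_\nu a_\nu^{-1}+\sum_m\beta_m^{-1}+\sum_n\alpha_n^{-1}<\infty$, let $f_0,g_0\in\mathbb C\setminus\{0\}$, let $j,k\ge 0$ be integers, and let $E$ be an arbitrary entire function. If $j+k>0$, assume that at least one of the four families is nonempty. Put $$f(z)=f_0z^{-k}e^{E(z)}\frac{\prod_\mu(1+z/b_\mu)}{\prod_m(1-z/\beta_m)},\qquad g(z)=g_0z^{j}e^{E(z)}\frac{\prod_\nu(1-z/a_\nu)}{\prod_n(1+z/\alpha_n)},$$ and let $F$ be the meromorphic function $F(z)=f(z^2)+z\,g(z^2)$ on $\mathbb C$. Put $c=-\dfrac{g_0|f_0|}{f_0|g_0|}$ (so $|c|=1$) and $J=j+k$, and let $Q_1,\dots,Q_4$ be the open quadrants of $\mathbb C$, numbered counterclockwise. Then $F$ has at least one zero, and its zeros, each repeated according to its multiplicity, can be listed as $z_1,z_2,\dots$ (a finite or infinite list) so that the following holds for all indices that occur in the list. 1. If $\operatorname{Im}c^2>0$,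 then all zeros are simple, $0<|z_1|<|z_2|<\cdots$, and $\operatorname{Im}z_n^2\neq0$ for every $n$; if $z_n\in Q_l$ with $l=1,2,3$ then $z_{n+1}\in Q_{l+1}$, and if $z_n\in Q_4$ then $z_{n+1}\in Q_1$. Moreover $(-1)^J\operatorname{Re}c\,\operatorname{Re}z_1>0$ and $\operatorname{Re}z_1\operatorname{Im}z_1<0$. 2. If $\operatorname{Im}c^2<0$, then all zeros are simple, $0<|z_1|<|z_2|<\cdots$, and $\operatorname{Im}z_n^2\neq0$ for every $n$; if $z_n\in Q_l$ with $l=2,3,4$ then $z_{n+1}\in Q_{l-1}$, and if $z_n\in Q_1$ then $z_{n+1}\in Q_4$. Moreover $(-1)^J\operatorname{Im}c\,\operatorname{Im}z_1<0$ and $\operatorname{Re}z_1\operatorname{Im}z_1>0$. 3. If $\operatorname{Im}c=0$, then $0<|z_1|\le|z_2|<|z_3|\le|z_4|<|z_5|\le\cdots$; there are no purely imaginary zeros, real zeros are simple or double, and all other zeros are simple. For every $n\ge1$: if $|z_{2n-1}|=|z_{2n}|$ then $z_{2n-1}=\overline{z_{2n}}$; if $|z_{2n-1}|<|z_{2n}|$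 then $\operatorname{Arg}z_{2n-1}=\operatorname{Arg}z_{2n}\in\{0,\pi\}$; and $\operatorname{sign}\operatorname{Re}z_{2n}=-\operatorname{sign}\operatorname{Re}z_{2n+1}$. Moreover $(-1)^Jc\operatorname{Re}z_1>0$ and $\operatorname{Re}z_1\operatorname{Im}z_1\le0$. 4. If $\operatorname{Re}c=0$, then $0<|z_1|<|z_2|\le|z_3|<|z_4|\le|z_5|<\cdots$; there are no real zeros, purely imaginary zeros are simple or double, and all other zeros are simple. For every $n\ge1$: if $|z_{2n}|=|z_{2n+1}|$ then $z_{2n}=-\overline{z_{2n+1}}$; if $|z_{2n}|<|z_{2n+1}|$ then $\operatorname{Arg}z_{2n}=\operatorname{Arg}z_{2n+1}\in\{-\frac\pi2,\frac\pi2\}$; and $\operatorname{sign}\operatorname{Im}z_{2n-1}=-\operatorname{sign}\operatorname{Im}z_{2n}$. Moreover $(-1)^J\operatorname{Im}c\,\operatorname{Im}z_1<0$ and $\operatorname{Re}z_1=0$. -/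

import Mathlib

open Complex Filter

namespace MeromorphicZeros

/-- The open quadrants of the complex plane, numbered counterclockwise. -/
def Q₁ : Set ℂ := {z | 0 < z.re ∧ 0 < z.im}

/-- The second open quadrant. -/
def Q₂ : Set ℂ := {z | z.re < 0 ∧ 0 < z.im}

/-- The third open quadrant. -/
def Q₃ : Set ℂ := {z | z.re < 0 ∧ z.im < 0}

/-- The fourth open quadrant. -/
def Q₄ : Set ℂ := {z | 0 < z.re ∧ z.im < 0}

/-- Multiplicity of `w` as a zero of the meromorphic function `F`: the order of `F` at `w` if it
is nonnegative, and `0` if `F` has a pole at `w`. It only depends on `F` near, but not at, `w`. -/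
noncomputable def zeroMult (F : ℂ → ℂ) (w : ℂ) : ℕ∞ :=
  WithTop.map Int.toNat (meromorphicOrderAt F w)

/-- `z 1, z 2, …` (all `z k` with `1 ≤ k ≤ ω`, where `ω` may be infinite) lists the zeros of `F`,
each zero being listed exactly as many times as its multiplicity. The value `z 0` and the values
`z k` with `k > ω` play no role. -/
def IsZeroList (F : ℂ → ℂ) (ω : ℕ∞) (z : ℕ → ℂ) : Prop :=
  ∀ w : ℂ, {k : ℕ | 1 ≤ k ∧ (k : ℕ∞) ≤ ω ∧ z k = w}.encard = zeroMult F w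

/-- The distribution of the zeros in the case `Im c² > 0`. -/
structure Distribution₁ (F : ℂ → ℂ) (c : ℂ) (J : ℕ) (ω : ℕ∞) (z : ℕ → ℂ) : Prop where
  simple : ∀ w : ℂ, zeroMult F w ≤ 1
  pos : 0 < ‖z 1‖
  lt : ∀ k : ℕ, 1 ≤ k → ((k + 1 : ℕ) : ℕ∞) ≤ ω → ‖z k‖ < ‖z (k + 1)‖
  im_sq_ne : ∀ k : ℕ, 1 ≤ k → (k : ℕ∞) ≤ ω → (z k ^ 2).im ≠ 0
  next : ∀ k : ℕ, 1 ≤ k → ((k + 1 : ℕ) : ℕ∞) ≤ ω →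
    (z k ∈ Q₁ → z (k + 1) ∈ Q₂) ∧ (z k ∈ Q₂ → z (k + 1) ∈ Q₃) ∧
    (z k ∈ Q₃ → z (k + 1) ∈ Q₄) ∧ (z k ∈ Q₄ → z (k + 1) ∈ Q₁)
  first_re : 0 < (-1) ^ J * c.re * (z 1).re
  first_quadrant : (z 1).re * (z 1).im < 0

/-- The distribution of the zeros in the case `Im c² < 0`. -/
structure Distribution₂ (F : ℂ → ℂ) (c : ℂ) (J : ℕ) (ω : ℕ∞) (z : ℕ → ℂ) : Prop where
  simple : ∀ w : ℂ, zeroMult F w ≤ 1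
  pos : 0 < ‖z 1‖
  lt : ∀ k : ℕ, 1 ≤ k → ((k + 1 : ℕ) : ℕ∞) ≤ ω → ‖z k‖ < ‖z (k + 1)‖
  im_sq_ne : ∀ k : ℕ, 1 ≤ k → (k : ℕ∞) ≤ ω → (z k ^ 2).im ≠ 0
  next : ∀ k : ℕ, 1 ≤ k → ((k + 1 : ℕ) : ℕ∞) ≤ ω →
    (z k ∈ Q₁ → z (k + 1) ∈ Q₄) ∧ (z k ∈ Q₂ → z (k + 1) ∈ Q₁) ∧
    (z k ∈ Q₃ → z (k + 1) ∈ Q₂) ∧ (z k ∈ Q₄ → z (k + 1) ∈ Q₃)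
  first_im : (-1) ^ J * c.im * (z 1).im < 0
  first_quadrant : 0 < (z 1).re * (z 1).im

/-- The distribution of the zeros in the case `Im c = 0`. -/
structure Distribution₃ (F : ℂ → ℂ) (c : ℂ) (J : ℕ) (ω : ℕ∞) (z : ℕ → ℂ) : Prop where
  pos : 0 < ‖z 1‖
  le : ∀ k : ℕ, 1 ≤ k → ((2 * k : ℕ) : ℕ∞) ≤ ω → ‖z (2 * k - 1)‖ ≤ ‖z (2 * k)‖
  lt : ∀ k : ℕ, 1 ≤ k → ((2 * k + 1 : ℕ) : ℕ∞) ≤ ω → ‖z (2 * k)‖ < ‖z (2 * k + 1)‖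
  no_imaginary : ∀ w : ℂ, w.re = 0 → zeroMult F w = 0
  real_le_two : ∀ w : ℂ, w.im = 0 → zeroMult F w ≤ 2
  nonreal_simple : ∀ w : ℂ, w.im ≠ 0 → zeroMult F w ≤ 1
  of_eq : ∀ k : ℕ, 1 ≤ k → ((2 * k : ℕ) : ℕ∞) ≤ ω → ‖z (2 * k - 1)‖ = ‖z (2 * k)‖ →
    z (2 * k - 1) = starRingEnd ℂ (z (2 * k))
  of_lt : ∀ k : ℕ, 1 ≤ k → ((2 * k : ℕ) : ℕ∞) ≤ ω → ‖z (2 * k - 1)‖ < ‖z (2 * k)‖ →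
    arg (z (2 * k - 1)) = arg (z (2 * k)) ∧ arg (z (2 * k)) ∈ ({0, Real.pi} : Set ℝ)
  sign_re : ∀ k : ℕ, 1 ≤ k → ((2 * k + 1 : ℕ) : ℕ∞) ≤ ω →
    SignType.sign (z (2 * k)).re = -SignType.sign (z (2 * k + 1)).re
  first_re : 0 < (-1) ^ J * c.re * (z 1).re
  first_quadrant : (z 1).re * (z 1).im ≤ 0

/-- The distribution of the zeros in the case `Re c = 0`. -/
structure Distribution₄ (F : ℂ → ℂ) (c : ℂ) (J : ℕ) (ω : ℕ∞) (z : ℕ → ℂ) : Prop where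
  pos : 0 < ‖z 1‖
  lt : ∀ k : ℕ, 1 ≤ k → ((2 * k : ℕ) : ℕ∞) ≤ ω → ‖z (2 * k - 1)‖ < ‖z (2 * k)‖
  le : ∀ k : ℕ, 1 ≤ k → ((2 * k + 1 : ℕ) : ℕ∞) ≤ ω → ‖z (2 * k)‖ ≤ ‖z (2 * k + 1)‖
  no_real : ∀ w : ℂ, w.im = 0 → zeroMult F w = 0
  imaginary_le_two : ∀ w : ℂ, w.re = 0 → zeroMult F w ≤ 2
  nonimaginary_simple : ∀ w : ℂ, w.re ≠ 0 → zeroMult F w ≤ 1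
  of_eq : ∀ k : ℕ, 1 ≤ k → ((2 * k + 1 : ℕ) : ℕ∞) ≤ ω → ‖z (2 * k)‖ = ‖z (2 * k + 1)‖ →
    z (2 * k) = -starRingEnd ℂ (z (2 * k + 1))
  of_lt : ∀ k : ℕ, 1 ≤ k → ((2 * k + 1 : ℕ) : ℕ∞) ≤ ω → ‖z (2 * k)‖ < ‖z (2 * k + 1)‖ →
    arg (z (2 * k)) = arg (z (2 * k + 1)) ∧
      arg (z (2 * k + 1)) ∈ ({-(Real.pi / 2), Real.pi / 2} : Set ℝ)
  sign_im : ∀ k : ℕ, 1 ≤ k → ((2 * k : ℕ) : ℕ∞) ≤ ω →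
    SignType.sign (z (2 * k - 1)).im = -SignType.sign (z (2 * k)).im
  first_im : (-1) ^ J * c.im * (z 1).im < 0
  first_re : (z 1).re = 0

/-- The zeros of `F` can be listed as `z 1, z 2, …`, with multiplicities and with at least one
entry, so that the list is distributed as the position of `c` prescribes. -/
def ZeroLocalization (F : ℂ → ℂ) (c : ℂ) (J : ℕ) : Prop :=
  ∃ (ω : ℕ∞) (z : ℕ → ℂ), 1 ≤ ω ∧ IsZeroList F ω z ∧
    (0 < (c ^ 2).im → Distribution₁ F c J ω z) ∧
    ((c ^ 2).im < 0 → Distribution₂ F c J ω z) ∧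
    (c.im = 0 → Distribution₃ F c J ω z) ∧
    (c.re = 0 → Distribution₄ F c J ω z)

end MeromorphicZeros

namespace MeromorphicZeros
open scoped Topology

/-! Clearing the denominators and removing the factor `f₀ e^E`, which has no zeros, turns the zeros
of `F` into those of the entire function `charFun`, that is P(w²) − cK w^(2J+1) Q(−w²). Here P and Q
are canonical products of genus zero with parameters b ∪ α and a ∪ β, and K = |g₀|/|f₀|. P vanishes
only on the negative axis and Q(−u) only on the positive one, so no zero is lost to a pole. Writing
w² = ρe^(±iφ) with 0 ≤ φ ≤ π, and conjugating when the sign is negative, leaves the equation P(u) =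
±cKρ^τ e^(iτφ) Q(−u) with τ = J + 1/2 in the closed upper half-plane. It is split into an equation
of moduli and one of arguments.

Moduli: along a half-circle |P| decreases and |Q(−u)| increases, one of them strictly
(`gap_strictAnti`). So each radius has at most one angle of equal moduli; `angle` is this angle,
clipped to [0, π], and depends continuously on ρ.

Arguments: `theta` is the argument of the quotient along this curve. It is nondecreasing
(`theta_sub_mul_log`). The source is that log(1 + e^w) has a derivative with positive imaginary part
in the strip 0 < Im w < π. Integrated along segments and summed over the factors, this bounds (Δθ)(Δ
log ρ) below by (Δ log-modulus)(Δφ), and the latter is nonnegative on the clipped curve. Equality at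
different radii forces the curve to run along the real axis.

Endpoints: a level set of θ is a single point, or a piece of a real half-axis. On such a piece the
logarithmic quotient of the moduli has a fixed sign and is, up to sign, strictly convex in log ρ, so
it vanishes only at endpoints. Hence the moduli agree at ρ exactly when ρ is the least or the
greatest element of its level set (`active_iff`). The two coincide on the axis exactly when the zero
is double. So the multiplicity of a zero on an axis is the number of endpoint roles played by its
radius.

Listing: with c = σe^(iηγ), the zeros sit at the levels (m − J)π ∓ γ. Since θ starts at −τπ and
reaches −Jπ, the first level is attained, and by the intermediate value theorem the attained levels
form an initial segment. The signs `eps` and `zeta`, functions of the index, then give quadrants,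
order and pairing. If both products are empty, J = 0 and the function is the linear polynomial 1 +
(g₀/f₀)w. -/

/-- The canonical product of genus zero with zeros `-d i`. -/
noncomputable def zeroProd {ι : Type*} (d : ι → ℝ) (u : ℂ) : ℂ := ∏' i, (1 + u / (d i : ℂ))

/-! ### Canonical products of genus zero and their logarithmic derivatives -/

section Products

variable {ι : Type*} {d : ι → ℝ}

lemma summable_div_ofReal (hs : Summable fun i => (d i)⁻¹) (u : ℂ) :
    Summable fun i => u / (d i : ℂ) := by
  have h : Summable fun i => (((d i)⁻¹ : ℝ) : ℂ) := Complex.ofRealCLM.summable hs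
  simpa [div_eq_mul_inv] using h.mul_left u

lemma multipliableLocallyUniformlyOn_zeroProd (hd : ∀ i, 0 < d i)
    (hs : Summable fun i => (d i)⁻¹) (R : ℝ) :
    MultipliableLocallyUniformlyOn (fun i (u : ℂ) => 1 + u / (d i : ℂ)) (Metric.ball 0 R) := by
  refine Summable.multipliableLocallyUniformlyOn_one_add (u := fun i => R * (d i)⁻¹)
    Metric.isOpen_ball (hs.mul_left R) (Eventually.of_forall fun i x hx => ?_)
    fun i => (continuous_id.div_const _).continuousOn
  rw [mem_ball_zero_iff] at hx
  rw [norm_div, norm_real, Real.norm_of_nonneg (hd i).le, div_eq_mul_inv]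
  have := inv_pos.2 (hd i)
  gcongr

lemma differentiable_zeroProd (hd : ∀ i, 0 < d i) (hs : Summable fun i => (d i)⁻¹) :
    Differentiable ℂ (zeroProd d) := by
  intro x
  have h : DifferentiableOn ℂ (zeroProd d) (Metric.ball 0 (‖x‖ + 1)) :=
    (multipliableLocallyUniformlyOn_zeroProd hd hs _).hasProdLocallyUniformlyOn.differentiableOn
      (Eventually.of_forall fun t => by fun_prop) Metric.isOpen_ball
  exact h.differentiableAt (Metric.isOpen_ball.mem_nhds (by simp))

lemma zeroProd_zero : zeroProd d 0 = 1 := by simp [zeroProd]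

lemma zeroProd_conj (hs : Summable fun i => (d i)⁻¹) (u : ℂ) :
    zeroProd d (starRingEnd ℂ u) = starRingEnd ℂ (zeroProd d u) := by
  unfold zeroProd
  rw [(Complex.multipliable_one_add_of_summable (summable_div_ofReal hs u)).map_tprod
    (starRingEnd ℂ) continuous_conj]
  simp

/-- If no factor vanishes, the sum of the logarithms converges and the product is an exponential. -/
lemma zeroProd_ne_zero_iff (hs : Summable fun i => (d i)⁻¹) {u : ℂ} :
    zeroProd d u ≠ 0 ↔ ∀ i, 1 + u / (d i : ℂ) ≠ 0 := by
  constructor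
  · intro h i hi
    exact h (tprod_of_exists_eq_zero ⟨i, hi⟩)
  · intro h
    rw [zeroProd, ← Complex.cexp_tsum_eq_tprod h
      (Complex.summable_log_one_add_of_summable (summable_div_ofReal hs u))]
    exact exp_ne_zero _

lemma zeroProd_sumElim {ι₂ : Type*} {d' : ι₂ → ℝ} (hs : Summable fun i => (d i)⁻¹)
    (hs' : Summable fun i => (d' i)⁻¹) (u : ℂ) :
    zeroProd (Sum.elim d d') u = zeroProd d u * zeroProd d' u :=
  Multipliable.tprod_sum
    (Complex.multipliable_one_add_of_summable (summable_div_ofReal hs u))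
    (Complex.multipliable_one_add_of_summable (summable_div_ofReal hs' u))

lemma summable_inv_add (hd : ∀ i, 0 < d i) (hs : Summable fun i => (d i)⁻¹) (u : ℂ) :
    Summable fun i => u / (u + d i) := by
  have h0 := summable_div_ofReal hs u
  have ht : Tendsto (fun i => (1 + u / (d i : ℂ))⁻¹) cofinite (𝓝 (1 + 0)⁻¹) :=
    (tendsto_const_nhds.add h0.tendsto_cofinite_zero).inv₀ (by simp)
  refine (h0.norm.mul_tendsto_const ht).congr fun i => ?_
  have : (d i : ℂ) ≠ 0 := by exact_mod_cast (hd i).ne'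
  rw [← div_eq_mul_inv, div_div, mul_add, mul_one, mul_div_cancel₀ _ this, add_comm]

/-- `u` times the logarithmic derivative of `zeroProd d`, as a sum. -/
noncomputable def zeroSum {ι : Type*} (d : ι → ℝ) (u : ℂ) : ℂ := ∑' i, u / (u + d i)

lemma mul_logDeriv_zeroProd (hd : ∀ i, 0 < d i) (hs : Summable fun i => (d i)⁻¹) {u : ℂ}
    (hu : zeroProd d u ≠ 0) : u * logDeriv (zeroProd d) u = zeroSum d u := by
  have hne := (zeroProd_ne_zero_iff hs).1 hu
  have hlog : ∀ i, logDeriv (fun v : ℂ => 1 + v / (d i : ℂ)) u = 1 / (u + d i) := fun i => by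
    have h0 : (d i : ℂ) ≠ 0 := by exact_mod_cast (hd i).ne'
    have h1 : HasDerivAt (fun v : ℂ => 1 + v / (d i : ℂ)) (1 / (d i : ℂ)) u :=
      ((hasDerivAt_id u).div_const _).const_add _
    rw [logDeriv_apply, h1.deriv, div_div, mul_add, mul_one, mul_div_cancel₀ _ h0, add_comm]
  rcases eq_or_ne u 0 with rfl | hu0
  · simp [zeroSum]
  have hsum : Summable fun i => 1 / (u + d i) := by
    refine ((summable_inv_add hd hs u).mul_left u⁻¹).congr fun i => ?_
    rw [← mul_div_assoc, inv_mul_cancel₀ hu0]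
  have key := logDeriv_tprod_eq_tsum (f := fun i (v : ℂ) => 1 + v / (d i : ℂ))
    (s := Metric.ball 0 (‖u‖ + 1)) (x := u) Metric.isOpen_ball (by simp) hne
    (fun i => by fun_prop) (by simpa only [hlog] using hsum)
    (multipliableLocallyUniformlyOn_zeroProd hd hs _) hu
  have : logDeriv (zeroProd d) u = ∑' i, 1 / (u + d i) := by
    simp only [hlog] at key
    exact key
  rw [this, zeroSum, ← tsum_mul_left]
  simp [div_eq_mul_inv]

lemma im_div_add (c : ℝ) (u : ℂ) : (u / (u + c)).im = c * u.im / normSq (u + c) := by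
  rw [div_im]
  simp
  ring

/-- Every term u/(u + d) maps the closed upper half-plane into itself, so any single term bounds the
sum from below. This quantitative form is what the order computation on the real axis needs. -/
lemma im_zeroSum_nonneg (hd : ∀ i, 0 < d i) (hs : Summable fun i => (d i)⁻¹) {u : ℂ}
    (hu : 0 ≤ u.im) (i : ι) : d i * u.im / normSq (u + d i) ≤ (zeroSum d u).im := by
  have h := (summable_inv_add hd hs u)
  rw [zeroSum, im_tsum h, ← im_div_add]
  refine Summable.le_tsum (imCLM.summable h) i fun j _ => ?_
  show 0 ≤ (u / (u + d j)).im
  rw [im_div_add]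
  exact div_nonneg (mul_nonneg (hd j).le hu) (normSq_nonneg _)

end Products

end MeromorphicZeros

namespace MeromorphicZeros
open scoped Topology

/-! ### The increment of log(1 + e^w) in the strip 0 ≤ Im w ≤ π -/

section Segment

/-- The principal value on the negative axis is the limit from above; this is why arguments are
followed in the closed upper half-plane only. -/
lemma continuousWithinAt_log_upper {z : ℂ} (hz : z ≠ 0) :
    ContinuousWithinAt log {z : ℂ | 0 ≤ z.im} z := by
  by_cases h : z ∈ slitPlane
  · exact (continuousAt_clog h).continuousWithinAt
  · rw [mem_slitPlane_iff, not_or, not_lt, not_not] at h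
    refine continuousWithinAt_log_of_re_neg_of_im_zero (lt_of_le_of_ne h.1 fun h0 => hz ?_) h.2
    exact Complex.ext h0 h.2

lemma im_one_add_exp (w : ℂ) : (1 + exp w).im = Real.exp w.re * Real.sin w.im := by
  simp [exp_im]

/-- Along the segment with direction v the derivative of log(1 + e^w)·conj v is |v|² e^w/(1 + e^w),
whose imaginary part is positive inside the strip. Strict monotonicity on the open segment with
continuity at its ends allows endpoints on the boundary lines; `hedge` excludes segments lying
inside a boundary line, where that derivative is real. -/
lemma im_log_one_add_exp_mul_conj_pos {w₁ w₂ : ℂ} (h₁ : w₁.im ∈ Set.Icc 0 Real.pi)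
    (h₂ : w₂.im ∈ Set.Icc 0 Real.pi) (hn₁ : 1 + exp w₁ ≠ 0) (hn₂ : 1 + exp w₂ ≠ 0)
    (hne : w₁ ≠ w₂) (hedge : w₁.im = w₂.im → w₁.im ∈ Set.Ioo 0 Real.pi) :
    0 < ((log (1 + exp w₂) - log (1 + exp w₁)) * starRingEnd ℂ (w₂ - w₁)).im := by
  set v := w₂ - w₁ with hv
  let w : ℝ → ℂ := fun t => w₁ + t * v
  have hw0 : w 0 = w₁ := by simp [w]
  have hw1 : w 1 = w₂ := by simp [w, hv]
  have hwim : ∀ t, (w t).im = (1 - t) * w₁.im + t * w₂.im := fun t => by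
    simp [w, hv]; ring
  have hint : ∀ t ∈ Set.Ioo (0 : ℝ) 1, (w t).im ∈ Set.Ioo 0 Real.pi := by
    intro t ht
    rw [hwim]
    by_cases he : w₁.im = w₂.im
    · have := hedge he
      rw [← he]
      convert this using 1
      ring
    · obtain ⟨a1, a2⟩ := h₁
      obtain ⟨b1, b2⟩ := h₂
      obtain ⟨t0, t1⟩ := ht
      rcases lt_or_gt_of_ne he with hlt | hlt
      · constructor <;> nlinarith
      · constructor <;> nlinarith
  have hicc : ∀ t ∈ Set.Icc (0 : ℝ) 1, 0 ≤ (1 + exp (w t)).im ∧ 1 + exp (w t) ≠ 0 := by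
    intro t ht
    rcases eq_or_lt_of_le ht.1 with rfl | h0
    · rw [hw0, im_one_add_exp]
      exact ⟨mul_nonneg (Real.exp_pos _).le (Real.sin_nonneg_of_mem_Icc h₁), hn₁⟩
    rcases eq_or_lt_of_le ht.2 with rfl | h1
    · rw [hw1, im_one_add_exp]
      exact ⟨mul_nonneg (Real.exp_pos _).le (Real.sin_nonneg_of_mem_Icc h₂), hn₂⟩
    have : 0 < (1 + exp (w t)).im := by
      rw [im_one_add_exp]
      exact mul_pos (Real.exp_pos _) (Real.sin_pos_of_mem_Ioo (hint t ⟨h0, h1⟩))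
    exact ⟨this.le, fun h => by simp [h] at this⟩
  have hwc : Continuous w := by fun_prop
  let g : ℝ → ℂ := fun t => log (1 + exp (w t)) * starRingEnd ℂ v
  have hcont : ContinuousOn (fun t => (g t).im) (Set.Icc 0 1) := by
    refine Complex.continuous_im.comp_continuousOn (ContinuousOn.mul ?_ continuousOn_const)
    intro t ht
    have hc : ContinuousWithinAt (fun t => 1 + exp (w t)) (Set.Icc 0 1) t := by
      apply Continuous.continuousWithinAt; fun_prop
    exact ContinuousWithinAt.comp (g := log) (f := fun t => 1 + exp (w t))
      (continuousWithinAt_log_upper (hicc t ht).2) hc fun s hs => (hicc s hs).1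
  have hder : ∀ t ∈ Set.Ioo (0 : ℝ) 1, HasDerivAt (fun t => (g t).im)
      ((exp (w t) / (exp (w t) + (1 : ℝ)) * v * starRingEnd ℂ v).im) t := by
    intro t ht
    have him : 0 < (1 + exp (w t)).im := by
      rw [im_one_add_exp]
      exact mul_pos (Real.exp_pos _) (Real.sin_pos_of_mem_Ioo (hint t ht))
    have hsl : 1 + exp (w t) ∈ slitPlane := Or.inr him.ne'
    have d1 : HasDerivAt w v t := by
      have : HasDerivAt (fun s : ℝ => (s : ℂ) * v) (1 * v) t :=
        (ofRealCLM.hasDerivAt (x := t)).mul_const v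
      simpa [w] using this.const_add w₁
    have d2 : HasDerivAt g (exp (w t) * v / (1 + exp (w t)) * starRingEnd ℂ v) t :=
      ((d1.cexp.const_add 1).clog_real hsl).mul_const _
    have d3 := (imCLM.hasFDerivAt.comp_hasDerivAt t d2)
    rw [ofReal_one, div_mul_eq_mul_div, add_comm (exp (w t)) 1]
    exact d3
  have hpos : ∀ t ∈ Set.Ioo (0 : ℝ) 1,
      0 < (exp (w t) / (exp (w t) + (1 : ℝ)) * v * starRingEnd ℂ v).im := by
    intro t ht
    have hv0 : v ≠ 0 := sub_ne_zero.2 hne.symm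
    rw [mul_assoc, mul_conj, im_mul_ofReal, im_div_add, one_mul, exp_im]
    have hnz : exp (w t) + ((1 : ℝ) : ℂ) ≠ 0 := by
      rw [add_comm, ofReal_one]; exact (hicc t ⟨ht.1.le, ht.2.le⟩).2
    exact mul_pos (div_pos (mul_pos (Real.exp_pos _) (Real.sin_pos_of_mem_Ioo (hint t ht)))
      (normSq_pos.2 hnz)) (normSq_pos.2 hv0)
  have hmono : StrictMonoOn (fun t => (g t).im) (Set.Icc 0 1) := by
    refine strictMonoOn_of_deriv_pos (convex_Icc 0 1) hcont fun t ht => ?_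
    rw [interior_Icc] at ht
    rw [(hder t ht).deriv]
    exact hpos t ht
  have := hmono (Set.left_mem_Icc.2 zero_le_one) (Set.right_mem_Icc.2 zero_le_one) zero_lt_one
  simp only [g, hw0, hw1] at this
  rw [sub_mul, sub_im]
  linarith

lemma arg_ofReal_mono {x y : ℝ} (hxy : x ≤ y) : arg (y : ℂ) ≤ arg (x : ℂ) := by
  rcases lt_or_ge x 0 with hx | hx
  · rw [arg_ofReal_of_neg hx]; exact arg_le_pi _
  · rw [arg_ofReal_of_nonneg hx, arg_ofReal_of_nonneg (hx.trans hxy)]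

lemma im_log_one_add_exp_mul_conj_nonneg {w₁ w₂ : ℂ} (h₁ : w₁.im ∈ Set.Icc 0 Real.pi)
    (h₂ : w₂.im ∈ Set.Icc 0 Real.pi) (hn₁ : 1 + exp w₁ ≠ 0) (hn₂ : 1 + exp w₂ ≠ 0) :
    0 ≤ ((log (1 + exp w₂) - log (1 + exp w₁)) * starRingEnd ℂ (w₂ - w₁)).im := by
  by_cases hne : w₁ = w₂
  · simp [hne]
  by_cases hedge : w₁.im = w₂.im → w₁.im ∈ Set.Ioo 0 Real.pi
  · exact (im_log_one_add_exp_mul_conj_pos h₁ h₂ hn₁ hn₂ hne hedge).le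
  -- The segment lies in a boundary line and may pass through the zero of 1 + e^w at πi, so no
  -- derivative is used. On the line Im w = 0 the argument is 0; on Im w = π the real number 1 − e^x
  -- decreases in x and its argument jumps from 0 to π.
  push Not at hedge
  obtain ⟨he, hb⟩ := hedge
  have hb' : w₁.im = 0 ∨ w₁.im = Real.pi := by
    by_contra! hcon
    exact hb ⟨lt_of_le_of_ne h₁.1 hcon.1.symm, lt_of_le_of_ne h₁.2 hcon.2⟩
  have him : ((log (1 + exp w₂) - log (1 + exp w₁)) * starRingEnd ℂ (w₂ - w₁)).im
      = (arg (1 + exp w₂) - arg (1 + exp w₁)) * (w₂.re - w₁.re) := by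
    simp [mul_im, he, log_im]
  rw [him]
  rcases hb' with hb' | hb'
  · have aux : ∀ w : ℂ, w.im = 0 → 1 + exp w = ((1 + Real.exp w.re : ℝ) : ℂ) := fun w hw => by
      apply Complex.ext <;> simp [exp_re, exp_im, hw]
    rw [aux _ hb', aux _ (he ▸ hb'), arg_ofReal_of_nonneg (by positivity),
      arg_ofReal_of_nonneg (by positivity)]
    simp
  · have aux : ∀ w : ℂ, w.im = Real.pi → 1 + exp w = ((1 - Real.exp w.re : ℝ) : ℂ) := fun w hw => by
      apply Complex.ext <;> simp [exp_re, exp_im, hw, sub_eq_add_neg]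
    rw [aux _ hb', aux _ (he ▸ hb')]
    rcases le_total w₁.re w₂.re with h | h
    · exact mul_nonneg (sub_nonneg.2 (arg_ofReal_mono
        (sub_le_sub_left (Real.exp_le_exp.2 h) _))) (sub_nonneg.2 h)
    · exact mul_nonneg_of_nonpos_of_nonpos (sub_nonpos.2 (arg_ofReal_mono
        (sub_le_sub_left (Real.exp_le_exp.2 h) _))) (sub_nonpos.2 h)

end Segment

/-! ### Modulus and argument of a canonical product in polar coordinates -/

/-- The point with polar coordinates `(ρ, φ)`. -/
noncomputable def polar (ρ φ : ℝ) : ℂ := ρ * exp (φ * I)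

/-- The branch of `log (zeroProd d)` on the closed upper half-plane, in polar coordinates. -/
noncomputable def logSum {ι : Type*} (d : ι → ℝ) (ρ φ : ℝ) : ℂ :=
  ∑' i, log (1 + polar ρ φ / (d i : ℂ))

lemma polar_im (ρ φ : ℝ) : (polar ρ φ).im = ρ * Real.sin φ := by
  simp [polar, exp_ofReal_mul_I_im]

lemma polar_re (ρ φ : ℝ) : (polar ρ φ).re = ρ * Real.cos φ := by
  simp [polar, exp_ofReal_mul_I_re]

lemma norm_polar {ρ : ℝ} (hρ : 0 < ρ) (φ : ℝ) : ‖polar ρ φ‖ = ρ := by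
  simp [polar, norm_exp_ofReal_mul_I, abs_of_pos hρ]

lemma polar_zero (ρ : ℝ) : polar ρ 0 = ρ := by simp [polar]

lemma polar_pi (ρ : ℝ) : polar ρ Real.pi = -ρ := by simp [polar]

lemma conj_polar (ρ φ : ℝ) : starRingEnd ℂ (polar ρ φ) = polar ρ (-φ) := by
  apply Complex.ext <;> simp [polar_re, polar_im]

lemma neg_polar (ρ φ : ℝ) : -polar ρ φ = starRingEnd ℂ (polar ρ (Real.pi - φ)) := by
  apply Complex.ext <;> simp [polar_re, polar_im]

lemma continuous_polar : Continuous fun x : ℝ × ℝ => polar x.1 x.2 := by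
  unfold polar; fun_prop

/-- Logarithmic polar coordinates. -/
noncomputable def logPolar (ρ φ : ℝ) : ℂ := Real.log ρ + φ * I

lemma logPolar_im (ρ φ : ℝ) : (logPolar ρ φ).im = φ := by simp [logPolar]

lemma logPolar_re (ρ φ : ℝ) : (logPolar ρ φ).re = Real.log ρ := by simp [logPolar]

lemma polar_div {ρ c : ℝ} (hρ : 0 < ρ) (hc : 0 < c) (φ : ℝ) :
    polar ρ φ / (c : ℂ) = exp (logPolar ρ φ - Real.log c) := by
  rw [exp_sub, logPolar, exp_add, ← ofReal_exp, ← ofReal_exp, Real.exp_log hρ, Real.exp_log hc,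
    polar]

section Sums

variable {ι : Type*} {d : ι → ℝ}

lemma summable_logSum (hs : Summable fun i => (d i)⁻¹) (ρ φ : ℝ) :
    Summable fun i => log (1 + polar ρ φ / (d i : ℂ)) :=
  Complex.summable_log_one_add_of_summable (summable_div_ofReal hs _)

lemma zeroProd_polar (hs : Summable fun i => (d i)⁻¹) {ρ φ : ℝ}
    (h : zeroProd d (polar ρ φ) ≠ 0) : zeroProd d (polar ρ φ) = exp (logSum d ρ φ) :=
  (Complex.cexp_tsum_eq_tprod ((zeroProd_ne_zero_iff hs).1 h) (summable_logSum hs ρ φ)).symm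

lemma norm_zeroProd_polar (hs : Summable fun i => (d i)⁻¹) {ρ φ : ℝ}
    (h : zeroProd d (polar ρ φ) ≠ 0) :
    Real.log ‖zeroProd d (polar ρ φ)‖ = (logSum d ρ φ).re := by
  rw [zeroProd_polar hs h, norm_exp, Real.log_exp]

lemma hasSum_im_logSum_mul (hs : Summable fun i => (d i)⁻¹) (ρ₁ φ₁ ρ₂ φ₂ : ℝ) (v : ℂ) :
    HasSum (fun i => ((log (1 + polar ρ₂ φ₂ / (d i : ℂ)) - log (1 + polar ρ₁ φ₁ / (d i : ℂ)))
      * v).im) (((logSum d ρ₂ φ₂ - logSum d ρ₁ φ₁) * v).im) :=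
  Complex.hasSum_im
    (((summable_logSum hs ρ₂ φ₂).hasSum.sub (summable_logSum hs ρ₁ φ₁).hasSum).mul_right v)

lemma im_log_polar_nonneg {ρ₁ φ₁ ρ₂ φ₂ c : ℝ} (hc : 0 < c) (hρ₁ : 0 < ρ₁) (hρ₂ : 0 < ρ₂)
    (hφ₁ : φ₁ ∈ Set.Icc 0 Real.pi) (hφ₂ : φ₂ ∈ Set.Icc 0 Real.pi)
    (h₁ : 1 + polar ρ₁ φ₁ / (c : ℂ) ≠ 0) (h₂ : 1 + polar ρ₂ φ₂ / (c : ℂ) ≠ 0) :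
    0 ≤ ((log (1 + polar ρ₂ φ₂ / (c : ℂ)) - log (1 + polar ρ₁ φ₁ / (c : ℂ)))
      * starRingEnd ℂ (logPolar ρ₂ φ₂ - logPolar ρ₁ φ₁)).im := by
  rw [polar_div hρ₁ hc] at h₁ ⊢
  rw [polar_div hρ₂ hc] at h₂ ⊢
  have := im_log_one_add_exp_mul_conj_nonneg (by simpa [logPolar_im] using hφ₁)
    (by simpa [logPolar_im] using hφ₂) h₁ h₂
  simpa using this

lemma im_log_polar_pos {ρ₁ φ₁ ρ₂ φ₂ c : ℝ} (hc : 0 < c) (hρ₁ : 0 < ρ₁) (hρ₂ : 0 < ρ₂)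
    (hφ₁ : φ₁ ∈ Set.Icc 0 Real.pi) (hφ₂ : φ₂ ∈ Set.Icc 0 Real.pi)
    (h₁ : 1 + polar ρ₁ φ₁ / (c : ℂ) ≠ 0) (h₂ : 1 + polar ρ₂ φ₂ / (c : ℂ) ≠ 0)
    (hne : ρ₁ ≠ ρ₂ ∨ φ₁ ≠ φ₂) (hedge : φ₁ = φ₂ → φ₁ ∈ Set.Ioo 0 Real.pi) :
    0 < ((log (1 + polar ρ₂ φ₂ / (c : ℂ)) - log (1 + polar ρ₁ φ₁ / (c : ℂ)))
      * starRingEnd ℂ (logPolar ρ₂ φ₂ - logPolar ρ₁ φ₁)).im := by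
  rw [polar_div hρ₁ hc] at h₁ ⊢
  rw [polar_div hρ₂ hc] at h₂ ⊢
  have := im_log_one_add_exp_mul_conj_pos (by simpa [logPolar_im] using hφ₁)
    (by simpa [logPolar_im] using hφ₂) h₁ h₂ (fun h => ?_) (by simpa [logPolar_im] using hedge)
  · simpa using this
  · rw [sub_left_inj] at h
    have hre := congrArg Complex.re h
    have him := congrArg Complex.im h
    rw [logPolar_re, logPolar_re] at hre
    rw [logPolar_im, logPolar_im] at him
    rcases hne with hne | hne
    · exact hne (Real.log_injOn_pos hρ₁ hρ₂ hre)
    · exact hne him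

/-- Each factor is 1 + e^w with w = log ρ + iφ − log d. The shift by log d is real and cancels in
differences, so the strip inequality can be summed over all factors. -/
lemma im_logSum_nonneg (hd : ∀ i, 0 < d i) (hs : Summable fun i => (d i)⁻¹)
    {ρ₁ φ₁ ρ₂ φ₂ : ℝ} (hρ₁ : 0 < ρ₁) (hρ₂ : 0 < ρ₂)
    (hφ₁ : φ₁ ∈ Set.Icc 0 Real.pi) (hφ₂ : φ₂ ∈ Set.Icc 0 Real.pi)
    (h₁ : zeroProd d (polar ρ₁ φ₁) ≠ 0) (h₂ : zeroProd d (polar ρ₂ φ₂) ≠ 0) :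
    0 ≤ ((logSum d ρ₂ φ₂ - logSum d ρ₁ φ₁)
      * starRingEnd ℂ (logPolar ρ₂ φ₂ - logPolar ρ₁ φ₁)).im :=
  (hasSum_im_logSum_mul hs ρ₁ φ₁ ρ₂ φ₂ _).nonneg fun i => im_log_polar_nonneg (hd i) hρ₁ hρ₂ hφ₁
    hφ₂ ((zeroProd_ne_zero_iff hs).1 h₁ i) ((zeroProd_ne_zero_iff hs).1 h₂ i)

lemma im_logSum_pos [Nonempty ι] (hd : ∀ i, 0 < d i) (hs : Summable fun i => (d i)⁻¹)
    {ρ₁ φ₁ ρ₂ φ₂ : ℝ} (hρ₁ : 0 < ρ₁) (hρ₂ : 0 < ρ₂)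
    (hφ₁ : φ₁ ∈ Set.Icc 0 Real.pi) (hφ₂ : φ₂ ∈ Set.Icc 0 Real.pi)
    (h₁ : zeroProd d (polar ρ₁ φ₁) ≠ 0) (h₂ : zeroProd d (polar ρ₂ φ₂) ≠ 0)
    (hne : ρ₁ ≠ ρ₂ ∨ φ₁ ≠ φ₂) (hedge : φ₁ = φ₂ → φ₁ ∈ Set.Ioo 0 Real.pi) :
    0 < ((logSum d ρ₂ φ₂ - logSum d ρ₁ φ₁)
      * starRingEnd ℂ (logPolar ρ₂ φ₂ - logPolar ρ₁ φ₁)).im := by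
  have h := hasSum_im_logSum_mul hs ρ₁ φ₁ ρ₂ φ₂
    (starRingEnd ℂ (logPolar ρ₂ φ₂ - logPolar ρ₁ φ₁))
  have hpos := fun i => im_log_polar_pos (hd i) hρ₁ hρ₂ hφ₁ hφ₂
    ((zeroProd_ne_zero_iff hs).1 h₁ i) ((zeroProd_ne_zero_iff hs).1 h₂ i) hne hedge
  rw [← h.tsum_eq]
  exact h.summable.tsum_pos (fun i => (hpos i).le) (Classical.arbitrary ι) (hpos _)

/-- The form in which the inequality is used: Δarg · Δ log ρ − Δ log-modulus · Δφ. -/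
lemma im_logSum_mul_conj (ρ₁ φ₁ ρ₂ φ₂ : ℝ) : ((logSum d ρ₂ φ₂ - logSum d ρ₁ φ₁)
      * starRingEnd ℂ (logPolar ρ₂ φ₂ - logPolar ρ₁ φ₁)).im =
    ((logSum d ρ₂ φ₂).im - (logSum d ρ₁ φ₁).im) * (Real.log ρ₂ - Real.log ρ₁) -
    ((logSum d ρ₂ φ₂).re - (logSum d ρ₁ φ₁).re) * (φ₂ - φ₁) := by
  rw [mul_im, conj_re, conj_im, sub_re, sub_re, sub_im, sub_im, logPolar_im, logPolar_im,
    logPolar_re, logPolar_re]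
  ring

lemma one_add_polar_div_ne_zero {ρ φ c : ℝ} (hρ : 0 < ρ) (hc : 0 < c)
    (hφ : φ ∈ Set.Ico 0 Real.pi) : 1 + polar ρ φ / (c : ℂ) ≠ 0 := by
  intro h
  have him := congrArg Complex.im h
  have hre := congrArg Complex.re h
  rw [add_im, div_ofReal_im, polar_im] at him
  rw [add_re, div_ofReal_re, polar_re] at hre
  simp only [one_im, zero_add, zero_im, one_re, zero_re] at him hre
  rcases eq_or_lt_of_le hφ.1 with h0 | h0
  · rw [← h0, Real.cos_zero, mul_one] at hre
    have := div_pos hρ hc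
    linarith
  · exact absurd him (div_pos (mul_pos hρ (Real.sin_pos_of_pos_of_lt_pi h0 hφ.2)) hc).ne'

lemma zeroProd_polar_ne_zero (hd : ∀ i, 0 < d i) (hs : Summable fun i => (d i)⁻¹) {ρ φ : ℝ}
    (hρ : 0 < ρ) (hφ : φ ∈ Set.Ico 0 Real.pi) : zeroProd d (polar ρ φ) ≠ 0 :=
  (zeroProd_ne_zero_iff hs).2 fun i => one_add_polar_div_ne_zero hρ (hd i) hφ

/-- The norm of a canonical product decreases along upper half-circles. -/
lemma norm_zeroProd_polar_anti (hd : ∀ i, 0 < d i) (hs : Summable fun i => (d i)⁻¹) {ρ : ℝ}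
    (hρ : 0 < ρ) {φ₁ φ₂ : ℝ} (h₁ : 0 ≤ φ₁) (h₂ : φ₂ ≤ Real.pi) (h : φ₁ ≤ φ₂) :
    ‖zeroProd d (polar ρ φ₂)‖ ≤ ‖zeroProd d (polar ρ φ₁)‖ := by
  rcases eq_or_lt_of_le h with rfl | h
  · exact le_rfl
  by_cases h0 : zeroProd d (polar ρ φ₂) = 0
  · simp [h0]
  have h0' := zeroProd_polar_ne_zero hd hs hρ ⟨h₁, h.trans_le h₂⟩
  have := im_logSum_nonneg hd hs hρ hρ ⟨h₁, (h.trans_le h₂).le⟩ ⟨h₁.trans h.le, h₂⟩ h0' h0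
  -- With equal radii the term in Δ log ρ drops out, leaving an inequality between log-moduli and
  -- angles.
  rw [im_logSum_mul_conj, sub_self, mul_zero, zero_sub, neg_nonneg,
    ← norm_zeroProd_polar hs h0, ← norm_zeroProd_polar hs h0'] at this
  have h3 := nonpos_of_mul_nonpos_left this (sub_pos.2 h)
  exact (Real.log_le_log_iff (norm_pos_iff.2 h0) (norm_pos_iff.2 h0')).1 (sub_nonpos.1 h3)

lemma norm_zeroProd_polar_strictAnti [Nonempty ι] (hd : ∀ i, 0 < d i)
    (hs : Summable fun i => (d i)⁻¹) {ρ : ℝ}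
    (hρ : 0 < ρ) {φ₁ φ₂ : ℝ} (h₁ : 0 ≤ φ₁) (h₂ : φ₂ ≤ Real.pi) (h : φ₁ < φ₂) :
    ‖zeroProd d (polar ρ φ₂)‖ < ‖zeroProd d (polar ρ φ₁)‖ := by
  have h0' := zeroProd_polar_ne_zero hd hs hρ ⟨h₁, h.trans_le h₂⟩
  by_cases h0 : zeroProd d (polar ρ φ₂) = 0
  · simpa [h0] using h0'
  have := im_logSum_pos hd hs hρ hρ ⟨h₁, (h.trans_le h₂).le⟩ ⟨h₁.trans h.le, h₂⟩ h0' h0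
    (Or.inr h.ne) (fun h' => absurd h' h.ne)
  rw [im_logSum_mul_conj, sub_self, mul_zero, zero_sub, neg_pos,
    ← norm_zeroProd_polar hs h0, ← norm_zeroProd_polar hs h0'] at this
  have h3 := neg_of_mul_neg_left this (sub_pos.2 h).le
  exact (Real.log_lt_log_iff (norm_pos_iff.2 h0) (norm_pos_iff.2 h0')).1 (sub_neg.1 h3)

lemma im_one_add_polar_div_nonneg {ρ φ c : ℝ} (hρ : 0 < ρ) (hc : 0 < c)
    (hφ : φ ∈ Set.Icc 0 Real.pi) : 0 ≤ (1 + polar ρ φ / (c : ℂ)).im := by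
  rw [add_im, div_ofReal_im, polar_im, one_im, zero_add]
  exact div_nonneg (mul_nonneg hρ.le (Real.sin_nonneg_of_mem_Icc hφ)) hc.le

/-- The constant 2π serves two regimes: |log(1 + x)| ≤ (3/2)|x| for |x| ≤ 1/2, and arg ≤ π ≤ 2π|x|
for |x| ≥ 1/2. It gives a summable majorant and forces the argument to 0 at the origin. -/
lemma norm_log_one_add_polar_le {ρ φ c : ℝ} (hρ : 0 < ρ) (hc : 0 < c)
    (hφ : φ ∈ Set.Icc 0 Real.pi) :
    (log (1 + polar ρ φ / (c : ℂ))).im ∈ Set.Icc 0 (2 * Real.pi * ρ * c⁻¹) := by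
  refine ⟨by rw [log_im]; exact arg_nonneg_iff.2 (im_one_add_polar_div_nonneg hρ hc hφ), ?_⟩
  have hnorm : ‖polar ρ φ / (c : ℂ)‖ = ρ * c⁻¹ := by
    rw [norm_div, norm_polar hρ, norm_real, Real.norm_of_nonneg hc.le, div_eq_mul_inv]
  have hx : 0 < ρ * c⁻¹ := by positivity
  have hpi := Real.pi_gt_three
  rcases le_total (ρ * c⁻¹) (1 / 2) with h | h
  · have h1 := norm_log_one_add_half_le_self (hnorm.trans_le h)
    have h2 := (le_abs_self _).trans ((abs_im_le_norm _).trans h1)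
    rw [hnorm] at h2
    nlinarith
  · rw [log_im]
    refine (arg_le_pi _).trans ?_
    nlinarith

lemma im_logSum_mem (hd : ∀ i, 0 < d i) (hs : Summable fun i => (d i)⁻¹) {ρ φ : ℝ} (hρ : 0 < ρ)
    (hφ : φ ∈ Set.Icc 0 Real.pi) :
    (logSum d ρ φ).im ∈ Set.Icc 0 (2 * Real.pi * ρ * ∑' i, (d i)⁻¹) := by
  have h := Complex.hasSum_im (summable_logSum hs ρ φ).hasSum
  refine ⟨h.nonneg fun i => (norm_log_one_add_polar_le hρ (hd i) hφ).1, ?_⟩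
  exact hasSum_le (fun i => (norm_log_one_add_polar_le hρ (hd i) hφ).2) h
    (hs.hasSum.mul_left (2 * Real.pi * ρ))

lemma im_log_le_im_logSum (hd : ∀ i, 0 < d i) (hs : Summable fun i => (d i)⁻¹) {ρ φ : ℝ}
    (hρ : 0 < ρ) (hφ : φ ∈ Set.Icc 0 Real.pi) (i : ι) :
    arg (1 + polar ρ φ / (d i : ℂ)) ≤ (logSum d ρ φ).im := by
  have h := Complex.hasSum_im (summable_logSum hs ρ φ).hasSum
  rw [← log_im]
  exact le_hasSum h i fun j _ => (norm_log_one_add_polar_le hρ (hd j) hφ).1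

/-- The argument of a canonical product is continuous along curves in the closed upper half-plane
avoiding the zeros. -/
lemma continuousOn_im_logSum (hd : ∀ i, 0 < d i) (hs : Summable fun i => (d i)⁻¹) {ψ : ℝ → ℝ}
    (hψ : ContinuousOn ψ (Set.Ioi 0)) (hm : ∀ ρ, 0 < ρ → ψ ρ ∈ Set.Icc 0 Real.pi)
    (hne : ∀ ρ, 0 < ρ → zeroProd d (polar ρ (ψ ρ)) ≠ 0) :
    ContinuousOn (fun ρ => (logSum d ρ (ψ ρ)).im) (Set.Ioi 0) := by
  intro R hR
  rw [Set.mem_Ioi] at hR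
  -- On (0, R + 1) the majorant 2π(R + 1)/d makes the series of arguments converge uniformly.
  have key : ContinuousOn (fun ρ => ∑' i, (log (1 + polar ρ (ψ ρ) / (d i : ℂ))).im)
      (Set.Ioo 0 (R + 1)) := by
    refine continuousOn_tsum (u := fun i => 2 * Real.pi * (R + 1) * (d i)⁻¹) (fun i => ?_)
      (hs.mul_left _) fun i ρ hρ => ?_
    · refine Complex.continuous_im.comp_continuousOn fun ρ hρ => ?_
      have hcw : ContinuousWithinAt (fun ρ => 1 + polar ρ (ψ ρ) / (d i : ℂ))
          (Set.Ioo 0 (R + 1)) ρ := by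
        refine ContinuousWithinAt.const_add (ContinuousWithinAt.div_const ?_ _) _
        exact continuous_polar.continuousAt.comp_continuousWithinAt
          (continuousWithinAt_id.prodMk ((hψ ρ hρ.1).mono Set.Ioo_subset_Ioi_self))
      exact ContinuousWithinAt.comp (g := log) (f := fun ρ => 1 + polar ρ (ψ ρ) / (d i : ℂ))
        (continuousWithinAt_log_upper ((zeroProd_ne_zero_iff hs).1 (hne ρ hρ.1) i)) hcw
        fun s hs => im_one_add_polar_div_nonneg hs.1 (hd i) (hm s hs.1)
    · have h := norm_log_one_add_polar_le hρ.1 (hd i) (hm ρ hρ.1)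
      rw [Real.norm_of_nonneg h.1]
      refine h.2.trans ?_
      have := inv_pos.2 (hd i)
      have := Real.pi_pos
      gcongr
      exact hρ.2.le
  have key2 : ContinuousOn (fun ρ => (logSum d ρ (ψ ρ)).im) (Set.Ioo 0 (R + 1)) :=
    key.congr fun ρ _ => im_tsum (summable_logSum hs ρ (ψ ρ))
  exact (key2.continuousAt (Ioo_mem_nhds hR (by linarith))).continuousWithinAt

end Sums

end MeromorphicZeros

/-! ### The curve of equal moduli and the monotonicity of the phase -/

namespace MeromorphicZeros
open scoped Topology

/-- The data of an equation `zeroProd p u = K ρ ^ τ * (unimodular) * zeroProd q (-u)`, where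
`ρ = ‖u‖`. -/
structure EquationData (ι κ : Type*) where
  /-- The parameters of the first product. -/
  p : ι → ℝ
  /-- The parameters of the second product. -/
  q : κ → ℝ
  /-- The positive constant. -/
  K : ℝ
  /-- The exponent. -/
  τ : ℝ
  p_pos : ∀ i, 0 < p i
  q_pos : ∀ i, 0 < q i
  p_summable : Summable fun i => (p i)⁻¹
  q_summable : Summable fun i => (q i)⁻¹
  K_pos : 0 < K
  nonempty : Nonempty ι ∨ Nonempty κ

namespace EquationData

variable {ι κ : Type*} (D : EquationData ι κ)

/-- The data with the two products interchanged. -/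
noncomputable def swap : EquationData κ ι where
  p := D.q
  q := D.p
  K := D.K⁻¹
  τ := -D.τ
  p_pos := D.q_pos
  q_pos := D.p_pos
  p_summable := D.q_summable
  q_summable := D.p_summable
  K_pos := inv_pos.2 D.K_pos
  nonempty := D.nonempty.symm

lemma swap_p : D.swap.p = D.q := rfl

lemma swap_q : D.swap.q = D.p := rfl

lemma swap_K : D.swap.K = D.K⁻¹ := rfl

lemma swap_τ : D.swap.τ = -D.τ := rfl

/-- The difference of the moduli of the two sides. -/
noncomputable def gap (ρ φ : ℝ) : ℝ :=
  ‖zeroProd D.p (polar ρ φ)‖ - D.K * ρ ^ D.τ * ‖zeroProd D.q (polar ρ (Real.pi - φ))‖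

/-- The argument of the quotient of the two sides. -/
noncomputable def phase (ρ φ : ℝ) : ℝ :=
  (logSum D.p ρ φ).im + (logSum D.q ρ (Real.pi - φ)).im - D.τ * φ

/-- The logarithm of the modulus of the quotient of the two sides. -/
noncomputable def level (ρ φ : ℝ) : ℝ :=
  (logSum D.p ρ φ).re - (logSum D.q ρ (Real.pi - φ)).re - D.τ * Real.log ρ - Real.log D.K

lemma coeff_pos {ρ : ℝ} (hρ : 0 < ρ) : 0 < D.K * ρ ^ D.τ :=
  mul_pos D.K_pos (Real.rpow_pos_of_pos hρ _)

/-- Reflecting φ to π − φ and dividing by Kρ^τ exchanges the two sides of the equation. This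
symmetry later transfers statements at angle 0 to angle π. -/
lemma swap_gap {ρ : ℝ} (hρ : 0 < ρ) (φ : ℝ) :
    D.swap.gap ρ φ = -(D.K * ρ ^ D.τ)⁻¹ * D.gap ρ (Real.pi - φ) := by
  have h := (D.coeff_pos hρ).ne'
  have h2 : D.K⁻¹ * ρ ^ (-D.τ) = (D.K * ρ ^ D.τ)⁻¹ := by
    rw [Real.rpow_neg hρ.le, mul_inv]
  simp only [gap, swap_p, swap_q, swap_K, swap_τ, sub_sub_cancel]
  rw [h2]
  linear_combination (-‖zeroProd D.q (polar ρ φ)‖) * inv_mul_cancel₀ h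

lemma swap_phase (ρ φ : ℝ) :
    D.swap.phase ρ φ = D.phase ρ (Real.pi - φ) + D.τ * Real.pi := by
  simp only [phase, swap_p, swap_q, swap_τ, sub_sub_cancel]
  ring

lemma gap_strictAnti {ρ : ℝ} (hρ : 0 < ρ) {φ₁ φ₂ : ℝ} (h₁ : 0 ≤ φ₁) (h₂ : φ₂ ≤ Real.pi)
    (h : φ₁ < φ₂) : D.gap ρ φ₂ < D.gap ρ φ₁ := by
  have hc := D.coeff_pos hρ
  unfold gap
  rcases D.nonempty with hn | hn
  · have e1 := norm_zeroProd_polar_strictAnti D.p_pos D.p_summable hρ h₁ h₂ h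
    have e2 := norm_zeroProd_polar_anti D.q_pos D.q_summable hρ (sub_nonneg.2 h₂)
      (sub_le_self _ h₁) (sub_le_sub_left h.le Real.pi)
    have := mul_le_mul_of_nonneg_left e2 hc.le
    linarith
  · have e1 := norm_zeroProd_polar_anti D.p_pos D.p_summable hρ h₁ h₂ h.le
    have e2 := norm_zeroProd_polar_strictAnti D.q_pos D.q_summable hρ (sub_nonneg.2 h₂)
      (sub_le_self _ h₁) (sub_lt_sub_left h Real.pi)
    have := mul_lt_mul_of_pos_left e2 hc
    linarith

lemma continuousOn_gap {ψ : ℝ → ℝ} {s : Set ℝ} (hs : s ⊆ Set.Ioi 0) (hψ : ContinuousOn ψ s) :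
    ContinuousOn (fun ρ => D.gap ρ (ψ ρ)) s := by
  have hp := (differentiable_zeroProd D.p_pos D.p_summable).continuous
  have hq := (differentiable_zeroProd D.q_pos D.q_summable).continuous
  have h1 : ContinuousOn (fun ρ => polar ρ (ψ ρ)) s :=
    continuous_polar.comp_continuousOn (continuousOn_id.prodMk hψ)
  have h2 : ContinuousOn (fun ρ => polar ρ (Real.pi - ψ ρ)) s :=
    continuous_polar.comp_continuousOn (continuousOn_id.prodMk (continuousOn_const.sub hψ))
  refine (hp.comp_continuousOn h1).norm.sub (ContinuousOn.mul (continuousOn_const.mul ?_)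
    (hq.comp_continuousOn h2).norm)
  exact continuousOn_id.rpow_const fun x hx => Or.inl (ne_of_gt (hs hx))

lemma continuous_gap (ρ : ℝ) : Continuous (D.gap ρ) := by
  have hp := (differentiable_zeroProd D.p_pos D.p_summable).continuous
  have hq := (differentiable_zeroProd D.q_pos D.q_summable).continuous
  unfold gap
  have h1 : Continuous fun φ => polar ρ φ := by unfold polar; fun_prop
  have h2 : Continuous fun φ => polar ρ (Real.pi - φ) := h1.comp (by fun_prop)
  exact (hp.comp h1).norm.sub (continuous_const.mul (hq.comp h2).norm)

/-- The two implications cover all cases at once: a genuine solution inside satisfies both, while a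
clipped angle 0 or π satisfies one of them vacuously. -/
lemma exists_angle (ρ : ℝ) : ∃ φ ∈ Set.Icc 0 Real.pi,
    (φ < Real.pi → D.gap ρ φ ≤ 0) ∧ (0 < φ → 0 ≤ D.gap ρ φ) := by
  have hpi := Real.pi_pos
  by_cases h0 : D.gap ρ 0 ≤ 0
  · exact ⟨0, ⟨le_rfl, hpi.le⟩, fun _ => h0, fun h => absurd h (lt_irrefl _)⟩
  by_cases h1 : 0 ≤ D.gap ρ Real.pi
  · exact ⟨Real.pi, ⟨hpi.le, le_rfl⟩, fun h => absurd h (lt_irrefl _), fun _ => h1⟩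
  push Not at h0 h1
  obtain ⟨φ, hφ, he⟩ := intermediate_value_Icc' hpi.le (D.continuous_gap ρ).continuousOn
    ⟨h1.le, h0.le⟩
  exact ⟨φ, hφ, fun _ => he.le, fun _ => he.ge⟩

/-- The angle at which the two sides have equal moduli on the half-circle of radius `ρ`, clipped to
the end points of the half-circle if there is no such angle. -/
noncomputable def angle (ρ : ℝ) : ℝ :=
  (D.exists_angle ρ).choose

variable {D} {ρ : ℝ}

lemma angle_spec (D : EquationData ι κ) (ρ : ℝ) : D.angle ρ ∈ Set.Icc 0 Real.pi ∧
    (D.angle ρ < Real.pi → D.gap ρ (D.angle ρ) ≤ 0) ∧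
    (0 < D.angle ρ → 0 ≤ D.gap ρ (D.angle ρ)) :=
  (D.exists_angle ρ).choose_spec

lemma angle_mem (D : EquationData ι κ) (ρ : ℝ) : D.angle ρ ∈ Set.Icc 0 Real.pi :=
  (D.angle_spec ρ).1

lemma pi_sub_angle_mem (D : EquationData ι κ) (ρ : ℝ) :
    Real.pi - D.angle ρ ∈ Set.Icc 0 Real.pi := by
  have := D.angle_mem ρ
  exact ⟨sub_nonneg.2 this.2, sub_le_self _ this.1⟩

lemma lt_angle_iff (hρ : 0 < ρ) {a : ℝ} (ha : a ∈ Set.Ico 0 Real.pi) :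
    a < D.angle ρ ↔ 0 < D.gap ρ a := by
  obtain ⟨h1, h2, h3⟩ := D.angle_spec ρ
  constructor
  · intro h
    exact (h3 (ha.1.trans_lt h)).trans_lt (D.gap_strictAnti hρ ha.1 h1.2 h)
  · intro h
    by_contra! hc
    have := h2 (hc.trans_lt ha.2)
    rcases eq_or_lt_of_le hc with he | hl
    · rw [he] at this; linarith
    · have := D.gap_strictAnti hρ h1.1 ha.2.le hl; linarith

lemma angle_lt_iff (hρ : 0 < ρ) {a : ℝ} (ha : a ∈ Set.Ioc 0 Real.pi) :
    D.angle ρ < a ↔ D.gap ρ a < 0 := by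
  obtain ⟨h1, h2, h3⟩ := D.angle_spec ρ
  constructor
  · intro h
    exact (D.gap_strictAnti hρ h1.1 ha.2 h).trans_le (h2 (h.trans_le ha.2))
  · intro h
    by_contra! hc
    have := h3 (ha.1.trans_le hc)
    rcases eq_or_lt_of_le hc with he | hl
    · rw [← he] at this; linarith
    · have := D.gap_strictAnti hρ ha.1.le h1.2 hl; linarith

lemma eq_angle (hρ : 0 < ρ) {φ : ℝ} (hφ : φ ∈ Set.Icc 0 Real.pi)
    (h1 : φ < Real.pi → D.gap ρ φ ≤ 0) (h2 : 0 < φ → 0 ≤ D.gap ρ φ) : φ = D.angle ρ := by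
  have hm := D.angle_mem ρ
  rcases lt_trichotomy φ (D.angle ρ) with h | h | h
  · have h' := h.trans_le hm.2
    have := (lt_angle_iff hρ ⟨hφ.1, h'⟩).1 h
    linarith [h1 h']
  · exact h
  · have h' := hm.1.trans_lt h
    have := (angle_lt_iff hρ ⟨h', hφ.2⟩).1 h
    linarith [h2 h']

lemma eq_angle_of_gap_eq_zero (hρ : 0 < ρ) {φ : ℝ} (hφ : φ ∈ Set.Icc 0 Real.pi)
    (h : D.gap ρ φ = 0) : φ = D.angle ρ :=
  eq_angle hρ hφ (fun _ => h.le) fun _ => h.ge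

lemma gap_eq_zero_of_mem_Ioo (h : D.angle ρ ∈ Set.Ioo 0 Real.pi) :
    D.gap ρ (D.angle ρ) = 0 :=
  le_antisymm ((D.angle_spec ρ).2.1 h.2) ((D.angle_spec ρ).2.2 h.1)

lemma swap_angle (hρ : 0 < ρ) : D.swap.angle ρ = Real.pi - D.angle ρ := by
  obtain ⟨h1, h2, h3⟩ := D.angle_spec ρ
  have hc := neg_lt_zero.2 (inv_pos.2 (D.coeff_pos hρ))
  symm
  refine eq_angle hρ (D.pi_sub_angle_mem ρ) (fun h => ?_) fun h => ?_
  · rw [D.swap_gap hρ, sub_sub_cancel]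
    exact mul_nonpos_of_nonpos_of_nonneg hc.le (h3 (by linarith))
  · rw [D.swap_gap hρ, sub_sub_cancel]
    exact mul_nonneg_of_nonpos_of_nonpos hc.le (h2 (by linarith))

/-- P can vanish only at φ = π, and there the clipping condition gives |P| ≥ Kρ^τ |Q(ρ)| > 0. -/
lemma zeroProd_p_ne_zero (hρ : 0 < ρ) : zeroProd D.p (polar ρ (D.angle ρ)) ≠ 0 := by
  obtain ⟨h1, h2, h3⟩ := D.angle_spec ρ
  rcases eq_or_lt_of_le h1.2 with h | h
  · intro h0
    have h4 := h3 (by rw [h]; exact Real.pi_pos)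
    rw [gap, h0, norm_zero, zero_sub, h, sub_self] at h4
    have := mul_pos (D.coeff_pos hρ) (norm_pos_iff.2
      (zeroProd_polar_ne_zero D.q_pos D.q_summable hρ ⟨le_refl 0, Real.pi_pos⟩))
    linarith
  · exact zeroProd_polar_ne_zero D.p_pos D.p_summable hρ ⟨h1.1, h⟩

lemma zeroProd_q_ne_zero (hρ : 0 < ρ) :
    zeroProd D.q (polar ρ (Real.pi - D.angle ρ)) ≠ 0 := by
  rw [← swap_angle hρ]
  exact zeroProd_p_ne_zero (D := D.swap) hρ

/-- Comparing the angle with a constant a amounts to the sign of the gap at the fixed angle a, which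
is continuous in ρ; this gives continuity in the order topology. -/
lemma continuousOn_angle : ContinuousOn D.angle (Set.Ioi 0) := by
  intro ρ hρ
  have hm := D.angle_mem ρ
  have hev : ∀ᶠ x in 𝓝[Set.Ioi 0] ρ, x ∈ Set.Ioi (0 : ℝ) := self_mem_nhdsWithin
  rw [ContinuousWithinAt, tendsto_order]
  constructor
  · intro a ha
    rcases lt_or_ge a 0 with h0 | h0
    · filter_upwards [hev] with x hx using h0.trans_le (D.angle_mem x).1
    · have ha' : a ∈ Set.Ico 0 Real.pi := ⟨h0, ha.trans_le hm.2⟩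
      have hg := (lt_angle_iff hρ ha').1 ha
      have hc := (D.continuousOn_gap subset_rfl (continuousOn_const (c := a))) ρ hρ
      filter_upwards [hev, hc.eventually (lt_mem_nhds hg)] with x hx hx'
      exact (lt_angle_iff hx ha').2 hx'
  · intro a ha
    rcases lt_or_ge Real.pi a with h0 | h0
    · filter_upwards [hev] with x hx using (D.angle_mem x).2.trans_lt h0
    · have ha' : a ∈ Set.Ioc 0 Real.pi := ⟨hm.1.trans_lt ha, h0⟩
      have hg := (angle_lt_iff hρ ha').1 ha
      have hc := (D.continuousOn_gap subset_rfl (continuousOn_const (c := a))) ρ hρ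
      filter_upwards [hev, hc.eventually (gt_mem_nhds hg)] with x hx hx'
      exact (angle_lt_iff hx ha').2 hx'

variable (D) in
/-- The argument of the quotient of the two sides along the curve of equal moduli. -/
noncomputable def theta (ρ : ℝ) : ℝ := D.phase ρ (D.angle ρ)

lemma swap_theta (hρ : 0 < ρ) : D.swap.theta ρ = D.theta ρ + D.τ * Real.pi := by
  rw [theta, swap_phase, swap_angle hρ, sub_sub_cancel, theta]

lemma continuousOn_theta : ContinuousOn D.theta (Set.Ioi 0) := by
  refine ContinuousOn.sub (ContinuousOn.add ?_ ?_) (continuousOn_const.mul continuousOn_angle)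
  · exact continuousOn_im_logSum D.p_pos D.p_summable continuousOn_angle (fun ρ _ => D.angle_mem ρ)
      fun _ => zeroProd_p_ne_zero
  · exact continuousOn_im_logSum D.q_pos D.q_summable (continuousOn_const.sub continuousOn_angle)
      (fun ρ _ => D.pi_sub_angle_mem ρ) fun _ => zeroProd_q_ne_zero

lemma level_eq_log (hρ : 0 < ρ) {φ : ℝ} (hp : zeroProd D.p (polar ρ φ) ≠ 0)
    (hq : zeroProd D.q (polar ρ (Real.pi - φ)) ≠ 0) :
    D.level ρ φ = Real.log ‖zeroProd D.p (polar ρ φ)‖ -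
      Real.log (D.K * ρ ^ D.τ * ‖zeroProd D.q (polar ρ (Real.pi - φ))‖) := by
  rw [level, ← norm_zeroProd_polar D.p_summable hp, ← norm_zeroProd_polar D.q_summable hq,
    Real.log_mul (D.coeff_pos hρ).ne' (norm_ne_zero_iff.2 hq),
    Real.log_mul D.K_pos.ne' (Real.rpow_pos_of_pos hρ _).ne', Real.log_rpow hρ]
  ring

lemma level_nonpos_iff (hρ : 0 < ρ) {φ : ℝ} (hp : zeroProd D.p (polar ρ φ) ≠ 0)
    (hq : zeroProd D.q (polar ρ (Real.pi - φ)) ≠ 0) : D.level ρ φ ≤ 0 ↔ D.gap ρ φ ≤ 0 := by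
  rw [level_eq_log hρ hp hq, sub_nonpos, gap, sub_nonpos, Real.log_le_log_iff (norm_pos_iff.2 hp)
    (mul_pos (D.coeff_pos hρ) (norm_pos_iff.2 hq))]

lemma level_nonneg_iff (hρ : 0 < ρ) {φ : ℝ} (hp : zeroProd D.p (polar ρ φ) ≠ 0)
    (hq : zeroProd D.q (polar ρ (Real.pi - φ)) ≠ 0) : 0 ≤ D.level ρ φ ↔ 0 ≤ D.gap ρ φ := by
  rw [level_eq_log hρ hp hq, sub_nonneg, gap, sub_nonneg, Real.log_le_log_iff
    (mul_pos (D.coeff_pos hρ) (norm_pos_iff.2 hq)) (norm_pos_iff.2 hp)]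

/-- The level is 0 where the curve is not clipped, ≤ 0 where it is clipped at angle 0 and ≥ 0 where
it is clipped at π. Thus the point with the smaller angle has level ≤ 0 and the one with the larger
angle has level ≥ 0. -/
lemma level_sub_mul_nonneg {ρ₁ ρ₂ : ℝ} (h₁ : 0 < ρ₁) (h₂ : 0 < ρ₂) :
    0 ≤ (D.level ρ₂ (D.angle ρ₂) - D.level ρ₁ (D.angle ρ₁)) * (D.angle ρ₂ - D.angle ρ₁) := by
  have key : ∀ {r s : ℝ}, 0 < r → 0 < s → D.angle r < D.angle s →
      D.level r (D.angle r) ≤ D.level s (D.angle s) := by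
    intro r s hr hs h
    exact ((level_nonpos_iff hr (zeroProd_p_ne_zero hr) (zeroProd_q_ne_zero hr)).2
      ((D.angle_spec r).2.1 (h.trans_le (D.angle_mem s).2))).trans
      ((level_nonneg_iff hs (zeroProd_p_ne_zero hs) (zeroProd_q_ne_zero hs)).2
      ((D.angle_spec s).2.2 ((D.angle_mem r).1.trans_lt h)))
  rcases lt_trichotomy (D.angle ρ₁) (D.angle ρ₂) with h | h | h
  · exact mul_nonneg (sub_nonneg.2 (key h₁ h₂ h)) (sub_nonneg.2 h.le)
  · rw [h, sub_self, mul_zero]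
  · exact mul_nonneg_of_nonpos_of_nonpos (sub_nonpos.2 (key h₂ h₁ h)) (sub_nonpos.2 h.le)

/-- Adding the inequality for P to that for Q at the reflected angles, the contributions of τ cancel
and Δθ · Δ log ρ ≥ Δlevel · Δangle ≥ 0 remains. Strictness comes from the nonempty product, unless
both points lie on the same real half-axis. -/
lemma theta_sub_mul_log {ρ₁ ρ₂ : ℝ} (h₁ : 0 < ρ₁) (h₂ : 0 < ρ₂) :
    0 ≤ (D.theta ρ₂ - D.theta ρ₁) * (Real.log ρ₂ - Real.log ρ₁) ∧
    (ρ₁ ≠ ρ₂ → (D.angle ρ₁ = D.angle ρ₂ → D.angle ρ₁ ∈ Set.Ioo 0 Real.pi) →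
      0 < (D.theta ρ₂ - D.theta ρ₁) * (Real.log ρ₂ - Real.log ρ₁)) := by
  have e1 := im_logSum_nonneg D.p_pos D.p_summable h₁ h₂ (D.angle_mem ρ₁)
    (D.angle_mem ρ₂) (zeroProd_p_ne_zero h₁) (zeroProd_p_ne_zero h₂)
  have e2 := im_logSum_nonneg D.q_pos D.q_summable h₁ h₂ (D.pi_sub_angle_mem ρ₁)
    (D.pi_sub_angle_mem ρ₂) (zeroProd_q_ne_zero h₁) (zeroProd_q_ne_zero h₂)
  have e3 := level_sub_mul_nonneg (D := D) h₁ h₂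
  rw [im_logSum_mul_conj] at e1 e2
  simp only [theta, phase]
  simp only [level] at e3
  refine ⟨by nlinarith, fun hne hedge => ?_⟩
  rcases D.nonempty with hn | hn
  · have e1' := im_logSum_pos D.p_pos D.p_summable h₁ h₂ (D.angle_mem ρ₁)
      (D.angle_mem ρ₂) (zeroProd_p_ne_zero h₁) (zeroProd_p_ne_zero h₂) (Or.inl hne) hedge
    rw [im_logSum_mul_conj] at e1'
    nlinarith
  · have e2' := im_logSum_pos D.q_pos D.q_summable h₁ h₂ (D.pi_sub_angle_mem ρ₁)
      (D.pi_sub_angle_mem ρ₂) (zeroProd_q_ne_zero h₁) (zeroProd_q_ne_zero h₂) (Or.inl hne)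
      (fun h => by
        have := hedge (by linarith)
        exact ⟨sub_pos.2 this.2, by linarith [this.1]⟩)
    rw [im_logSum_mul_conj] at e2'
    nlinarith

lemma theta_mono {ρ₁ ρ₂ : ℝ} (h₁ : 0 < ρ₁) (h : ρ₁ ≤ ρ₂) : D.theta ρ₁ ≤ D.theta ρ₂ := by
  rcases eq_or_lt_of_le h with rfl | h
  · exact le_rfl
  have := (theta_sub_mul_log (D := D) h₁ (h₁.trans h)).1
  exact sub_nonneg.1 (nonneg_of_mul_nonneg_left this (sub_pos.2 (Real.log_lt_log h₁ h)))

lemma lt_of_theta_lt {ρ₁ ρ₂ : ℝ} (h₂ : 0 < ρ₂) (h : D.theta ρ₁ < D.theta ρ₂) : ρ₁ < ρ₂ := by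
  by_contra! hc
  exact absurd (theta_mono h₂ hc) (not_le.2 h)

lemma angle_of_theta_eq {ρ₁ ρ₂ : ℝ} (h₁ : 0 < ρ₁) (h₂ : 0 < ρ₂) (hne : ρ₁ ≠ ρ₂)
    (h : D.theta ρ₁ = D.theta ρ₂) :
    D.angle ρ₁ = D.angle ρ₂ ∧ (D.angle ρ₁ = 0 ∨ D.angle ρ₁ = Real.pi) := by
  have := (theta_sub_mul_log (D := D) h₁ h₂).2 hne
  rw [h, sub_self, zero_mul] at this
  have h3 : ¬ (D.angle ρ₁ = D.angle ρ₂ → D.angle ρ₁ ∈ Set.Ioo 0 Real.pi) :=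
    fun hc => lt_irrefl _ (this hc)
  push Not at h3
  refine ⟨h3.1, ?_⟩
  by_contra! hc
  have hm := D.angle_mem ρ₁
  exact h3.2 ⟨lt_of_le_of_ne hm.1 hc.1.symm, lt_of_le_of_ne hm.2 hc.2⟩

end EquationData

/-! ### Values of the phase: on the real axis, near the origin, and far enough out -/

lemma im_logSum_of_real {ι : Type*} {d : ι → ℝ} (hs : Summable fun i => (d i)⁻¹) {ρ φ : ℝ}
    (hφ : φ = 0 ∨ φ = Real.pi) (h : zeroProd d (polar ρ φ) ≠ 0) :
    ∃ n : ℤ, (logSum d ρ φ).im = n * Real.pi := by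
  have hr : starRingEnd ℂ (polar ρ φ) = polar ρ φ := by
    rcases hφ with rfl | rfl
    · simp [polar_zero]
    · simp [polar_pi]
  have h1 := zeroProd_conj hs (polar ρ φ)
  rw [hr, eq_comm, conj_eq_iff_im, zeroProd_polar hs h, exp_im] at h1
  have h2 := (mul_eq_zero.1 h1).resolve_left (Real.exp_pos _).ne'
  obtain ⟨n, hn⟩ := Real.sin_eq_zero_iff.1 h2
  exact ⟨n, hn.symm⟩

lemma half_le_arg_one_add_polar {x φ : ℝ} (hx : 1 < x) (hφ : φ ∈ Set.Icc 0 Real.pi) :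
    φ / 2 ≤ arg (1 + polar x φ) := by
  have hpi := Real.pi_pos
  rcases eq_or_lt_of_le hφ.2 with h | h
  · rw [h, polar_pi]
    have : (1 : ℂ) + -(x : ℂ) = ((1 - x : ℝ) : ℂ) := by push_cast; ring
    rw [this, arg_ofReal_of_neg (by linarith)]
    linarith
  -- Factor 1 + xe^(iφ) = e^(iφ/2) y with y = (1 + x) cos(φ/2) + i(x − 1) sin(φ/2). For x > 1, y has
  -- nonnegative argument, so the argument of the product is at least φ/2.
  · set y : ℂ := ⟨(1 + x) * Real.cos (φ / 2), (x - 1) * Real.sin (φ / 2)⟩ with hy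
    have hc : 0 < Real.cos (φ / 2) := Real.cos_pos_of_mem_Ioo ⟨by linarith [hφ.1], by linarith⟩
    have hs : 0 ≤ Real.sin (φ / 2) := Real.sin_nonneg_of_mem_Icc ⟨by linarith [hφ.1], by linarith⟩
    have hre : 0 < y.re := mul_pos (by linarith) hc
    have him : 0 ≤ y.im := mul_nonneg (by linarith) hs
    have harg0 : 0 ≤ arg y := arg_nonneg_iff.2 him
    have harg1 : arg y < Real.pi / 2 := lt_of_abs_lt (abs_arg_lt_pi_div_two_iff.2 (Or.inl hre))
    have hE : arg (exp ((φ / 2 : ℝ) * I)) = φ / 2 := by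
      rw [arg_exp_mul_I]
      exact (toIocMod_eq_self Real.two_pi_pos).2 ⟨by linarith [hφ.1], by linarith⟩
    have hz : 1 + polar x φ = exp ((φ / 2 : ℝ) * I) * y := by
      have e1 : φ = 2 * (φ / 2) := by ring
      have e2 := Real.sin_sq_add_cos_sq (φ / 2)
      apply Complex.ext
      · rw [add_re, polar_re, mul_re, exp_ofReal_mul_I_re, exp_ofReal_mul_I_im, hy, one_re]
        conv_lhs => rw [e1, Real.cos_two_mul]
        linear_combination (x - 1) * e2
      · rw [add_im, polar_im, mul_im, exp_ofReal_mul_I_re, exp_ofReal_mul_I_im, hy, one_im]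
        conv_lhs => rw [e1, Real.sin_two_mul]
        ring
    have hy0 : y ≠ 0 := fun h0 => by rw [h0] at hre; simp at hre
    have := (arg_mul_eq_add_arg_iff (exp_ne_zero ((φ / 2 : ℝ) * I)) hy0).2 (by
      rw [hE]; exact ⟨by linarith [hφ.1], by linarith⟩)
    rw [hz, this, hE]
    linarith

namespace EquationData

variable {ι κ : Type*} {D : EquationData ι κ} {ρ : ℝ}

lemma theta_of_angle_eq_zero (hρ : 0 < ρ) (h : D.angle ρ = 0) :
    ∃ n : ℤ, D.theta ρ = n * Real.pi := by
  obtain ⟨n, hn⟩ := im_logSum_of_real D.p_summable (Or.inl h) (zeroProd_p_ne_zero (D := D) hρ)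
  obtain ⟨m, hm⟩ := im_logSum_of_real D.q_summable (Or.inr (by rw [h, sub_zero]))
    (zeroProd_q_ne_zero (D := D) hρ)
  refine ⟨n + m, ?_⟩
  rw [theta, phase, hn, hm, h]
  push_cast
  ring

lemma theta_of_angle_eq_pi (hρ : 0 < ρ) (h : D.angle ρ = Real.pi) :
    ∃ n : ℤ, D.theta ρ = n * Real.pi - D.τ * Real.pi := by
  obtain ⟨n, hn⟩ := theta_of_angle_eq_zero (D := D.swap) hρ (by rw [swap_angle hρ, h, sub_self])
  rw [swap_theta hρ] at hn
  exact ⟨n, by linarith⟩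

/-- For small ρ the factor ρ^τ makes the right side negligible, so the curve is clipped at π. The
two arguments then add up to a nonnegative multiple of π that is smaller than π, hence to 0, and
only −τπ is left. -/
lemma exists_theta_eq_start (hτ : 0 < D.τ) :
    ∃ r > 0, ∀ ρ, 0 < ρ → ρ ≤ r → D.theta ρ = -(D.τ * Real.pi) := by
  have hpi := Real.pi_pos
  set Sp := ∑' i, (D.p i)⁻¹
  set Sq := ∑' i, (D.q i)⁻¹
  have hg : ContinuousAt (fun ρ => D.gap ρ Real.pi) 0 := by
    have hp := (differentiable_zeroProd D.p_pos D.p_summable).continuous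
    have hq := (differentiable_zeroProd D.q_pos D.q_summable).continuous
    have h1 : Continuous fun ρ => polar ρ Real.pi := by unfold polar; fun_prop
    have h2 : Continuous fun ρ => polar ρ (Real.pi - Real.pi) := by unfold polar; fun_prop
    exact (hp.comp h1).norm.continuousAt.sub ((continuousAt_const.mul
      (Real.continuousAt_rpow_const _ _ (Or.inr hτ.le))).mul (hq.comp h2).norm.continuousAt)
  have hg0 : 0 < D.gap 0 Real.pi := by
    simp [gap, polar, zeroProd_zero, Real.zero_rpow hτ.ne']
  have hs : ContinuousAt (fun ρ => 2 * Real.pi * ρ * Sp + 2 * Real.pi * ρ * Sq) 0 := by fun_prop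
  have hev := (hg.eventually (lt_mem_nhds hg0)).and
    (hs.eventually (gt_mem_nhds (show _ < Real.pi by simpa using hpi)))
  obtain ⟨r, hr, hball⟩ := Metric.eventually_nhds_iff.1 hev
  refine ⟨r / 2, by positivity, fun ρ hρ hρr => ?_⟩
  obtain ⟨hgap, hsum⟩ := hball (y := ρ) (by
    rw [Real.dist_eq, sub_zero, abs_of_pos hρ]; linarith)
  have hangle : D.angle ρ = Real.pi := by
    by_contra hne
    have hlt := lt_of_le_of_ne (D.angle_mem ρ).2 hne
    have := (angle_lt_iff hρ ⟨hpi, le_rfl⟩).1 hlt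
    linarith
  obtain ⟨n, hn⟩ := theta_of_angle_eq_pi hρ hangle
  have e1 := im_logSum_mem D.p_pos D.p_summable hρ (D.angle_mem ρ)
  have e2 := im_logSum_mem D.q_pos D.q_summable hρ (D.pi_sub_angle_mem ρ)
  have e3 : (logSum D.p ρ (D.angle ρ)).im + (logSum D.q ρ (Real.pi - D.angle ρ)).im
      = n * Real.pi := by
    rw [theta, phase] at hn
    rw [hangle] at hn ⊢
    linarith
  have hn0 : n = 0 := by
    have h1 : (n : ℝ) * Real.pi < 1 * Real.pi := by
      rw [← e3]; linarith [e1.2, e2.2]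
    have h2 : (0 : ℝ) ≤ n * Real.pi := by rw [← e3]; linarith [e1.1, e2.1]
    have h3 : (n : ℝ) < 1 := lt_of_mul_lt_mul_right h1 hpi.le
    have h4 : (0 : ℝ) ≤ n := nonneg_of_mul_nonneg_left h2 hpi
    have h3' : n < 1 := by exact_mod_cast h3
    have h4' : 0 ≤ n := by exact_mod_cast h4
    omega
  rw [hn, hn0]
  push_cast
  ring

lemma start_le_theta (hτ : 0 < D.τ) (hρ : 0 < ρ) : -(D.τ * Real.pi) ≤ D.theta ρ := by
  obtain ⟨r, hr, h⟩ := exists_theta_eq_start hτ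
  rw [← h (min r ρ) (lt_min hr hρ) (min_le_left _ _)]
  exact theta_mono (lt_min hr hρ) (min_le_right _ _)

lemma half_angle_le {ι : Type*} {d : ι → ℝ} (hd : ∀ i, 0 < d i) (hs : Summable fun i => (d i)⁻¹)
    {ρ φ : ℝ} (i : ι) (hρ : d i < ρ) (hφ : φ ∈ Set.Icc 0 Real.pi) :
    φ / 2 ≤ (logSum d ρ φ).im := by
  refine (half_le_arg_one_add_polar ((one_lt_div (hd i)).2 hρ) hφ).trans ?_
  have h : polar (ρ / d i) φ = polar ρ φ / d i := by
    unfold polar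
    push_cast
    ring
  rw [h]
  exact im_log_le_im_logSum hd hs ((hd i).trans hρ) hφ i

/-- A single factor of P at a radius beyond its parameter contributes at least φ/2, so θ ≥ −(τ −
1/2)φ. If P is empty, a factor of Q contributes (π − φ)/2, which suffices once φ ≤ π/2. For τ = J +
1/2 the bound is −Jπ, high enough for the first zero. -/
lemma exists_le_theta (hτ : 1 / 2 ≤ D.τ) :
    ∃ ρ > 0, -((D.τ - 1 / 2) * Real.pi) ≤ D.theta ρ := by
  rcases isEmpty_or_nonempty ι with hp | ⟨⟨i⟩⟩
  · obtain ⟨i⟩ := D.nonempty.resolve_left (not_nonempty_iff.2 hp)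
    have hτ0 : 0 < D.τ := by linarith
    obtain ⟨ρ, hρK, hρi⟩ := (((tendsto_rpow_atTop hτ0).eventually_ge_atTop D.K⁻¹).and
      (eventually_gt_atTop (D.q i))).exists
    have h0 : 0 < ρ := (D.q_pos i).trans hρi
    have hpi := Real.pi_pos
    have hmem : Real.pi / 2 ∈ Set.Ico 0 Real.pi := ⟨by linarith, by linarith⟩
    -- On the imaginary axis P = 1 and |Q| ≥ 1, so Kρ^τ ≥ 1 excludes a positive gap there.
    have hangle : D.angle ρ ≤ Real.pi / 2 := by
      by_contra! hc
      have hg := (lt_angle_iff h0 hmem).1 hc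
      have hq : zeroProd D.q (polar ρ (Real.pi / 2)) ≠ 0 :=
        zeroProd_polar_ne_zero D.q_pos D.q_summable h0 hmem
      have hq1 : 1 ≤ ‖zeroProd D.q (polar ρ (Real.pi / 2))‖ := by
        rw [zeroProd_polar D.q_summable hq, norm_exp, Real.one_le_exp_iff]
        refine (Complex.hasSum_re (summable_logSum D.q_summable _ _).hasSum).nonneg fun j => ?_
        rw [log_re]
        refine Real.log_nonneg ?_
        refine le_trans ?_ (re_le_norm _)
        rw [add_re, div_ofReal_re, polar_re, Real.cos_pi_div_two]
        simp
      have hp1 : zeroProd D.p (polar ρ (Real.pi / 2)) = 1 := by simp [zeroProd]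
      have hK : 1 ≤ D.K * ρ ^ D.τ := by
        have := mul_le_mul_of_nonneg_left hρK D.K_pos.le
        rwa [mul_inv_cancel₀ D.K_pos.ne'] at this
      rw [gap, hp1, norm_one, show Real.pi - Real.pi / 2 = Real.pi / 2 by ring] at hg
      nlinarith
    refine ⟨ρ, h0, ?_⟩
    have h1 := half_angle_le D.q_pos D.q_summable i hρi (D.pi_sub_angle_mem ρ)
    have h2 := (im_logSum_mem D.p_pos D.p_summable h0 (D.angle_mem ρ)).1
    have h3 := D.angle_mem ρ
    rw [theta, phase]
    nlinarith [h3.1, h3.2]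
  · have hρ : D.p i < 2 * D.p i := by linarith [D.p_pos i]
    have h0 : 0 < 2 * D.p i := (D.p_pos i).trans hρ
    refine ⟨_, h0, ?_⟩
    have h3 := D.angle_mem (2 * D.p i)
    have h1 := half_angle_le D.p_pos D.p_summable i hρ h3
    have h2 := (im_logSum_mem D.q_pos D.q_summable h0 (D.pi_sub_angle_mem (2 * D.p i))).1
    rw [theta, phase]
    nlinarith [h3.1, h3.2]

end EquationData

end MeromorphicZeros

/-! ### Equal moduli on the real axis: endpoints of level sets and the slope -/

namespace MeromorphicZeros
open scoped Topology

/-- Dividing by `f x` first moves the value to 1, where the principal logarithm is differentiable.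
-/
lemma hasDerivAt_log_norm {f : ℂ → ℂ} {f' : ℂ} {x : ℝ} (hf : HasDerivAt f f' x)
    (h0 : f x ≠ 0) : HasDerivAt (fun y : ℝ => Real.log ‖f y‖) (f' / f x).re x := by
  have h1 : HasDerivAt (fun y : ℝ => f y / f x) (f' / f x) x :=
    hf.comp_ofReal.div_const _
  have h2 : HasDerivAt (fun y : ℝ => log (f y / f x)) (f' / f x) x := by
    simpa [div_self h0] using h1.clog_real (by simp [div_self h0])
  have h3 : HasDerivAt (fun y : ℝ => (log (f y / f x)).re + Real.log ‖f x‖) (f' / f x).re x :=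
    (reCLM.hasFDerivAt.comp_hasDerivAt x h2).add_const _
  refine h3.congr_of_eventuallyEq ?_
  filter_upwards [hf.comp_ofReal.continuousAt.eventually_ne h0] with y hy
  rw [log_re, norm_div, Real.log_div (norm_ne_zero_iff.2 hy) (norm_ne_zero_iff.2 h0)]
  ring

section ZeroSum

variable {ι : Type*} {d : ι → ℝ}

lemma hasSum_zeroSum_ofReal (hd : ∀ i, 0 < d i) (hs : Summable fun i => (d i)⁻¹) (x : ℝ) :
    HasSum (fun i => x / (x + d i)) (zeroSum d x).re := by
  have := Complex.hasSum_re (summable_inv_add hd hs x).hasSum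
  refine this.congr_fun fun i => ?_
  rw [← ofReal_add, ← ofReal_div, ofReal_re]

lemma zeroSum_conj (u : ℂ) : zeroSum d (starRingEnd ℂ u) = starRingEnd ℂ (zeroSum d u) := by
  rw [zeroSum, zeroSum, conj_tsum]
  simp

lemma hasDerivAt_zeroProd (hd : ∀ i, 0 < d i) (hs : Summable fun i => (d i)⁻¹) {u : ℂ}
    (hu : u ≠ 0) (h0 : zeroProd d u ≠ 0) :
    HasDerivAt (zeroProd d) (zeroProd d u * zeroSum d u / u) u := by
  refine (differentiable_zeroProd hd hs u).hasDerivAt.congr_deriv ?_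
  rw [← mul_logDeriv_zeroProd hd hs h0, logDeriv_apply]
  field_simp

lemma analyticAt_zeroSum (hd : ∀ i, 0 < d i) (hs : Summable fun i => (d i)⁻¹) {u : ℂ}
    (h0 : zeroProd d u ≠ 0) : AnalyticAt ℂ (zeroSum d) u := by
  have ha : AnalyticAt ℂ (zeroProd d) u := (differentiable_zeroProd hd hs).analyticAt u
  have : AnalyticAt ℂ (fun v => v * (deriv (zeroProd d) v / zeroProd d v)) u :=
    analyticAt_id.mul (ha.deriv.div ha h0)
  refine this.congr ?_
  filter_upwards [ha.continuousAt.eventually_ne h0] with v hv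
  rw [← mul_logDeriv_zeroProd hd hs hv, logDeriv_apply]

/-- A bound linear in Im u, uniform up to the real axis, is needed to exclude a vanishing derivative
at boundary points. -/
lemma div_mul_im_le_im_zeroSum (hd : ∀ i, 0 < d i) (hs : Summable fun i => (d i)⁻¹) (i : ι)
    {R : ℝ} {u : ℂ} (hu : 0 ≤ u.im) (hn : ‖u‖ ≤ R) :
    d i / (R + d i) ^ 2 * u.im ≤ (zeroSum d u).im := by
  refine le_trans ?_ (im_zeroSum_nonneg hd hs hu i)
  have hdi := hd i
  rcases eq_or_lt_of_le hu with h0 | h0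
  · rw [← h0]; simp
  have hne : u + d i ≠ 0 := fun h => by
    have := congrArg Complex.im h
    simp at this
    linarith
  rw [div_mul_eq_mul_div]
  refine div_le_div_of_nonneg_left (mul_pos hdi h0).le (normSq_pos.2 hne) ?_
  rw [normSq_eq_norm_sq]
  have : ‖u + d i‖ ≤ R + d i := by
    refine (norm_add_le _ _).trans ?_
    rw [norm_real, Real.norm_of_nonneg hdi.le]
    linarith
  gcongr

lemma zeroSum_im_nonneg (hd : ∀ i, 0 < d i) (hs : Summable fun i => (d i)⁻¹) {u : ℂ}
    (hu : 0 ≤ u.im) : 0 ≤ (zeroSum d u).im := by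
  rcases isEmpty_or_nonempty ι with h | ⟨⟨i⟩⟩
  · simp [zeroSum]
  · exact (div_nonneg (mul_nonneg (hd i).le hu) (normSq_nonneg _)).trans
      (im_zeroSum_nonneg hd hs hu i)

end ZeroSum

namespace EquationData

variable {ι κ : Type*} {D : EquationData ι κ} {ρ : ℝ}

variable (D) in
/-- Twice the logarithmic derivative, with respect to `log u`, of the quotient of the two sides. -/
noncomputable def slope (u : ℂ) : ℂ := 2 * zeroSum D.p u - 2 * zeroSum D.q (-u) - 2 * D.τ

lemma swap_slope (u : ℂ) : D.swap.slope u = -D.slope (-u) := by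
  rw [slope, slope, swap_p, swap_q, swap_τ, neg_neg]
  push_cast
  ring

lemma slope_im_of_real (x : ℝ) : (D.slope x).im = 0 := by
  have h2 : starRingEnd ℂ 2 = 2 := conj_ofNat 2
  rw [← conj_eq_iff_im, slope]
  simp [← zeroSum_conj, h2]

/-- All terms are monotone between poles, and the nonvanishing of Q(−x) on the whole interval keeps
every pole outside it. As the slope is twice the derivative of `edge` with respect to log ρ, this is
strict convexity of `edge` in log ρ. -/
lemma slope_strictMono {a b : ℝ} (ha : 0 < a) (hab : a < b)
    (hq : ∀ x ∈ Set.Icc a b, zeroProd D.q (-x) ≠ 0) : (D.slope a).re < (D.slope b).re := by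
  have hre : ∀ x : ℝ, (D.slope x).re =
      2 * (zeroSum D.p x).re - 2 * (zeroSum D.q ((-x : ℝ) : ℂ)).re - 2 * D.τ := fun x => by
    simp [slope]
  have hp1 := hasSum_zeroSum_ofReal D.p_pos D.p_summable
  have hq1 := hasSum_zeroSum_ofReal D.q_pos D.q_summable
  have tp : ∀ i, a / (a + D.p i) < b / (b + D.p i) := fun i => by
    have := D.p_pos i
    rw [div_lt_div_iff₀ (by linarith) (by linarith)]
    nlinarith
  have tq : ∀ i, -b / (-b + D.q i) < -a / (-a + D.q i) := fun i => by
    have hqi := D.q_pos i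
    have hout : D.q i < a ∨ b < D.q i := by
      by_contra! hc
      refine (zeroProd_ne_zero_iff D.q_summable).1 (hq (D.q i) hc) i ?_
      have : (D.q i : ℂ) ≠ 0 := by exact_mod_cast hqi.ne'
      rw [neg_div, div_self this, add_neg_cancel]
    rcases hout with h | h
    · rw [← neg_div_neg_eq (-b), ← neg_div_neg_eq (-a), div_lt_div_iff₀ (by linarith) (by linarith)]
      nlinarith
    · rw [div_lt_div_iff₀ (by linarith) (by linarith)]
      nlinarith
  rw [hre, hre]
  rcases D.nonempty with ⟨⟨i⟩⟩ | ⟨⟨i⟩⟩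
  · have h1 := hasSum_lt (fun i => (tp i).le) (tp i) (hp1 a) (hp1 b)
    have h2 := hasSum_le (fun i => (tq i).le) (hq1 (-b)) (hq1 (-a))
    linarith
  · have h1 := hasSum_le (fun i => (tp i).le) (hp1 a) (hp1 b)
    have h2 := hasSum_lt (fun i => (tq i).le) (tq i) (hq1 (-b)) (hq1 (-a))
    linarith

variable (D) in
/-- The logarithm of the quotient of the moduli of the two sides on the positive half-line. -/
noncomputable def edge (ρ : ℝ) : ℝ :=
  Real.log ‖zeroProd D.p ρ‖ - Real.log ‖zeroProd D.q (-ρ)‖ - D.τ * Real.log ρ - Real.log D.K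

lemma zeroProd_ofReal_ne_zero {ι : Type*} {d : ι → ℝ} (hd : ∀ i, 0 < d i)
    (hs : Summable fun i => (d i)⁻¹) (hρ : 0 < ρ) : zeroProd d ρ ≠ 0 := by
  have := zeroProd_polar_ne_zero hd hs hρ ⟨le_refl 0, Real.pi_pos⟩
  rwa [polar_zero] at this

lemma edge_eq (hρ : 0 < ρ) (hq : zeroProd D.q (-ρ) ≠ 0) :
    D.edge ρ = Real.log ‖zeroProd D.p ρ‖ - Real.log (D.K * ρ ^ D.τ * ‖zeroProd D.q (-ρ)‖) := by
  rw [Real.log_mul (D.coeff_pos hρ).ne' (norm_ne_zero_iff.2 hq),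
    Real.log_mul D.K_pos.ne' (Real.rpow_pos_of_pos hρ _).ne', Real.log_rpow hρ, edge]
  ring

lemma gap_zero (ρ : ℝ) :
    D.gap ρ 0 = ‖zeroProd D.p ρ‖ - D.K * ρ ^ D.τ * ‖zeroProd D.q (-ρ)‖ := by
  rw [gap, polar_zero, sub_zero, polar_pi]

lemma edge_nonpos_iff (hρ : 0 < ρ) (hq : zeroProd D.q (-ρ) ≠ 0) :
    D.edge ρ ≤ 0 ↔ D.gap ρ 0 ≤ 0 := by
  have hp := zeroProd_ofReal_ne_zero D.p_pos D.p_summable hρ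
  rw [edge_eq hρ hq, gap_zero, sub_nonpos, sub_nonpos, Real.log_le_log_iff (norm_pos_iff.2 hp)
    (mul_pos (D.coeff_pos hρ) (norm_pos_iff.2 hq))]

lemma edge_nonneg_iff (hρ : 0 < ρ) (hq : zeroProd D.q (-ρ) ≠ 0) :
    0 ≤ D.edge ρ ↔ 0 ≤ D.gap ρ 0 := by
  have hp := zeroProd_ofReal_ne_zero D.p_pos D.p_summable hρ
  rw [edge_eq hρ hq, gap_zero, sub_nonneg, sub_nonneg, Real.log_le_log_iff
    (mul_pos (D.coeff_pos hρ) (norm_pos_iff.2 hq)) (norm_pos_iff.2 hp)]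

lemma hasDerivAt_edge (hρ : 0 < ρ) (hq : zeroProd D.q (-ρ) ≠ 0) :
    HasDerivAt D.edge ((D.slope ρ).re / (2 * ρ)) ρ := by
  have hρ0 : (ρ : ℂ) ≠ 0 := by exact_mod_cast hρ.ne'
  have hp := zeroProd_ofReal_ne_zero D.p_pos D.p_summable hρ
  have h1 := hasDerivAt_log_norm (hasDerivAt_zeroProd D.p_pos D.p_summable hρ0 hp) hp
  have h2' : HasDerivAt (fun u : ℂ => zeroProd D.q (-u))
      (zeroProd D.q (-ρ) * zeroSum D.q (-ρ) / (-ρ) * (-1)) (ρ : ℂ) :=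
    (hasDerivAt_zeroProd D.q_pos D.q_summable (neg_ne_zero.2 hρ0) hq).comp (ρ : ℂ)
      (hasDerivAt_neg _)
  have h2 := hasDerivAt_log_norm h2' hq
  have h3 := ((h1.sub h2).sub ((Real.hasDerivAt_log hρ.ne').const_mul D.τ)).sub_const
    (Real.log D.K)
  refine h3.congr_deriv ?_
  have e1 : zeroProd D.p ρ * zeroSum D.p ρ / ρ / zeroProd D.p ρ = zeroSum D.p ρ / ρ := by
    field_simp
  have e2 : zeroProd D.q (-ρ) * zeroSum D.q (-ρ) / (-ρ) * (-1) / zeroProd D.q (-ρ)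
      = zeroSum D.q (-ρ) / ρ := by
    field_simp
  rw [e1, e2, div_ofReal_re, div_ofReal_re, slope]
  simp
  field_simp

variable (D) in
/-- The radii at which the argument has the value `t`. -/
def levelSet (t : ℝ) : Set ℝ := {ρ | 0 < ρ ∧ D.theta ρ = t}

variable (D) in
/-- The two sides have equal moduli somewhere on the half-circle of radius `ρ`. -/
def Active (ρ : ℝ) : Prop := D.gap ρ (D.angle ρ) = 0

lemma angle_eq_zero_of_gap_nonpos (hρ : 0 < ρ) (h : D.gap ρ 0 ≤ 0) : D.angle ρ = 0 := by
  refine le_antisymm ?_ (D.angle_mem ρ).1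
  by_contra! hc
  exact absurd ((lt_angle_iff hρ ⟨le_rfl, Real.pi_pos⟩).1 hc) (not_lt.2 h)

/-- Where the angle is 0 the phase lies in πℤ; being continuous, it is locally constant there. -/
lemma eventually_theta_eq (hρ : 0 < ρ) (h0 : D.angle ρ = 0) {l : Filter ℝ} (hl : l ≤ 𝓝 ρ)
    (h : ∀ᶠ r in l, D.gap r 0 ≤ 0) : ∀ᶠ r in l, r ∈ D.levelSet (D.theta ρ) := by
  have hpi := Real.pi_pos
  have hc : ContinuousAt D.theta ρ := continuousOn_theta.continuousAt (Ioi_mem_nhds hρ)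
  have h1 : ∀ᶠ r in 𝓝 ρ, |D.theta r - D.theta ρ| < Real.pi := by
    simpa [Real.dist_eq] using Metric.tendsto_nhds.1 hc Real.pi hpi
  obtain ⟨n, hn⟩ := theta_of_angle_eq_zero hρ h0
  filter_upwards [h, hl h1, hl (Ioi_mem_nhds hρ)] with r hr hr1 hr0
  obtain ⟨m, hm⟩ := theta_of_angle_eq_zero hr0 (angle_eq_zero_of_gap_nonpos hr0 hr)
  refine ⟨hr0, ?_⟩
  rw [hm, hn, ← sub_mul, abs_mul, abs_of_pos hpi, mul_lt_iff_lt_one_left hpi] at hr1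
  have : |m - n| < 1 := by exact_mod_cast hr1
  rw [hm, hn, sub_eq_zero.1 (Int.abs_lt_one_iff.1 this)]

/-- Monotonicity makes the phase constant on [a, b], and a constant phase keeps the angle constant.
-/
lemma angle_eq_zero_of_mem {a b r : ℝ} (ha : 0 < a) (h : D.theta a = D.theta b) (h0 : D.angle a = 0)
    (hr : r ∈ Set.Icc a b) : D.angle r = 0 := by
  rcases eq_or_lt_of_le hr.1 with rfl | h1
  · exact h0
  · have e : D.theta a = D.theta r :=
      le_antisymm (theta_mono ha h1.le) (h ▸ theta_mono (ha.trans h1) hr.2)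
    rw [← (angle_of_theta_eq ha (ha.trans h1) h1.ne e).1, h0]

lemma zeroProd_neg_ne_zero (hρ : 0 < ρ) (h : D.angle ρ = 0) : zeroProd D.q (-ρ) ≠ 0 := by
  have := zeroProd_q_ne_zero (D := D) hρ
  rwa [h, sub_zero, polar_pi] at this

lemma gap_zero_nonpos (h : D.angle ρ = 0) : D.gap ρ 0 ≤ 0 := by
  have := (D.angle_spec ρ).2.1
  rw [h] at this
  exact this Real.pi_pos

/-- On the level interval `edge` is ≤ 0, and it is 0 at the active radius ρ. A nonnegative slope at
ρ would, by convexity, make `edge` strictly increase, hence become positive, to the right. -/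
lemma slope_neg_of_lt {s : ℝ} (hρ : 0 < ρ) (h0 : D.angle ρ = 0) (ha : D.Active ρ) (hs : ρ < s)
    (h : D.theta s = D.theta ρ) : (D.slope ρ).re < 0 := by
  by_contra! hc
  have hz : ∀ r ∈ Set.Icc ρ s, D.angle r = 0 := fun r hr =>
    angle_eq_zero_of_mem hρ h.symm h0 hr
  have hq : ∀ r ∈ Set.Icc ρ s, zeroProd D.q (-r) ≠ 0 := fun r hr =>
    zeroProd_neg_ne_zero (hρ.trans_le hr.1) (hz r hr)
  have hd : ∀ r ∈ Set.Icc ρ s, HasDerivAt D.edge ((D.slope r).re / (2 * r)) r := fun r hr =>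
    hasDerivAt_edge (hρ.trans_le hr.1) (hq r hr)
  have hmono : StrictMonoOn D.edge (Set.Icc ρ s) := by
    refine strictMonoOn_of_deriv_pos (convex_Icc _ _)
      (fun r hr => (hd r hr).continuousAt.continuousWithinAt) fun r hr => ?_
    rw [interior_Icc] at hr
    rw [(hd r (Set.Ioo_subset_Icc_self hr)).deriv]
    have h1 := slope_strictMono hρ hr.1 fun x hx => hq x ⟨hx.1, hx.2.trans hr.2.le⟩
    exact div_pos (hc.trans_lt h1) (by linarith [hr.1])
  have hl := Set.left_mem_Icc.2 hs.le
  have hr := Set.right_mem_Icc.2 hs.le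
  have h2 := hmono hl hr hs
  have h3 := (edge_nonpos_iff (hρ.trans hs) (hq s hr)).2 (gap_zero_nonpos (hz s hr))
  have h4 := (edge_nonneg_iff hρ (hq ρ hl)).2 (by rw [Active, h0] at ha; exact ha.ge)
  linarith

lemma slope_pos_of_lt {s : ℝ} (hs : 0 < s) (h0 : D.angle ρ = 0) (ha : D.Active ρ) (hsρ : s < ρ)
    (h : D.theta s = D.theta ρ) : 0 < (D.slope ρ).re := by
  by_contra! hc
  have hρ := hs.trans hsρ
  have hz : ∀ r ∈ Set.Icc s ρ, D.angle r = 0 := fun r hr =>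
    angle_eq_zero_of_mem hs h ((angle_of_theta_eq hs hρ hsρ.ne h).1.trans h0) hr
  have hq : ∀ r ∈ Set.Icc s ρ, zeroProd D.q (-r) ≠ 0 := fun r hr =>
    zeroProd_neg_ne_zero (hs.trans_le hr.1) (hz r hr)
  have hd : ∀ r ∈ Set.Icc s ρ, HasDerivAt D.edge ((D.slope r).re / (2 * r)) r := fun r hr =>
    hasDerivAt_edge (hs.trans_le hr.1) (hq r hr)
  have hmono : StrictAntiOn D.edge (Set.Icc s ρ) := by
    refine strictAntiOn_of_deriv_neg (convex_Icc _ _)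
      (fun r hr => (hd r hr).continuousAt.continuousWithinAt) fun r hr => ?_
    rw [interior_Icc] at hr
    rw [(hd r (Set.Ioo_subset_Icc_self hr)).deriv]
    have h1 := slope_strictMono (hs.trans hr.1) hr.2 fun x hx => hq x ⟨hr.1.le.trans hx.1, hx.2⟩
    exact div_neg_of_neg_of_pos (h1.trans_le hc) (by linarith [hr.1])
  have hl := Set.left_mem_Icc.2 hsρ.le
  have hr := Set.right_mem_Icc.2 hsρ.le
  have h2 := hmono hl hr hsρ
  have h3 := (edge_nonpos_iff hs (hq s hl)).2 (gap_zero_nonpos (hz s hl))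
  have h4 := (edge_nonneg_iff hρ (hq ρ hr)).2 (by rw [Active, h0] at ha; exact ha.ge)
  linarith

lemma eventually_gap_nonpos (hρ : 0 < ρ) (hq : zeroProd D.q (-ρ) ≠ 0) {l : Filter ℝ}
    (hl : l ≤ 𝓝 ρ) (h : ∀ᶠ r in l, D.edge r < 0) : ∀ᶠ r in l, D.gap r 0 ≤ 0 := by
  have hc : ContinuousAt (fun r : ℝ => zeroProd D.q (-r)) ρ :=
    ((differentiable_zeroProd D.q_pos D.q_summable).continuous.comp (by fun_prop)).continuousAt
  filter_upwards [h, hl (hc.eventually_ne hq), hl (Ioi_mem_nhds hρ)] with r h1 h2 h3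
  exact (edge_nonpos_iff h3 h2).1 h1.le

lemma edge_eq_zero (hρ : 0 < ρ) (h0 : D.angle ρ = 0) (ha : D.Active ρ) : D.edge ρ = 0 := by
  have hq := zeroProd_neg_ne_zero hρ h0
  rw [Active, h0] at ha
  exact le_antisymm ((edge_nonpos_iff hρ hq).2 ha.le) ((edge_nonneg_iff hρ hq).2 ha.ge)

/-- A negative derivative makes `edge` negative just to the right; there the curve stays clipped at
0 and the phase does not move. -/
lemma exists_gt_of_slope_neg (hρ : 0 < ρ) (h0 : D.angle ρ = 0) (ha : D.Active ρ)
    (hs : (D.slope ρ).re < 0) : ∃ s ∈ D.levelSet (D.theta ρ), ρ < s := by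
  have hq := zeroProd_neg_ne_zero hρ h0
  have hd := hasDerivAt_edge hρ hq
  have hneg : ∀ᶠ r in 𝓝[>] ρ, D.edge r < 0 := by
    have h1 := (hasDerivWithinAt_iff_tendsto_slope' (Set.self_notMem_Ioi)).1
      (hd.hasDerivWithinAt (s := Set.Ioi ρ))
    filter_upwards [h1.eventually
      (gt_mem_nhds (div_neg_of_neg_of_pos hs (by linarith : 0 < 2 * ρ))),
      self_mem_nhdsWithin] with r hr hr'
    rw [slope_def_field, edge_eq_zero hρ h0 ha, sub_zero] at hr
    exact (div_neg_iff.1 hr).elim (fun h => absurd h.2 (not_lt.2 (sub_pos.2 hr').le)) fun h => h.1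
  have := eventually_theta_eq hρ h0 nhdsWithin_le_nhds
    (eventually_gap_nonpos hρ hq nhdsWithin_le_nhds hneg)
  obtain ⟨s, h1, h2⟩ := (this.and self_mem_nhdsWithin).exists
  exact ⟨s, h1, h2⟩

lemma exists_lt_of_slope_pos (hρ : 0 < ρ) (h0 : D.angle ρ = 0) (ha : D.Active ρ)
    (hs : 0 < (D.slope ρ).re) : ∃ s ∈ D.levelSet (D.theta ρ), s < ρ := by
  have hq := zeroProd_neg_ne_zero hρ h0
  have hd := hasDerivAt_edge hρ hq
  have hneg : ∀ᶠ r in 𝓝[<] ρ, D.edge r < 0 := by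
    have h1 := (hasDerivWithinAt_iff_tendsto_slope' (Set.self_notMem_Iio)).1
      (hd.hasDerivWithinAt (s := Set.Iio ρ))
    filter_upwards [h1.eventually (lt_mem_nhds (div_pos hs (by linarith : 0 < 2 * ρ))),
      self_mem_nhdsWithin] with r hr hr'
    rw [slope_def_field, edge_eq_zero hρ h0 ha, sub_zero] at hr
    exact (div_pos_iff.1 hr).elim (fun h => absurd h.2 (not_lt.2 (sub_neg.2 hr').le)) fun h => h.1
  have := eventually_theta_eq hρ h0 nhdsWithin_le_nhds
    (eventually_gap_nonpos hρ hq nhdsWithin_le_nhds hneg)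
  obtain ⟨s, h1, h2⟩ := (this.and self_mem_nhdsWithin).exists
  exact ⟨s, h1, h2⟩

/-- A strictly negative gap persists nearby, so ρ is interior to its level set. -/
lemma exists_lt_gt_of_not_active (hρ : 0 < ρ) (h0 : D.angle ρ = 0) (ha : ¬ D.Active ρ) :
    (∃ s ∈ D.levelSet (D.theta ρ), s < ρ) ∧ ∃ s ∈ D.levelSet (D.theta ρ), ρ < s := by
  rw [Active, h0] at ha
  have hg : D.gap ρ 0 < 0 := lt_of_le_of_ne (gap_zero_nonpos h0) ha
  have hc : ContinuousAt (fun r => D.gap r 0) ρ :=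
    (D.continuousOn_gap subset_rfl continuousOn_const).continuousAt (Ioi_mem_nhds hρ)
  have hev := eventually_theta_eq hρ h0 le_rfl
    ((hc.eventually (gt_mem_nhds hg)).mono fun r hr => hr.le)
  constructor
  · obtain ⟨s, h1, h2⟩ := ((hev.filter_mono nhdsWithin_le_nhds).and
      (self_mem_nhdsWithin (s := Set.Iio ρ))).exists
    exact ⟨s, h1, h2⟩
  · obtain ⟨s, h1, h2⟩ := ((hev.filter_mono nhdsWithin_le_nhds).and
      (self_mem_nhdsWithin (s := Set.Ioi ρ))).exists
    exact ⟨s, h1, h2⟩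

lemma isGreatest_iff_of_angle_eq_zero (hρ : 0 < ρ) (h0 : D.angle ρ = 0) :
    IsGreatest (D.levelSet (D.theta ρ)) ρ ↔ D.Active ρ ∧ 0 ≤ (D.slope ρ).re := by
  constructor
  · intro h
    have ha : D.Active ρ := by
      by_contra ha
      obtain ⟨-, s, h1, h2⟩ := exists_lt_gt_of_not_active hρ h0 ha
      exact absurd (h.2 h1) (not_le.2 h2)
    refine ⟨ha, ?_⟩
    by_contra! hc
    obtain ⟨s, h1, h2⟩ := exists_gt_of_slope_neg hρ h0 ha hc
    exact absurd (h.2 h1) (not_le.2 h2)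
  · rintro ⟨ha, hs⟩
    refine ⟨⟨hρ, rfl⟩, fun s hsm => ?_⟩
    by_contra! hc
    exact absurd (slope_neg_of_lt hρ h0 ha hc hsm.2) (not_lt.2 hs)

lemma isLeast_iff_of_angle_eq_zero (hρ : 0 < ρ) (h0 : D.angle ρ = 0) :
    IsLeast (D.levelSet (D.theta ρ)) ρ ↔ D.Active ρ ∧ (D.slope ρ).re ≤ 0 := by
  constructor
  · intro h
    have ha : D.Active ρ := by
      by_contra ha
      obtain ⟨⟨s, h1, h2⟩, -⟩ := exists_lt_gt_of_not_active hρ h0 ha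
      exact absurd (h.2 h1) (not_le.2 h2)
    refine ⟨ha, ?_⟩
    by_contra! hc
    obtain ⟨s, h1, h2⟩ := exists_lt_of_slope_pos hρ h0 ha hc
    exact absurd (h.2 h1) (not_le.2 h2)
  · rintro ⟨ha, hs⟩
    refine ⟨⟨hρ, rfl⟩, fun s hsm => ?_⟩
    by_contra! hc
    exact absurd (slope_pos_of_lt hsm.1 h0 ha hc hsm.2) (not_lt.2 hs)

lemma swap_levelSet (t : ℝ) : D.swap.levelSet (t + D.τ * Real.pi) = D.levelSet t := by
  ext r
  refine and_congr_right fun hr => ?_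
  rw [swap_theta hr, add_left_inj]

lemma swap_active_iff (hρ : 0 < ρ) : D.swap.Active ρ ↔ D.Active ρ := by
  have h := neg_ne_zero.2 (inv_pos.2 (D.coeff_pos hρ)).ne'
  rw [Active, Active, D.swap_gap hρ, swap_angle hρ, sub_sub_cancel, mul_eq_zero, or_iff_right h]

lemma isGreatest_iff_of_angle_eq_pi (hρ : 0 < ρ) (h0 : D.angle ρ = Real.pi) :
    IsGreatest (D.levelSet (D.theta ρ)) ρ ↔ D.Active ρ ∧ (D.slope (-ρ)).re ≤ 0 := by
  rw [← swap_levelSet, ← swap_theta hρ, isGreatest_iff_of_angle_eq_zero hρ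
    (by rw [swap_angle hρ, h0, sub_self]), swap_active_iff hρ, swap_slope, neg_re, neg_nonneg]

lemma isLeast_iff_of_angle_eq_pi (hρ : 0 < ρ) (h0 : D.angle ρ = Real.pi) :
    IsLeast (D.levelSet (D.theta ρ)) ρ ↔ D.Active ρ ∧ 0 ≤ (D.slope (-ρ)).re := by
  rw [← swap_levelSet, ← swap_theta hρ, isLeast_iff_of_angle_eq_zero hρ
    (by rw [swap_angle hρ, h0, sub_self]), swap_active_iff hρ, swap_slope, neg_re, neg_nonpos]

/-- Off the real axis the phase is strictly increasing, so the level set is the single point ρ. -/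
lemma levelSet_of_interior (hρ : 0 < ρ) (h : D.angle ρ ∈ Set.Ioo 0 Real.pi) :
    IsLeast (D.levelSet (D.theta ρ)) ρ ∧ IsGreatest (D.levelSet (D.theta ρ)) ρ := by
  have key : ∀ s ∈ D.levelSet (D.theta ρ), ρ = s := by
    intro s hs
    by_contra hne
    rcases (angle_of_theta_eq hρ hs.1 hne hs.2.symm).2 with h' | h'
    · exact h.1.ne' h'
    · exact h.2.ne h'
  exact ⟨⟨⟨hρ, rfl⟩, fun s hs => (key s hs).le⟩, ⟨⟨hρ, rfl⟩, fun s hs => (key s hs).ge⟩⟩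

lemma angle_cases (D : EquationData ι κ) (ρ : ℝ) :
    D.angle ρ = 0 ∨ D.angle ρ = Real.pi ∨ D.angle ρ ∈ Set.Ioo 0 Real.pi := by
  have hm := D.angle_mem ρ
  rcases eq_or_lt_of_le hm.1 with h | h
  · exact Or.inl h.symm
  rcases eq_or_lt_of_le hm.2 with h' | h'
  · exact Or.inr (Or.inl h')
  · exact Or.inr (Or.inr ⟨h, h'⟩)

/-- Replaces the equation of moduli by an order property of the phase: solutions are exactly the
endpoints belonging to level sets. -/
lemma active_iff (hρ : 0 < ρ) : D.Active ρ ↔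
    IsLeast (D.levelSet (D.theta ρ)) ρ ∨ IsGreatest (D.levelSet (D.theta ρ)) ρ := by
  rcases D.angle_cases ρ with h | h | h
  · rw [isGreatest_iff_of_angle_eq_zero hρ h, isLeast_iff_of_angle_eq_zero hρ h, ← and_or_left]
    simp [le_total]
  · rw [isGreatest_iff_of_angle_eq_pi hρ h, isLeast_iff_of_angle_eq_pi hρ h, ← and_or_left]
    simp [le_total]
  · simp [levelSet_of_interior hρ h, Active, gap_eq_zero_of_mem_Ioo h]

/-- Being least and being greatest impose opposite weak signs on the real slope. Its vanishing,
which characterises a multiple zero, is the coincidence of the two endpoints. -/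
lemma isLeast_and_isGreatest_iff (hρ : 0 < ρ) (ha : D.Active ρ)
    (h : D.angle ρ = 0 ∨ D.angle ρ = Real.pi) :
    IsLeast (D.levelSet (D.theta ρ)) ρ ∧ IsGreatest (D.levelSet (D.theta ρ)) ρ ↔
      D.slope (polar ρ (D.angle ρ)) = 0 := by
  rcases h with h | h
  · rw [isGreatest_iff_of_angle_eq_zero hρ h, isLeast_iff_of_angle_eq_zero hρ h, h, polar_zero,
      Complex.ext_iff, slope_im_of_real]
    simp [ha, le_antisymm_iff]
  · have := slope_im_of_real (D := D) (-ρ)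
    rw [ofReal_neg] at this
    rw [isGreatest_iff_of_angle_eq_pi hρ h, isLeast_iff_of_angle_eq_pi hρ h, h, polar_pi,
      Complex.ext_iff, this]
    simp [ha, le_antisymm_iff, and_comm]

/-- The imaginary part of the slope is bounded below in the upper half-plane. -/
lemma exists_le_im_slope (D : EquationData ι κ) {R : ℝ} (hR : 0 < R) :
    ∃ δ > 0, ∀ u : ℂ, 0 ≤ u.im → ‖u‖ ≤ R → δ * u.im ≤ (D.slope u).im := by
  have him : ∀ u : ℂ, (D.slope u).im =
      2 * (zeroSum D.p u).im + 2 * (zeroSum D.q (-starRingEnd ℂ u)).im := fun u => by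
    have : zeroSum D.q (-starRingEnd ℂ u) = starRingEnd ℂ (zeroSum D.q (-u)) := by
      rw [← zeroSum_conj, map_neg]
    rw [this]
    simp [slope]
    ring
  have hconj : ∀ u : ℂ, (-starRingEnd ℂ u).im = u.im := fun u => by simp
  have hnorm : ∀ u : ℂ, ‖-starRingEnd ℂ u‖ = ‖u‖ := fun u => by simp
  rcases D.nonempty with ⟨⟨i⟩⟩ | ⟨⟨i⟩⟩
  · refine ⟨2 * (D.p i / (R + D.p i) ^ 2), ?_, fun u hu hn => ?_⟩
    · have := D.p_pos i
      positivity
    · have h1 := div_mul_im_le_im_zeroSum D.p_pos D.p_summable i hu hn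
      have h2 := zeroSum_im_nonneg D.q_pos D.q_summable (u := -starRingEnd ℂ u) (by rwa [hconj])
      rw [him]
      linarith
  · refine ⟨2 * (D.q i / (R + D.q i) ^ 2), ?_, fun u hu hn => ?_⟩
    · have := D.q_pos i
      positivity
    · have h1 := div_mul_im_le_im_zeroSum D.q_pos D.q_summable i
        (u := -starRingEnd ℂ u) (by rwa [hconj])
        ((hnorm u).trans_le hn)
      have h2 := zeroSum_im_nonneg D.p_pos D.p_summable hu
      rw [hconj] at h1
      rw [him]
      linarith

lemma slope_ne_zero_of_im_pos {u : ℂ} (hu : 0 < u.im) : D.slope u ≠ 0 := by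
  obtain ⟨δ, hδ, h⟩ := D.exists_le_im_slope (R := ‖u‖ + 1) (by positivity)
  have := (mul_pos hδ hu).trans_le (h u hu.le (by linarith))
  intro h0
  rw [h0] at this
  exact lt_irrefl _ this

lemma analyticAt_slope {u : ℂ} (hp : zeroProd D.p u ≠ 0) (hq : zeroProd D.q (-u) ≠ 0) :
    AnalyticAt ℂ D.slope u := by
  have h1 := analyticAt_zeroSum D.p_pos D.p_summable hp
  have h2 : AnalyticAt ℂ (fun v => zeroSum D.q (-v)) u :=
    (analyticAt_zeroSum D.q_pos D.q_summable hq).fun_comp analyticAt_id.neg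
  exact ((analyticAt_const.mul h1).sub (analyticAt_const.mul h2)).sub analyticAt_const

/-- With a vanishing derivative the slope at x + iy would be o(y), against the lower bound δy for
its imaginary part. This caps the multiplicity at two. -/
lemma deriv_slope_ne_zero {x : ℝ} (hp : zeroProd D.p x ≠ 0) (hq : zeroProd D.q (-x) ≠ 0)
    (h0 : D.slope x = 0) : deriv D.slope x ≠ 0 := by
  intro hd
  have hder := (analyticAt_slope hp hq).differentiableAt.hasDerivAt
  rw [hd, hasDerivAt_iff_isLittleO_nhds_zero] at hder
  obtain ⟨δ, hδ, hb⟩ := D.exists_le_im_slope (R := |x| + 1) (by positivity)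
  have hev := hder.def (half_pos hδ)
  have hI : Tendsto (fun y : ℝ => (y : ℂ) * I) (𝓝 0) (𝓝 0) := by
    have : Continuous fun y : ℝ => (y : ℂ) * I := by fun_prop
    simpa using this.tendsto 0
  have hev2 := ((hI.eventually hev).filter_mono (nhdsWithin_le_nhds (s := Set.Ioi 0))).and
    (Ioo_mem_nhdsGT (zero_lt_one' ℝ))
  obtain ⟨y, hy, hy0, hy1⟩ := hev2.exists
  have him : ((x : ℂ) + y * I).im = y := by simp
  have h2 := hb (x + y * I) (by rw [him]; exact hy0.le) (by
    refine (norm_add_le _ _).trans ?_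
    rw [norm_mul, norm_I, norm_real, norm_real, Real.norm_eq_abs, Real.norm_of_nonneg hy0.le]
    linarith)
  rw [him] at h2
  rw [h0, sub_zero, smul_zero, sub_zero, norm_mul, norm_I, norm_real, Real.norm_of_nonneg hy0.le,
    mul_one] at hy
  have h3 := (le_abs_self _).trans (abs_im_le_norm (D.slope (x + y * I)))
  nlinarith

end EquationData

end MeromorphicZeros

/-! ### The characteristic function in polar coordinates and the orders of its zeros -/

namespace MeromorphicZeros
open scoped Topology

/-- The square root `±√ρ exp (±iφ/2)` of `ρ exp (±iφ)`, with signs `ε` and `ζ`. -/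
noncomputable def root (ε ζ ρ φ : ℝ) : ℂ := ε * (√ρ : ℝ) * exp ((ζ * (φ / 2) : ℝ) * I)

lemma root_re {ε ζ ρ φ : ℝ} (hζ : ζ = 1 ∨ ζ = -1) :
    (root ε ζ ρ φ).re = ε * √ρ * Real.cos (φ / 2) := by
  rw [root, ← ofReal_mul, re_ofReal_mul, exp_ofReal_mul_I_re]
  rcases hζ with rfl | rfl
  · rw [one_mul]
  · rw [neg_one_mul, Real.cos_neg]

lemma root_im {ε ζ ρ φ : ℝ} (hζ : ζ = 1 ∨ ζ = -1) :
    (root ε ζ ρ φ).im = ε * ζ * √ρ * Real.sin (φ / 2) := by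
  rw [root, ← ofReal_mul, im_ofReal_mul, exp_ofReal_mul_I_im]
  rcases hζ with rfl | rfl
  · rw [one_mul, mul_one]
  · rw [neg_one_mul, Real.sin_neg]
    ring

lemma norm_root {ε ζ ρ φ : ℝ} (hε : ε = 1 ∨ ε = -1) : ‖root ε ζ ρ φ‖ = √ρ := by
  rw [root, norm_mul, norm_exp_ofReal_mul_I, mul_one, norm_mul, norm_real, norm_real,
    Real.norm_of_nonneg (Real.sqrt_nonneg ρ)]
  rcases hε with rfl | rfl <;> simp

lemma conj_root {ε ζ ρ φ : ℝ} : starRingEnd ℂ (root ε ζ ρ φ) = root ε (-ζ) ρ φ := by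
  rw [root, root, map_mul, map_mul, conj_ofReal, conj_ofReal, ← exp_conj, map_mul, conj_ofReal,
    conj_I]
  push_cast
  ring_nf

lemma root_sq {ε ζ ρ φ : ℝ} (hε : ε = 1 ∨ ε = -1) (hρ : 0 < ρ) :
    root ε ζ ρ φ ^ 2 = polar ρ (ζ * φ) := by
  have h1 : (ε : ℂ) ^ 2 = 1 := by rcases hε with rfl | rfl <;> simp
  have h2 : ((√ρ : ℝ) : ℂ) ^ 2 = ρ := by
    rw [← ofReal_pow, Real.sq_sqrt hρ.le]
  rw [root, mul_pow, mul_pow, h1, h2, ← exp_nat_mul, polar, one_mul]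
  congr 2
  push_cast
  ring

/-- The four cases are the quadrants of w: ε is the sign of the real part and ζ that of the product
of real and imaginary parts, up to choices on the axes. -/
lemma exists_eq_root {w : ℂ} (hw : w ≠ 0) : ∃ ε ζ ρ φ : ℝ, (ε = 1 ∨ ε = -1) ∧
    (ζ = 1 ∨ ζ = -1) ∧ 0 < ρ ∧ φ ∈ Set.Icc 0 Real.pi ∧ w = root ε ζ ρ φ := by
  have hρ : 0 < ‖w‖ ^ 2 := by positivity
  have hs : √(‖w‖ ^ 2) = ‖w‖ := Real.sqrt_sq (norm_nonneg w)
  have h := norm_mul_exp_arg_mul_I w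
  have h1 := neg_pi_lt_arg w
  have h2 := arg_le_pi w
  rcases le_or_gt 0 (arg w) with h0 | h0
  · rcases le_or_gt (arg w) (Real.pi / 2) with h3 | h3
    · refine ⟨1, 1, _, 2 * arg w, by simp, by simp, hρ,
        ⟨by linarith, by linarith⟩, ?_⟩
      rw [root, hs, ofReal_one, one_mul, one_mul, mul_div_cancel_left₀ _ two_ne_zero, h]
    · refine ⟨-1, -1, _, 2 * (Real.pi - arg w), by simp, by simp, hρ,
        ⟨by linarith, by linarith⟩, ?_⟩
      rw [root, hs, mul_div_cancel_left₀ _ two_ne_zero]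
      have : (((-1 * (Real.pi - arg w) : ℝ) : ℂ)) * I = arg w * I - Real.pi * I := by
        push_cast; ring
      rw [this, exp_sub, exp_pi_mul_I, ofReal_neg, ofReal_one]
      linear_combination -h
  · rcases le_or_gt (-(Real.pi / 2)) (arg w) with h3 | h3
    · refine ⟨1, -1, _, -2 * arg w, by simp, by simp, hρ,
        ⟨by linarith, by linarith⟩, ?_⟩
      have : (-1 * (-2 * arg w / 2) : ℝ) = arg w := by ring
      rw [root, hs, ofReal_one, one_mul, this, h]
    · refine ⟨-1, 1, _, 2 * (Real.pi + arg w), by simp, by simp, hρ,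
        ⟨by linarith, by linarith⟩, ?_⟩
      rw [root, hs, mul_div_cancel_left₀ _ two_ne_zero]
      have : (((1 * (Real.pi + arg w) : ℝ) : ℂ)) * I = arg w * I + Real.pi * I := by
        push_cast; ring
      rw [this, exp_add, exp_pi_mul_I, ofReal_neg, ofReal_one]
      linear_combination -h

namespace EquationData

variable {ι κ : Type*} (D : EquationData ι κ)

/-- The entire function whose zeros are studied. -/
noncomputable def charFun (c : ℂ) (J : ℕ) (w : ℂ) : ℂ :=
  zeroProd D.p (w ^ 2) - c * D.K * w ^ (2 * J + 1) * zeroProd D.q (-w ^ 2)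

variable {D} {c : ℂ} {J : ℕ} {ρ : ℝ}

/-- Reduces ζ = −1 to ζ = 1 at the price of conjugating c. -/
lemma charFun_conj (w : ℂ) :
    D.charFun c J (starRingEnd ℂ w) = starRingEnd ℂ (D.charFun (starRingEnd ℂ c) J w) := by
  simp only [charFun, map_sub, map_mul, map_pow, conj_conj, conj_ofReal,
    ← zeroProd_conj D.p_summable, ← zeroProd_conj D.q_summable, map_neg]

lemma analyticAt_charFun (w : ℂ) : AnalyticAt ℂ (D.charFun c J) w := by
  have hp := differentiable_zeroProd D.p_pos D.p_summable
  have hq := differentiable_zeroProd D.q_pos D.q_summable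
  have : Differentiable ℂ (D.charFun c J) := by
    have h1 : Differentiable ℂ fun w : ℂ => zeroProd D.p (w ^ 2) := hp.comp (by fun_prop)
    have h2 : Differentiable ℂ fun w : ℂ => zeroProd D.q (-w ^ 2) := hq.comp (by fun_prop)
    exact h1.sub (((differentiable_const _).mul (by fun_prop)).mul h2)
  exact this.analyticAt w

lemma root_pow {ε φ : ℝ} (hε : ε = 1 ∨ ε = -1) (hρ : 0 < ρ) (hτ : D.τ = J + 1 / 2) :
    root ε 1 ρ φ ^ (2 * J + 1) = ε * (ρ ^ D.τ : ℝ) * exp ((D.τ * φ : ℝ) * I) := by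
  have h1 : (ε : ℂ) ^ (2 * J + 1) = ε := by
    rcases hε with rfl | rfl <;> simp [pow_succ, pow_mul]
  have h2 : ((√ρ : ℝ) : ℂ) ^ (2 * J + 1) = (ρ ^ D.τ : ℝ) := by
    rw [← ofReal_pow, Real.sqrt_eq_rpow, ← Real.rpow_natCast, ← Real.rpow_mul hρ.le, hτ]
    congr 2
    push_cast
    ring
  rw [root, mul_pow, mul_pow, h1, h2, ← exp_nat_mul, hτ]
  congr 2
  push_cast
  ring

lemma charFun_root_eq {ε φ : ℝ} (hε : ε = 1 ∨ ε = -1) (hρ : 0 < ρ) (hτ : D.τ = J + 1 / 2) :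
    D.charFun c J (root ε 1 ρ φ) = zeroProd D.p (polar ρ φ) -
      c * D.K * (ε * (ρ ^ D.τ : ℝ) * exp ((D.τ * φ : ℝ) * I)) *
        starRingEnd ℂ (zeroProd D.q (polar ρ (Real.pi - φ))) := by
  rw [charFun, root_pow hε hρ hτ, root_sq hε hρ, one_mul, neg_polar, zeroProd_conj D.q_summable]

lemma gap_eq_zero_of_charFun {ε φ : ℝ} (hε : ε = 1 ∨ ε = -1) (hρ : 0 < ρ)
    (hτ : D.τ = J + 1 / 2) (hc : ‖c‖ = 1) (h : D.charFun c J (root ε 1 ρ φ) = 0) :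
    D.gap ρ φ = 0 := by
  rw [charFun_root_eq hε hρ hτ, sub_eq_zero] at h
  have h1 := congrArg norm h
  have h2 : ‖(ε : ℂ)‖ = 1 := by rcases hε with rfl | rfl <;> simp
  have h3 := (Real.rpow_pos_of_pos hρ D.τ).le
  rw [norm_mul, norm_mul, norm_mul, norm_mul, norm_mul, norm_exp_ofReal_mul_I, hc, h2, norm_real,
    norm_real, Real.norm_of_nonneg D.K_pos.le, Real.norm_of_nonneg h3, RCLike.norm_conj] at h1
  rw [gap, h1]
  ring

lemma exp_eq_norm_mul (z : ℂ) : exp z = ‖exp z‖ * exp (z.im * I) := by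
  rw [norm_exp, ofReal_exp, ← exp_add, re_add_im]

/-- Once the moduli agree, both sides share the same positive factor, and only the comparison of
unimodular factors remains. -/
lemma charFun_root_of_active {ε : ℝ} (hε : ε = 1 ∨ ε = -1) (hρ : 0 < ρ)
    (hτ : D.τ = J + 1 / 2) (ha : D.Active ρ) :
    D.charFun c J (root ε 1 ρ (D.angle ρ)) = 0 ↔ exp (D.theta ρ * I) = ε * c := by
  have hp := zeroProd_p_ne_zero (D := D) hρ
  have hq := zeroProd_q_ne_zero (D := D) hρ
  have e1 : zeroProd D.p (polar ρ (D.angle ρ)) = ‖zeroProd D.p (polar ρ (D.angle ρ))‖ *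
      exp ((logSum D.p ρ (D.angle ρ)).im * I) := by
    rw [zeroProd_polar D.p_summable hp]
    exact exp_eq_norm_mul _
  have e2 : starRingEnd ℂ (zeroProd D.q (polar ρ (Real.pi - D.angle ρ))) =
      ‖zeroProd D.q (polar ρ (Real.pi - D.angle ρ))‖ *
      exp (-((logSum D.q ρ (Real.pi - D.angle ρ)).im * I)) := by
    rw [zeroProd_polar D.q_summable hq, ← exp_conj]
    conv_lhs => rw [exp_eq_norm_mul, exp_conj, RCLike.norm_conj]
    simp
  have e3 : (‖zeroProd D.p (polar ρ (D.angle ρ))‖ : ℂ) =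
      D.K * (ρ ^ D.τ : ℝ) * ‖zeroProd D.q (polar ρ (Real.pi - D.angle ρ))‖ := by
    have := sub_eq_zero.1 ha
    exact_mod_cast this
  have e4 : exp ((logSum D.p ρ (D.angle ρ)).im * I) = exp (D.theta ρ * I) *
      (exp ((D.τ * D.angle ρ : ℝ) * I) *
        exp (-((logSum D.q ρ (Real.pi - D.angle ρ)).im * I))) := by
    rw [← exp_add, ← exp_add, theta, phase]
    congr 1
    push_cast
    ring
  have key : D.charFun c J (root ε 1 ρ (D.angle ρ)) =
      (‖zeroProd D.p (polar ρ (D.angle ρ))‖ * (exp ((D.τ * D.angle ρ : ℝ) * I) *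
        exp (-((logSum D.q ρ (Real.pi - D.angle ρ)).im * I)))) *
      (exp (D.theta ρ * I) - ε * c) := by
    rw [charFun_root_eq hε hρ hτ, e2]
    conv_lhs => rw [e1, e4]
    rw [e3]
    ring
  rw [key, mul_eq_zero, or_iff_right, sub_eq_zero]
  exact mul_ne_zero (by exact_mod_cast norm_ne_zero_iff.2 hp)
    (mul_ne_zero (exp_ne_zero _) (exp_ne_zero _))

/-- The zeros of the characteristic function in polar coordinates. -/
lemma charFun_root_eq_zero_iff {ε ζ φ : ℝ} (hε : ε = 1 ∨ ε = -1) (hζ : ζ = 1 ∨ ζ = -1)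
    (hρ : 0 < ρ) (hφ : φ ∈ Set.Icc 0 Real.pi) (hτ : D.τ = J + 1 / 2) (hc : ‖c‖ = 1) :
    D.charFun c J (root ε ζ ρ φ) = 0 ↔
      φ = D.angle ρ ∧ D.Active ρ ∧ exp ((ζ * D.theta ρ : ℝ) * I) = ε * c := by
  have key : ∀ {c : ℂ}, ‖c‖ = 1 → (D.charFun c J (root ε 1 ρ φ) = 0 ↔
      φ = D.angle ρ ∧ D.Active ρ ∧ exp (D.theta ρ * I) = ε * c) := by
    intro c hc
    constructor
    · intro h
      have hg := gap_eq_zero_of_charFun hε hρ hτ hc h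
      have hφ' := eq_angle_of_gap_eq_zero hρ hφ hg
      subst hφ'
      exact ⟨rfl, hg, (charFun_root_of_active hε hρ hτ hg).1 h⟩
    · rintro ⟨rfl, ha, h⟩
      exact (charFun_root_of_active hε hρ hτ ha).2 h
  rcases hζ with rfl | rfl
  · rw [key hc, one_mul]
  · rw [← conj_root, charFun_conj, map_eq_zero, key (by rwa [RCLike.norm_conj]),
      ← (starRingEnd ℂ).injective.eq_iff (a := exp (D.theta ρ * I)), ← exp_conj, map_mul, map_mul,
      conj_conj, conj_ofReal, conj_ofReal, conj_I]
    push_cast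
    ring_nf

lemma charFun_zero : D.charFun c J 0 = 1 := by simp [charFun, zeroProd_zero]

lemma slope_conj (u : ℂ) : D.slope (starRingEnd ℂ u) = starRingEnd ℂ (D.slope u) := by
  have h2 : starRingEnd ℂ 2 = 2 := conj_ofNat 2
  rw [slope, slope, ← map_neg, zeroSum_conj, zeroSum_conj]
  simp [h2]

/-- With Y the quotient of the second term by the first, the function is −P(v²)(Y − 1) near w, and
Y′ = −(Y/v) · slope(v²). So the order is one more than the order of Y′, that is, of the slope. -/
lemma analyticOrderAt_charFun_aux {w : ℂ} (hτ : D.τ = J + 1 / 2) (hw : w ≠ 0)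
    (hp : zeroProd D.p (w ^ 2) ≠ 0) (hq : zeroProd D.q (-w ^ 2) ≠ 0)
    (h0 : D.charFun c J w = 0) :
    analyticOrderAt (D.charFun c J) w = analyticOrderAt (fun v => D.slope (v ^ 2)) w + 1 := by
  have hdp := differentiable_zeroProd D.p_pos D.p_summable
  have hdq := differentiable_zeroProd D.q_pos D.q_summable
  have hP : Differentiable ℂ fun v : ℂ => zeroProd D.p (v ^ 2) := hdp.comp (by fun_prop)
  have hQ : Differentiable ℂ fun v : ℂ => zeroProd D.q (-v ^ 2) := hdq.comp (by fun_prop)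
  let Y : ℂ → ℂ := fun v => c * D.K * v ^ (2 * J + 1) * zeroProd D.q (-v ^ 2) /
    zeroProd D.p (v ^ 2)
  have hYa : AnalyticAt ℂ Y w := by
    have h1 : AnalyticAt ℂ (fun v : ℂ => c * D.K * v ^ (2 * J + 1)) w := by fun_prop
    exact (h1.mul (hQ.analyticAt w)).div (hP.analyticAt w) hp
  have hpev : ∀ᶠ v in 𝓝 w, zeroProd D.p (v ^ 2) ≠ 0 :=
    hP.continuous.continuousAt.eventually_ne hp
  have hqev : ∀ᶠ v in 𝓝 w, zeroProd D.q (-v ^ 2) ≠ 0 :=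
    hQ.continuous.continuousAt.eventually_ne hq
  have hwev : ∀ᶠ v in 𝓝 w, v ≠ 0 := eventually_ne_nhds hw
  have hY1 : Y w = 1 := by
    rw [charFun, sub_eq_zero] at h0
    simp only [Y]
    rw [← h0, div_self hp]
  have hfac : D.charFun c J =ᶠ[𝓝 w] (fun v => -zeroProd D.p (v ^ 2)) * fun v => Y v - Y w := by
    filter_upwards [hpev] with v hv
    simp only [charFun, Pi.mul_apply, hY1, Y]
    field_simp
    ring
  have hder : deriv Y =ᶠ[𝓝 w] (fun v => -(Y v / v)) * fun v => D.slope (v ^ 2) := by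
    filter_upwards [hpev, hqev, hwev] with v hpv hqv hv
    have hv2 : v ^ 2 ≠ 0 := pow_ne_zero 2 hv
    have d1 : HasDerivAt (fun v : ℂ => c * D.K * v ^ (2 * J + 1))
        (c * D.K * ((2 * J + 1 : ℕ) * v ^ (2 * J))) v := by
      simpa using (hasDerivAt_pow (2 * J + 1) v).const_mul (c * D.K)
    have d0 : HasDerivAt (fun v : ℂ => v ^ 2) (2 * v) v := by simpa using hasDerivAt_pow 2 v
    have d2 : HasDerivAt (fun v : ℂ => zeroProd D.q (-v ^ 2))
        (zeroProd D.q (-v ^ 2) * zeroSum D.q (-v ^ 2) / (-v ^ 2) * (-(2 * v))) v :=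
      HasDerivAt.comp (h := fun v : ℂ => -v ^ 2) v
        (hasDerivAt_zeroProd D.q_pos D.q_summable (neg_ne_zero.2 hv2) hqv) d0.neg
    have d3 : HasDerivAt (fun v : ℂ => zeroProd D.p (v ^ 2))
        (zeroProd D.p (v ^ 2) * zeroSum D.p (v ^ 2) / (v ^ 2) * (2 * v)) v :=
      HasDerivAt.comp (h := fun v : ℂ => v ^ 2) v
        (hasDerivAt_zeroProd D.p_pos D.p_summable hv2 hpv) d0
    have d4 := (d1.mul d2).div d3 hpv
    have : deriv Y v = _ := d4.deriv
    rw [this]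
    simp only [Pi.mul_apply, slope, Y, hτ]
    push_cast
    field_simp
    ring
  have hsl : AnalyticAt ℂ (fun v => D.slope (v ^ 2)) w :=
    AnalyticAt.fun_comp (f := fun v : ℂ => v ^ 2) (analyticAt_slope hp hq) (by fun_prop)
  have hYw : AnalyticAt ℂ (fun v => -(Y v / v)) w := (hYa.div analyticAt_id hw).neg
  have hPn : AnalyticAt ℂ (fun v => -zeroProd D.p (v ^ 2)) w := (hP.analyticAt w).neg
  have hYs : AnalyticAt ℂ (fun v => Y v - Y w) w := hYa.sub analyticAt_const
  rw [analyticOrderAt_congr hfac, analyticOrderAt_mul hPn hYs,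
    hPn.analyticOrderAt_eq_zero.2 (neg_ne_zero.2 hp),
    zero_add, ← hYa.analyticOrderAt_deriv_add_one, analyticOrderAt_congr hder,
    analyticOrderAt_mul hYw hsl, hYw.analyticOrderAt_eq_zero.2, zero_add]
  rw [hY1]
  exact neg_ne_zero.2 (div_ne_zero one_ne_zero hw)

lemma analyticOrderAt_charFun_of_interior {ε ζ : ℝ} (hε : ε = 1 ∨ ε = -1) (hζ : ζ = 1 ∨ ζ = -1)
    (hρ : 0 < ρ) (hτ : D.τ = J + 1 / 2) (hi : D.angle ρ ∈ Set.Ioo 0 Real.pi)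
    (h0 : D.charFun c J (root ε ζ ρ (D.angle ρ)) = 0) :
    analyticOrderAt (D.charFun c J) (root ε ζ ρ (D.angle ρ)) = 1 := by
  have hu := root_sq (ζ := ζ) (φ := D.angle ρ) hε hρ
  have hw : root ε ζ ρ (D.angle ρ) ≠ 0 := by
    rw [← norm_ne_zero_iff, norm_root hε]; exact (Real.sqrt_pos.2 hρ).ne'
  have him : 0 < (polar ρ (D.angle ρ)).im := by
    rw [polar_im]; exact mul_pos hρ (Real.sin_pos_of_mem_Ioo hi)
  have hp := zeroProd_p_ne_zero (D := D) hρ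
  have hq : zeroProd D.q (-polar ρ (D.angle ρ)) ≠ 0 := by
    rw [neg_polar, zeroProd_conj D.q_summable, map_ne_zero]
    exact zeroProd_q_ne_zero hρ
  have hs := slope_ne_zero_of_im_pos (D := D) him
  have key : zeroProd D.p (polar ρ (ζ * D.angle ρ)) ≠ 0 ∧
      zeroProd D.q (-polar ρ (ζ * D.angle ρ)) ≠ 0 ∧ D.slope (polar ρ (ζ * D.angle ρ)) ≠ 0 := by
    rcases hζ with rfl | rfl
    · rw [one_mul]; exact ⟨hp, hq, hs⟩
    · rw [neg_one_mul, ← conj_polar, ← map_neg, zeroProd_conj D.p_summable,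
        zeroProd_conj D.q_summable, slope_conj, map_ne_zero, map_ne_zero, map_ne_zero]
      exact ⟨hp, hq, hs⟩
  rw [← hu] at key
  rw [analyticOrderAt_charFun_aux hτ hw key.1 key.2.1 h0,
    analyticOrderAt_eq_zero (f := fun v => D.slope (v ^ 2)).2 (Or.inr key.2.2), zero_add]

-- On the axis the slope at v² vanishes to order at most one, and does so exactly when both endpoint
-- roles fall on ρ. The order is therefore the number of these roles.
open Classical in
lemma analyticOrderAt_charFun_of_edge {ε ζ : ℝ} (hε : ε = 1 ∨ ε = -1) (hζ : ζ = 1 ∨ ζ = -1)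
    (hρ : 0 < ρ) (hτ : D.τ = J + 1 / 2) (hi : D.angle ρ = 0 ∨ D.angle ρ = Real.pi)
    (ha : D.Active ρ) (h0 : D.charFun c J (root ε ζ ρ (D.angle ρ)) = 0) :
    analyticOrderAt (D.charFun c J) (root ε ζ ρ (D.angle ρ)) =
      (if IsLeast (D.levelSet (D.theta ρ)) ρ then 1 else 0) +
      (if IsGreatest (D.levelSet (D.theta ρ)) ρ then 1 else 0) := by
  have hu : root ε ζ ρ (D.angle ρ) ^ 2 = polar ρ (D.angle ρ) := by
    rw [root_sq hε hρ]
    rcases hζ with rfl | rfl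
    · rw [one_mul]
    · rw [neg_one_mul, ← conj_polar, conj_eq_iff_im, polar_im]
      rcases hi with h | h <;> simp [h]
  have hw : root ε ζ ρ (D.angle ρ) ≠ 0 := by
    rw [← norm_ne_zero_iff, norm_root hε]; exact (Real.sqrt_pos.2 hρ).ne'
  have hp := zeroProd_p_ne_zero (D := D) hρ
  have hq : zeroProd D.q (-polar ρ (D.angle ρ)) ≠ 0 := by
    rw [neg_polar, zeroProd_conj D.q_summable, map_ne_zero]
    exact zeroProd_q_ne_zero hρ
  rw [analyticOrderAt_charFun_aux hτ hw (by rwa [hu]) (by rwa [hu]) h0]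
  have hiff := isLeast_and_isGreatest_iff hρ ha hi
  by_cases hs : D.slope (polar ρ (D.angle ρ)) = 0
  · obtain ⟨h1, h2⟩ := hiff.2 hs
    rw [if_pos h1, if_pos h2]
    congr 1
    obtain ⟨x, hx⟩ : ∃ x : ℝ, polar ρ (D.angle ρ) = x := by
      rcases hi with h | h
      · exact ⟨ρ, by rw [h, polar_zero]⟩
      · exact ⟨-ρ, by rw [h, polar_pi, ofReal_neg]⟩
    rw [hx] at hp hq hs hu
    have hd := deriv_slope_ne_zero hp hq hs
    have han : AnalyticAt ℂ D.slope (root ε ζ ρ (D.angle ρ) ^ 2) := by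
      rw [hu]; exact analyticAt_slope hp hq
    have d0 : HasDerivAt (fun v : ℂ => v ^ 2) (2 * root ε ζ ρ (D.angle ρ))
      (root ε ζ ρ (D.angle ρ)) := by simpa using hasDerivAt_pow 2 (root ε ζ ρ (D.angle ρ))
    have hd2 : HasDerivAt (fun v : ℂ => D.slope (v ^ 2)) _ (root ε ζ ρ (D.angle ρ)) :=
      HasDerivAt.comp (h := fun v : ℂ => v ^ 2) _ han.differentiableAt.hasDerivAt d0
    refine (AnalyticAt.fun_comp (f := fun v : ℂ => v ^ 2) han
      (by fun_prop)).analyticOrderAt_eq_one_of_zero_deriv_ne_zero (by rw [hu, hs]) ?_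
    rw [hd2.deriv, hu]
    exact mul_ne_zero hd (mul_ne_zero two_ne_zero hw)
  · rw [analyticOrderAt_eq_zero (f := fun v => D.slope (v ^ 2)).2 (Or.inr (by rwa [hu])), zero_add]
    have h3 := (active_iff hρ).1 ha
    rw [← hiff] at hs
    by_cases h1 : IsLeast (D.levelSet (D.theta ρ)) ρ
    · have h2 : ¬ IsGreatest (D.levelSet (D.theta ρ)) ρ := fun h => hs ⟨h1, h⟩
      simp [h1, h2]
    · simp [h1, h3.resolve_left h1]

end EquationData

end MeromorphicZeros

/-! ### Indexing the zeros by levels of the phase -/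

namespace MeromorphicZeros
open scoped Topology

namespace EquationData

variable {ι κ : Type*} {D : EquationData ι κ}

lemma exists_theta_eq {t r s : ℝ} (hr : 0 < r) (hs : 0 < s) (h1 : D.theta r ≤ t)
    (h2 : t ≤ D.theta s) : ∃ ρ ∈ Set.uIcc r s, D.theta ρ = t := by
  have hsub : Set.uIcc r s ⊆ Set.Ioi 0 := fun x hx => (lt_min hr hs).trans_le hx.1
  obtain ⟨ρ, h, he⟩ := intermediate_value_uIcc (continuousOn_theta.mono hsub)
    (Set.Icc_subset_uIcc ⟨h1, h2⟩)
  exact ⟨ρ, h, he⟩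

/-- The strict inequality at r keeps the level set away from the origin, so its part in the compact
interval [r, s] decides the minimum. -/
lemma exists_isLeast_levelSet {t r s : ℝ} (hr : 0 < r) (hs : 0 < s) (h1 : D.theta r < t)
    (h2 : t ≤ D.theta s) : ∃ ρ, IsLeast (D.levelSet t) ρ := by
  have hrs : r ≤ s := (lt_of_theta_lt hs (h1.trans_le h2)).le
  obtain ⟨ρ₀, h, he⟩ := exists_theta_eq hr hs h1.le h2
  rw [Set.uIcc_of_le hrs] at h
  have hcl : IsClosed (Set.Icc r s ∩ D.theta ⁻¹' {t}) :=
    (continuousOn_theta.mono fun x hx => hr.trans_le hx.1).preimage_isClosed_of_isClosed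
      isClosed_Icc isClosed_singleton
  have hco : IsCompact (Set.Icc r s ∩ D.theta ⁻¹' {t}) :=
    isCompact_Icc.of_isClosed_subset hcl Set.inter_subset_left
  obtain ⟨ρ, ⟨hm, hle⟩⟩ := hco.exists_isLeast ⟨ρ₀, h, he⟩
  refine ⟨ρ, ⟨hr.trans_le hm.1.1, hm.2⟩, fun x hx => ?_⟩
  have hrx : r < x := lt_of_theta_lt hx.1 (by rw [hx.2]; exact h1)
  rcases le_total x s with h3 | h3
  · exact hle ⟨⟨hrx.le, h3⟩, hx.2⟩
  · exact hm.1.2.trans h3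

lemma exists_isGreatest_levelSet {t r s : ℝ} (hr : 0 < r) (hs : 0 < s) (h1 : D.theta r ≤ t)
    (h2 : t < D.theta s) : ∃ ρ, IsGreatest (D.levelSet t) ρ := by
  have hrs : r ≤ s := (lt_of_theta_lt hs (h1.trans_lt h2)).le
  obtain ⟨ρ₀, h, he⟩ := exists_theta_eq hr hs h1 h2.le
  rw [Set.uIcc_of_le hrs] at h
  have hcl : IsClosed (Set.Icc r s ∩ D.theta ⁻¹' {t}) :=
    (continuousOn_theta.mono fun x hx => hr.trans_le hx.1).preimage_isClosed_of_isClosed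
      isClosed_Icc isClosed_singleton
  have hco : IsCompact (Set.Icc r s ∩ D.theta ⁻¹' {t}) :=
    isCompact_Icc.of_isClosed_subset hcl Set.inter_subset_left
  obtain ⟨ρ, ⟨hm, hle⟩⟩ := hco.exists_isGreatest ⟨ρ₀, h, he⟩
  refine ⟨ρ, ⟨hr.trans_le hm.1.1, hm.2⟩, fun x hx => ?_⟩
  have hxs : x < s := lt_of_theta_lt hs (by rw [hx.2]; exact h2)
  rcases le_total r x with h3 | h3
  · exact hle ⟨⟨h3, hxs.le⟩, hx.2⟩
  · exact h3.trans hm.1.1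

/-- The initial stretch of constant phase reaches down to radius 0, which is not itself a radius. -/
lemma not_isLeast_start (hτ : 0 < D.τ) {ρ : ℝ} :
    ¬ IsLeast (D.levelSet (-(D.τ * Real.pi))) ρ := by
  intro h
  obtain ⟨r, hr, hall⟩ := exists_theta_eq_start hτ
  have hρ := h.1.1
  have hm : 0 < min r ρ / 2 := half_pos (lt_min hr hρ)
  have h1 := min_le_left r ρ
  have h2 := min_le_right r ρ
  have hmem : min r ρ / 2 ∈ D.levelSet (-(D.τ * Real.pi)) := ⟨hm, hall _ hm (by linarith)⟩
  have := h.2 hmem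
  linarith [lt_min hr hρ]

end EquationData

/-- The position `c = σ exp (i η γ)` of a unimodular number, together with the exponent `J`. -/
structure Frame where
  /-- The exponent. -/
  J : ℕ
  /-- The sign of the real part. -/
  σ : ℝ
  /-- The sign of the product of the real and imaginary parts. -/
  η : ℝ
  /-- The angle with the real line. -/
  γ : ℝ
  σ_eq : σ = 1 ∨ σ = -1
  η_eq : η = 1 ∨ η = -1
  γ_nonneg : 0 ≤ γ
  γ_le : γ ≤ Real.pi / 2

namespace Frame

variable (T : Frame)

/-- The unimodular number. -/
noncomputable def c : ℂ := T.σ * exp ((T.η * T.γ : ℝ) * I)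

/-- The argument at which the `k`-th zero occurs. -/
noncomputable def lev (k : ℕ) : ℝ := ((((k - 1) / 2 : ℕ) : ℝ) - T.J) * Real.pi + (-1) ^ k * T.γ

/-- The sign of the real part of the `k`-th zero. -/
noncomputable def eps (k : ℕ) : ℝ := T.σ * (-1) ^ ((k - 1) / 2 + T.J)

/-- The sign of the product of the real and imaginary parts of the `k`-th zero. -/
noncomputable def zeta (k : ℕ) : ℝ := T.η * (-1) ^ k

lemma lev_odd (m : ℕ) : T.lev (2 * m + 1) = ((m : ℝ) - T.J) * Real.pi - T.γ := by
  have h : (2 * m + 1 - 1) / 2 = m := by omega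
  rw [lev, h, pow_succ, pow_mul]
  norm_num
  ring

lemma lev_even (m : ℕ) : T.lev (2 * m + 2) = ((m : ℝ) - T.J) * Real.pi + T.γ := by
  have h : (2 * m + 2 - 1) / 2 = m := by omega
  rw [lev, h, show 2 * m + 2 = 2 * (m + 1) by ring, pow_mul]
  norm_num

lemma eps_odd (m : ℕ) : T.eps (2 * m + 1) = T.σ * (-1) ^ (m + T.J) := by
  have h : (2 * m + 1 - 1) / 2 = m := by omega
  rw [eps, h]

lemma eps_even (m : ℕ) : T.eps (2 * m + 2) = T.σ * (-1) ^ (m + T.J) := by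
  have h : (2 * m + 2 - 1) / 2 = m := by omega
  rw [eps, h]

lemma zeta_odd (m : ℕ) : T.zeta (2 * m + 1) = -T.η := by
  rw [zeta, pow_succ, pow_mul]
  norm_num

lemma zeta_even (m : ℕ) : T.zeta (2 * m + 2) = T.η := by
  rw [zeta, show 2 * m + 2 = 2 * (m + 1) by ring, pow_mul]
  norm_num

lemma exists_eq_odd_or_even {k : ℕ} (hk : 1 ≤ k) : ∃ m, k = 2 * m + 1 ∨ k = 2 * m + 2 :=
  ⟨(k - 1) / 2, by omega⟩

lemma eps_eq (k : ℕ) : T.eps k = 1 ∨ T.eps k = -1 := by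
  rw [eps]
  rcases T.σ_eq with h | h <;> rcases neg_one_pow_eq_or ℝ ((k - 1) / 2 + T.J) with h' | h' <;>
    rw [h, h'] <;> norm_num

lemma zeta_eq (k : ℕ) : T.zeta k = 1 ∨ T.zeta k = -1 := by
  rw [zeta]
  rcases T.η_eq with h | h <;> rcases neg_one_pow_eq_or ℝ k with h' | h' <;>
    rw [h, h'] <;> norm_num

lemma norm_c : ‖T.c‖ = 1 := by
  rw [c, norm_mul, norm_exp_ofReal_mul_I, mul_one, norm_real]
  rcases T.σ_eq with h | h <;> rw [h] <;> simp

lemma neg_one_zpow_sub (m J : ℕ) : (-1 : ℝ) ^ ((m : ℤ) - J) = (-1) ^ (m + J) := by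
  rw [zpow_sub₀ (by norm_num), zpow_natCast, zpow_natCast, pow_add]
  rcases neg_one_pow_eq_or ℝ J with h | h <;> rw [h]
  · rw [div_one, mul_one]
  · rw [div_neg, div_one, mul_neg, mul_one]

lemma exp_int_mul_pi (n : ℤ) : exp (((n : ℝ) * Real.pi : ℝ) * I) = ((-1 : ℝ) ^ n : ℝ) := by
  rw [exp_mul_I, ← ofReal_cos, ← ofReal_sin, Real.cos_int_mul_pi, Real.sin_int_mul_pi]
  simp

/-- In both parities ζ_k times the level is ±(m − J)π + ηγ, so the exponential is (−1)^(m+J)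
e^(iηγ); σ² = 1 restores c. -/
lemma exp_zeta_mul_lev {k : ℕ} (hk : 1 ≤ k) :
    exp ((T.zeta k * T.lev k : ℝ) * I) = T.eps k * T.c := by
  have hs : (T.σ : ℂ) * T.σ = 1 := by rcases T.σ_eq with h | h <;> rw [h] <;> simp
  have hη : T.η * T.η = 1 := by rcases T.η_eq with h | h <;> rw [h] <;> simp
  have key : ∀ (s : ℝ) (m : ℕ), (s = 1 ∨ s = -1) →
      exp ((s * ((m : ℝ) - T.J) * Real.pi + T.η * T.γ : ℝ) * I) =
        ((T.σ * (-1) ^ (m + T.J) : ℝ) : ℂ) * T.c := by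
    intro s m h
    have h1 : exp ((s * ((m : ℝ) - T.J) * Real.pi : ℝ) * I) = ((-1) ^ (m + T.J) : ℝ) := by
      have h2 := neg_one_zpow_sub m T.J
      rcases h with rfl | rfl
      · have := exp_int_mul_pi ((m : ℤ) - T.J)
        rw [h2] at this
        rw [← this]
        push_cast
        ring_nf
      · have := exp_int_mul_pi (-((m : ℤ) - T.J))
        rw [zpow_neg, h2] at this
        have h3 : ((-1 : ℝ) ^ (m + T.J))⁻¹ = (-1) ^ (m + T.J) := by
          rcases neg_one_pow_eq_or ℝ (m + T.J) with h | h <;> rw [h] <;> norm_num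
        rw [h3] at this
        rw [← this]
        push_cast
        ring_nf
    rw [ofReal_add, add_mul, exp_add, h1, c, ofReal_mul T.σ]
    linear_combination (-(((-1) ^ (m + T.J) : ℝ) : ℂ) * exp ((T.η * T.γ : ℝ) * I)) * hs
  obtain ⟨m, rfl | rfl⟩ := exists_eq_odd_or_even hk
  · rw [lev_odd, eps_odd, zeta_odd, ← key (-T.η) m (by
      rcases T.η_eq with h | h <;> rw [h] <;> norm_num)]
    congr 2
    norm_cast
    ring
  · rw [lev_even, eps_even, zeta_even, ← key T.η m T.η_eq]
    congr 2
    norm_cast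
    ring

variable {ι κ : Type*} (D : EquationData ι κ)

/-- `ρ` is the square of the modulus of the `k`-th zero. -/
def Sel (k : ℕ) (ρ : ℝ) : Prop :=
  -- If γ = 0, the levels of 2m + 1 and 2m + 2 coincide and their indices take the lower and upper
  -- endpoint. If γ = π/2, the coinciding pairs are 2m + 2 and 2m + 3, so the roles of the parities
  -- are exchanged; index 1 then has the starting level −τπ, which has no least radius. For other γ
  -- a nonempty level set is a single point and the choice is immaterial.
  ((Odd k ↔ T.γ < Real.pi / 2) → IsLeast (D.levelSet (T.lev k)) ρ) ∧
  (¬ (Odd k ↔ T.γ < Real.pi / 2) → IsGreatest (D.levelSet (T.lev k)) ρ)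

variable {T D}

lemma not_odd_even (m : ℕ) : ¬ Odd (2 * m + 2) := by
  rw [Nat.not_odd_iff_even]; exact ⟨m + 1, by ring⟩

lemma odd_odd (m : ℕ) : Odd (2 * m + 1) := ⟨m, rfl⟩

lemma sel_odd (h : T.γ < Real.pi / 2) (m : ℕ) (ρ : ℝ) :
    T.Sel D (2 * m + 1) ρ ↔ IsLeast (D.levelSet (((m : ℝ) - T.J) * Real.pi - T.γ)) ρ := by
  simp [Sel, h, lev_odd]

lemma sel_even (h : T.γ < Real.pi / 2) (m : ℕ) (ρ : ℝ) :
    T.Sel D (2 * m + 2) ρ ↔ IsGreatest (D.levelSet (((m : ℝ) - T.J) * Real.pi + T.γ)) ρ := by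
  have := not_odd_even m
  simp only [Sel, h, lev_even, this]
  simp

lemma sel_odd' (h : T.γ = Real.pi / 2) (m : ℕ) (ρ : ℝ) :
    T.Sel D (2 * m + 1) ρ ↔ IsGreatest (D.levelSet (((m : ℝ) - T.J) * Real.pi - T.γ)) ρ := by
  have h' : ¬ T.γ < Real.pi / 2 := not_lt.2 h.ge
  have := odd_odd m
  simp only [Sel, h', lev_odd, this]
  simp

lemma sel_even' (h : T.γ = Real.pi / 2) (m : ℕ) (ρ : ℝ) :
    T.Sel D (2 * m + 2) ρ ↔ IsLeast (D.levelSet (((m : ℝ) - T.J) * Real.pi + T.γ)) ρ := by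
  have h' : ¬ T.γ < Real.pi / 2 := not_lt.2 h.ge
  have := not_odd_even m
  simp only [Sel, h', lev_even, this]
  simp

lemma Sel.isLeast_or_isGreatest {k : ℕ} {ρ : ℝ} (h : T.Sel D k ρ) :
    IsLeast (D.levelSet (T.lev k)) ρ ∨ IsGreatest (D.levelSet (T.lev k)) ρ := by
  by_cases hk : (Odd k ↔ T.γ < Real.pi / 2)
  · exact Or.inl (h.1 hk)
  · exact Or.inr (h.2 hk)

lemma Sel.mem {k : ℕ} {ρ : ℝ} (h : T.Sel D k ρ) : ρ ∈ D.levelSet (T.lev k) :=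
  h.isLeast_or_isGreatest.elim (fun h => h.1) fun h => h.1

lemma Sel.pos {k : ℕ} {ρ : ℝ} (h : T.Sel D k ρ) : 0 < ρ := h.mem.1

lemma Sel.theta {k : ℕ} {ρ : ℝ} (h : T.Sel D k ρ) : D.theta ρ = T.lev k := h.mem.2

lemma Sel.active {k : ℕ} {ρ : ℝ} (h : T.Sel D k ρ) : D.Active ρ := by
  rw [EquationData.active_iff h.pos, h.theta]
  exact h.isLeast_or_isGreatest

lemma Sel.unique {k : ℕ} {ρ ρ' : ℝ} (h : T.Sel D k ρ) (h' : T.Sel D k ρ') : ρ = ρ' := by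
  by_cases hk : (Odd k ↔ T.γ < Real.pi / 2)
  · exact (h.1 hk).unique (h'.1 hk)
  · exact (h.2 hk).unique (h'.2 hk)

lemma Sel.charFun_eq_zero {k : ℕ} {ρ : ℝ} (hk : 1 ≤ k) (hτ : D.τ = T.J + 1 / 2)
    (h : T.Sel D k ρ) : D.charFun T.c T.J (root (T.eps k) (T.zeta k) ρ (D.angle ρ)) = 0 := by
  rw [EquationData.charFun_root_eq_zero_iff (T.eps_eq k) (T.zeta_eq k) h.pos (D.angle_mem ρ) hτ
    T.norm_c]
  exact ⟨rfl, h.active, by rw [h.theta, T.exp_zeta_mul_lev hk]⟩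

section Existence

lemma start_lt (hγ : T.γ < Real.pi / 2) (hτ : D.τ = T.J + 1 / 2) (m : ℕ) :
    -(D.τ * Real.pi) < ((m : ℝ) - T.J) * Real.pi - T.γ := by
  have : (0 : ℝ) ≤ m * Real.pi := by positivity
  rw [hτ]
  linarith

lemma start_le (hτ : D.τ = T.J + 1 / 2) (m : ℕ) :
    -(D.τ * Real.pi) ≤ ((m : ℝ) - T.J) * Real.pi - T.γ := by
  have : (0 : ℝ) ≤ m * Real.pi := by positivity
  have := T.γ_le
  rw [hτ]
  linarith

/-- The first level −Jπ − γ lies between the initial value −(J + 1/2)π and the value −Jπ, which the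
phase is known to reach. -/
lemma exists_sel_one (hτ : D.τ = T.J + 1 / 2) : ∃ ρ, T.Sel D 1 ρ := by
  have hτ0 : 0 < D.τ := by rw [hτ]; positivity
  obtain ⟨r, hr, hstart⟩ := EquationData.exists_theta_eq_start hτ0
  have h1 := hstart r hr le_rfl
  obtain ⟨s, hs, h2⟩ := D.exists_le_theta (by rw [hτ]; simp)
  rw [hτ] at h2
  rcases lt_or_eq_of_le T.γ_le with hγ | hγ
  · obtain ⟨ρ, hρ⟩ := EquationData.exists_isLeast_levelSet (D := D)
      (t := (((0 : ℕ) : ℝ) - T.J) * Real.pi - T.γ) hr hs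
      (by rw [h1]; exact start_lt hγ hτ 0) (by
        have := T.γ_nonneg
        push_cast
        linarith)
    exact ⟨ρ, (sel_odd hγ 0 ρ).2 hρ⟩
  · obtain ⟨ρ, hρ⟩ := EquationData.exists_isGreatest_levelSet (D := D)
      (t := (((0 : ℕ) : ℝ) - T.J) * Real.pi - T.γ) hr hs
      (by rw [h1]; exact start_le hτ 0) (by
        have := Real.pi_pos
        rw [hγ]
        push_cast
        linarith)
    exact ⟨ρ, (sel_odd' hγ 0 ρ).2 hρ⟩

/-- Levels are nondecreasing in k, so a radius for k + 1 gives the upper bound for the intermediate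
value theorem. A least element needs strictness at the start, a greatest one strictness at the next
level; the convention in `Sel` provides exactly these. -/
lemma exists_sel_of_succ (hτ : D.τ = T.J + 1 / 2) {k : ℕ} (hk : 1 ≤ k)
    (h : ∃ ρ, T.Sel D (k + 1) ρ) : ∃ ρ, T.Sel D k ρ := by
  have hτ0 : 0 < D.τ := by rw [hτ]; positivity
  have hpi := Real.pi_pos
  have hγ0 := T.γ_nonneg
  obtain ⟨s, hsel⟩ := h
  obtain ⟨r, hr, hstart⟩ := EquationData.exists_theta_eq_start hτ0
  have h1 := hstart r hr le_rfl
  have hs := hsel.pos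
  have hth := hsel.theta
  rcases lt_or_eq_of_le T.γ_le with hγ | hγ <;> obtain ⟨m, rfl | rfl⟩ := exists_eq_odd_or_even hk
  · have h2 := start_lt hγ hτ m
    rw [show 2 * m + 1 + 1 = 2 * m + 2 by ring, lev_even] at hth
    obtain ⟨ρ, hρ⟩ := EquationData.exists_isLeast_levelSet (D := D) hr hs
      (by rw [h1]; exact h2) (by rw [hth]; linarith)
    exact ⟨ρ, (sel_odd hγ m ρ).2 hρ⟩
  · have h2 := start_lt hγ hτ m
    rw [show 2 * m + 2 + 1 = 2 * (m + 1) + 1 by ring, lev_odd] at hth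
    obtain ⟨ρ, hρ⟩ := EquationData.exists_isGreatest_levelSet (D := D)
      (t := ((m : ℝ) - T.J) * Real.pi + T.γ) hr hs
      (by rw [h1]; linarith) (by rw [hth]; push_cast; linarith)
    exact ⟨ρ, (sel_even hγ m ρ).2 hρ⟩
  · have h2 := start_le hτ m
    rw [show 2 * m + 1 + 1 = 2 * m + 2 by ring, lev_even] at hth
    obtain ⟨ρ, hρ⟩ := EquationData.exists_isGreatest_levelSet (D := D)
      (t := ((m : ℝ) - T.J) * Real.pi - T.γ) hr hs
      (by rw [h1]; exact h2) (by rw [hth]; linarith)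
    exact ⟨ρ, (sel_odd' hγ m ρ).2 hρ⟩
  · have h2 := start_le hτ m
    rw [show 2 * m + 2 + 1 = 2 * (m + 1) + 1 by ring, lev_odd] at hth
    obtain ⟨ρ, hρ⟩ := EquationData.exists_isLeast_levelSet (D := D)
      (t := ((m : ℝ) - T.J) * Real.pi + T.γ) hr hs
      (by rw [h1]; linarith) (by rw [hth]; push_cast; linarith)
    exact ⟨ρ, (sel_even' hγ m ρ).2 hρ⟩

lemma exists_enat_of_initial {V : ℕ → Prop} (h : ∀ k, 1 ≤ k → V (k + 1) → V k) :
    ∃ ω : ℕ∞, ∀ k : ℕ, 1 ≤ k → (V k ↔ (k : ℕ∞) ≤ ω) := by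
  classical
  by_cases hall : ∀ k, 1 ≤ k → V k
  · exact ⟨⊤, fun k hk => by simp [hall k hk]⟩
  push Not at hall
  have hN := Nat.find_spec hall
  set N := Nat.find hall with hNdef
  refine ⟨((N - 1 : ℕ) : ℕ∞), fun k hk => ?_⟩
  rw [Nat.cast_le]
  constructor
  · intro hV
    by_contra! hlt
    have hle : N ≤ k := by omega
    have : V N := Nat.decreasingInduction' (P := V)
      (fun j _ hj hVj => h j (hN.1.trans hj) hVj) hle hV
    exact hN.2 this
  · intro hle
    by_contra hV
    have := Nat.find_min' hall ⟨hk, hV⟩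
    omega

end Existence

/-! ### The number of indices at a zero equals its multiplicity -/

section Counting

lemma root_injective {ε ζ ε' ζ' ρ φ : ℝ} (hε : ε = 1 ∨ ε = -1) (hε' : ε' = 1 ∨ ε' = -1)
    (hζ : ζ = 1 ∨ ζ = -1) (hζ' : ζ' = 1 ∨ ζ' = -1) (hρ : 0 < ρ) (hφ : φ ∈ Set.Ioo 0 Real.pi)
    (h : root ε ζ ρ φ = root ε' ζ' ρ φ) : ε = ε' ∧ ζ = ζ' := by
  have hs := Real.sqrt_pos.2 hρ
  have hpi := Real.pi_pos
  have hc : 0 < Real.cos (φ / 2) :=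
    Real.cos_pos_of_mem_Ioo ⟨by linarith [hφ.1], by linarith [hφ.2]⟩
  have hsin : 0 < Real.sin (φ / 2) :=
    Real.sin_pos_of_mem_Ioo ⟨by linarith [hφ.1], by linarith [hφ.1, hφ.2]⟩
  have h1 := congrArg Complex.re h
  have h2 := congrArg Complex.im h
  rw [root_re hζ, root_re hζ'] at h1
  rw [root_im hζ, root_im hζ'] at h2
  have h3 := mul_right_cancel₀ hs.ne' (mul_right_cancel₀ hc.ne' h1)
  have h4 := mul_right_cancel₀ hs.ne' (mul_right_cancel₀ hsin.ne' h2)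
  subst h3
  refine ⟨rfl, mul_left_cancel₀ ?_ h4⟩
  rcases hε with rfl | rfl <;> norm_num

/-- The argument at a zero. -/
lemma exists_int_of_zero {ε ζ ρ : ℝ} (hζ : ζ = 1 ∨ ζ = -1)
    (h : exp ((ζ * D.theta ρ : ℝ) * I) = ε * T.c) :
    ∃ n : ℤ, D.theta ρ = n * Real.pi + ζ * T.η * T.γ ∧ ε = T.σ * (-1) ^ n := by
  have hσ := T.σ_eq
  have h1 : exp ((ζ * D.theta ρ - T.η * T.γ : ℝ) * I) = ((ε * T.σ : ℝ) : ℂ) := by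
    rw [ofReal_sub, sub_mul, exp_sub, h, c, ofReal_mul ε]
    field_simp
  have hsin : Real.sin (ζ * D.theta ρ - T.η * T.γ) = 0 := by
    have := congrArg Complex.im h1
    rwa [exp_ofReal_mul_I_im, ofReal_im] at this
  have hcos : Real.cos (ζ * D.theta ρ - T.η * T.γ) = ε * T.σ := by
    have := congrArg Complex.re h1
    rwa [exp_ofReal_mul_I_re, ofReal_re] at this
  obtain ⟨N, hN⟩ := Real.sin_eq_zero_iff.1 hsin
  rw [← hN, Real.cos_int_mul_pi] at hcos
  have hε' : ε = T.σ * (-1) ^ N := by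
    rw [hcos]
    rcases hσ with h | h <;> rw [h] <;> ring
  rcases hζ with rfl | rfl
  · exact ⟨N, by linarith, hε'⟩
  · refine ⟨-N, by push_cast; linarith, ?_⟩
    rw [hε', zpow_neg, ← inv_zpow]
    norm_num

/-- The angle vanishes only if `c` is real. -/
lemma γ_eq_zero {ρ s : ℝ} {n : ℤ} (hρ : 0 < ρ) (hs : s = 1 ∨ s = -1)
    (h : D.theta ρ = n * Real.pi + s * T.γ) (h0 : D.angle ρ = 0) : T.γ = 0 := by
  have hpi := Real.pi_pos
  obtain ⟨m, hm⟩ := EquationData.theta_of_angle_eq_zero hρ h0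
  have key : ∃ l : ℤ, T.γ = l * Real.pi := by
    rcases hs with rfl | rfl
    · exact ⟨m - n, by push_cast; linarith⟩
    · exact ⟨n - m, by push_cast; linarith⟩
  obtain ⟨l, hl⟩ := key
  have h1 := T.γ_nonneg
  have h2 := T.γ_le
  rw [hl] at h1 h2
  have h3 : (0 : ℝ) ≤ l := nonneg_of_mul_nonneg_left h1 hpi
  have h4 : (l : ℝ) < 1 := by nlinarith
  have h3' : 0 ≤ l := by exact_mod_cast h3
  have h4' : l < 1 := by exact_mod_cast h4
  have : l = 0 := by omega
  rw [hl, this]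
  simp

/-- The angle is `π` only if `c` is imaginary. -/
lemma γ_eq_pi_div_two {ρ s : ℝ} {n : ℤ} (hτ : D.τ = T.J + 1 / 2) (hρ : 0 < ρ)
    (hs : s = 1 ∨ s = -1) (h : D.theta ρ = n * Real.pi + s * T.γ) (h0 : D.angle ρ = Real.pi) :
    T.γ = Real.pi / 2 := by
  have hpi := Real.pi_pos
  obtain ⟨m, hm⟩ := EquationData.theta_of_angle_eq_pi hρ h0
  rw [hτ] at hm
  have key : ∃ l : ℤ, T.γ = l * Real.pi + Real.pi / 2 := by
    rcases hs with rfl | rfl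
    · exact ⟨m - n - T.J - 1, by push_cast; linarith⟩
    · exact ⟨n - m + T.J, by push_cast; linarith⟩
  obtain ⟨l, hl⟩ := key
  have h1 := T.γ_nonneg
  have h2 := T.γ_le
  rw [hl] at h1 h2
  have h3 : (-1 : ℝ) < l := by nlinarith
  have h4 : (l : ℝ) < 1 := by nlinarith
  have h3' : -1 < l := by exact_mod_cast h3
  have h4' : l < 1 := by exact_mod_cast h4
  have : l = 0 := by omega
  rw [hl, this]
  simp

lemma lev_inj {k l : ℕ} (hk : 1 ≤ k) (hl : 1 ≤ l) (h : T.lev k = T.lev l)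
    (hz : T.zeta k = T.zeta l) : k = l := by
  have hpi := Real.pi_pos
  have hη : T.η ≠ 0 := by rcases T.η_eq with h | h <;> rw [h] <;> norm_num
  have hne : -T.η ≠ T.η := fun h => hη (by linarith)
  obtain ⟨m, rfl | rfl⟩ := exists_eq_odd_or_even hk <;>
    obtain ⟨n, rfl | rfl⟩ := exists_eq_odd_or_even hl
  · rw [lev_odd, lev_odd] at h
    have : (m : ℝ) = n := by
      have := mul_right_cancel₀ hpi.ne' (sub_left_injective h)
      linarith
    have : m = n := by exact_mod_cast this
    rw [this]
  · rw [zeta_odd, zeta_even] at hz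
    exact absurd hz hne
  · rw [zeta_odd, zeta_even] at hz
    exact absurd hz.symm hne
  · rw [lev_even, lev_even] at h
    have : (m : ℝ) = n := by
      have := mul_right_cancel₀ hpi.ne' (add_left_injective _ h)
      linarith
    have : m = n := by exact_mod_cast this
    rw [this]

variable (T D) in
/-- The indices at which the zero `w` with square of modulus `ρ` is listed. -/
def indices (ρ : ℝ) (w : ℂ) : Set ℕ :=
  {k | 1 ≤ k ∧ T.Sel D k ρ ∧ root (T.eps k) (T.zeta k) ρ (D.angle ρ) = w}

lemma indices_of_interior {ε ζ ρ : ℝ} (hε : ε = 1 ∨ ε = -1) (hζ : ζ = 1 ∨ ζ = -1) (hρ : 0 < ρ)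
    (hτ : D.τ = T.J + 1 / 2) (hi : D.angle ρ ∈ Set.Ioo 0 Real.pi)
    (h : exp ((ζ * D.theta ρ : ℝ) * I) = ε * T.c) :
    ∃ k, T.indices D ρ (root ε ζ ρ (D.angle ρ)) = {k} := by
  have hpi := Real.pi_pos
  have hτ0 : 0 < D.τ := by rw [hτ]; positivity
  have hγ0 := T.γ_nonneg
  have hγ1 := T.γ_le
  obtain ⟨n, hn, hn2⟩ := exists_int_of_zero hζ h
  have hLG := EquationData.levelSet_of_interior hρ hi
  -- The starting level set has no least element, whereas that of an interior point does.
  have hstart : -(D.τ * Real.pi) < D.theta ρ := by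
    refine lt_of_le_of_ne (EquationData.start_le_theta hτ0 hρ) fun he => ?_
    rw [← he] at hLG
    exact EquationData.not_isLeast_start hτ0 hLG.1
  have hnJ : 0 ≤ n + T.J := by
    have h1 : ζ * T.η * T.γ ≤ Real.pi / 2 := by
      rcases hζ with rfl | rfl <;> rcases T.η_eq with h | h <;> rw [h] <;> linarith
    have h2 : -((T.J : ℝ) + 1) < n := by
      rw [hτ, hn] at hstart
      nlinarith
    have h3 : -((T.J : ℤ) + 1) < n := by exact_mod_cast h2
    omega
  obtain ⟨m, hm⟩ := Int.eq_ofNat_of_zero_le hnJ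
  have hnm : n = (m : ℤ) - T.J := by omega
  rw [hnm, neg_one_zpow_sub] at hn2
  have hnr : (n : ℝ) = (m : ℝ) - T.J := by rw [hnm]; push_cast; ring
  rw [hnr] at hn
  have hex : ∃ k, 1 ≤ k ∧ T.lev k = D.theta ρ ∧ T.eps k = ε ∧ T.zeta k = ζ := by
    have hcases : ζ = T.η ∨ ζ = -T.η := by
      rcases hζ with rfl | rfl <;> rcases T.η_eq with h | h <;> rw [h] <;> norm_num
    have hηη : T.η * T.η = 1 := by rcases T.η_eq with h | h <;> rw [h] <;> norm_num
    rcases hcases with rfl | rfl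
    · exact ⟨2 * m + 2, by omega, by rw [lev_even, hn, hηη, one_mul], by rw [eps_even, hn2],
        zeta_even _ _⟩
    · exact ⟨2 * m + 1, by omega, by rw [lev_odd, hn, neg_mul, hηη]; ring,
        by rw [eps_odd, hn2], zeta_odd _ _⟩
  obtain ⟨k, hk, e1, e2, e3⟩ := hex
  refine ⟨k, Set.eq_singleton_iff_unique_mem.2 ⟨⟨hk, ⟨fun _ => e1 ▸ hLG.1, fun _ => e1 ▸ hLG.2⟩,
    by rw [e2, e3]⟩, ?_⟩⟩
  rintro l ⟨hl, hsel, hw⟩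
  have hr := root_injective (T.eps_eq l) hε (T.zeta_eq l) hζ hρ hi hw
  exact lev_inj hl hk (by rw [← hsel.theta, e1]) (by rw [hr.2, e3])

lemma encard_pair_ite {P Q : Prop} [Decidable P] [Decidable Q] {S : Set ℕ} {a b : ℕ} (hab : a ≠ b)
    (ha : a ∈ S ↔ P) (hb : b ∈ S ↔ Q) (h : ∀ x ∈ S, x = a ∨ x = b) :
    S.encard = (if P then 1 else 0) + (if Q then 1 else 0) := by
  by_cases hP : P <;> by_cases hQ : Q
  · have : S = {a, b} := by
      ext x
      exact ⟨h x, by rintro (rfl | rfl); exacts [ha.2 hP, hb.2 hQ]⟩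
    rw [this, Set.encard_pair hab, if_pos hP, if_pos hQ]
    rfl
  · have : S = {a} := by
      ext x
      refine ⟨fun hx => (h x hx).elim id fun he => absurd (hb.1 (he ▸ hx)) hQ, ?_⟩
      rintro rfl
      exact ha.2 hP
    rw [this, Set.encard_singleton, if_pos hP, if_neg hQ, add_zero]
  · have : S = {b} := by
      ext x
      refine ⟨fun hx => (h x hx).elim (fun he => absurd (ha.1 (he ▸ hx)) hP) id, ?_⟩
      rintro rfl
      exact hb.2 hQ
    rw [this, Set.encard_singleton, if_neg hP, if_pos hQ, zero_add]
  · have : S = ∅ := by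
      ext x
      refine ⟨fun hx => ?_, fun hx => hx.elim⟩
      rcases h x hx with he | he
      exacts [absurd (ha.1 (he ▸ hx)) hP, absurd (hb.1 (he ▸ hx)) hQ]
    rw [this, Set.encard_empty, if_neg hP, if_neg hQ, add_zero]

-- Angle 0 forces γ = 0, and the level is shared by the indices 2m + 1 and 2m + 2, which claim its
-- least and greatest radius.
open Classical in
lemma encard_indices_of_angle_eq_zero {ε ζ ρ : ℝ} (hζ : ζ = 1 ∨ ζ = -1)
    (hρ : 0 < ρ) (hτ : D.τ = T.J + 1 / 2) (hi : D.angle ρ = 0)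
    (h : exp ((ζ * D.theta ρ : ℝ) * I) = ε * T.c) :
    (T.indices D ρ (root ε ζ ρ (D.angle ρ))).encard =
      (if IsLeast (D.levelSet (D.theta ρ)) ρ then 1 else 0) +
      (if IsGreatest (D.levelSet (D.theta ρ)) ρ then 1 else 0) := by
  have hpi := Real.pi_pos
  have hτ0 : 0 < D.τ := by rw [hτ]; positivity
  obtain ⟨n, hn, hn2⟩ := exists_int_of_zero hζ h
  have hs : ζ * T.η = 1 ∨ ζ * T.η = -1 := by
    rcases hζ with rfl | rfl <;> rcases T.η_eq with h | h <;> rw [h] <;> norm_num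
  have hγ : T.γ = 0 := γ_eq_zero hρ hs hn hi
  have hγ' : T.γ < Real.pi / 2 := by rw [hγ]; positivity
  rw [hγ, mul_zero, add_zero] at hn
  have hstart := EquationData.start_le_theta hτ0 hρ
  have hnJ : 0 ≤ n + T.J := by
    have h2 : -((T.J : ℝ) + 1) < n := by
      rw [hτ, hn] at hstart
      nlinarith
    have h3 : -((T.J : ℤ) + 1) < n := by exact_mod_cast h2
    omega
  obtain ⟨m, hm⟩ := Int.eq_ofNat_of_zero_le hnJ
  have hnm : n = (m : ℤ) - T.J := by omega
  rw [hnm, neg_one_zpow_sub] at hn2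
  have hnr : (n : ℝ) = (m : ℝ) - T.J := by rw [hnm]; push_cast; ring
  rw [hnr] at hn
  have hroot : ∀ ζ', root ε ζ' ρ (D.angle ρ) = root ε ζ ρ (D.angle ρ) := fun ζ' => by
    rw [root, root, hi, zero_div, mul_zero, mul_zero]
  refine encard_pair_ite (a := 2 * m + 1) (b := 2 * m + 2) (by omega) ?_ ?_ ?_
  · rw [indices, Set.mem_ofPred_eq, sel_odd hγ', hγ, sub_zero, ← hn, eps_odd, ← hn2]
    simp [hroot]
  · rw [indices, Set.mem_ofPred_eq, sel_even hγ', hγ, add_zero, ← hn, eps_even, ← hn2]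
    simp [hroot]
  · rintro k ⟨hk, hsel, -⟩
    have hth := hsel.theta
    rw [hn] at hth
    obtain ⟨l, rfl | rfl⟩ := exists_eq_odd_or_even hk
    · left
      rw [lev_odd, hγ, sub_zero] at hth
      have := mul_right_cancel₀ hpi.ne' hth
      have : (m : ℝ) = l := by linarith
      have : m = l := by exact_mod_cast this
      omega
    · right
      rw [lev_even, hγ, add_zero] at hth
      have := mul_right_cancel₀ hpi.ne' hth
      have : (m : ℝ) = l := by linarith
      have : m = l := by exact_mod_cast this
      omega

lemma root_pi {ε ζ ρ : ℝ} (hζ : ζ = 1 ∨ ζ = -1) :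
    root ε ζ ρ Real.pi = ((ε * ζ * √ρ : ℝ) : ℂ) * I := by
  apply Complex.ext
  · rw [root_re hζ, Real.cos_pi_div_two]; simp
  · rw [root_im hζ, Real.sin_pi_div_two]; simp

-- Angle π forces γ = π/2, and the level (N − J)π − π/2 is shared by the indices 2N and 2N + 1,
-- which claim its least and greatest radius. For N = 0 the first of these is not an index of the
-- list.
open Classical in
lemma encard_indices_of_angle_eq_pi {ε ζ ρ : ℝ} (hζ : ζ = 1 ∨ ζ = -1)
    (hρ : 0 < ρ) (hτ : D.τ = T.J + 1 / 2) (hi : D.angle ρ = Real.pi)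
    (h : exp ((ζ * D.theta ρ : ℝ) * I) = ε * T.c) :
    (T.indices D ρ (root ε ζ ρ (D.angle ρ))).encard =
      (if IsLeast (D.levelSet (D.theta ρ)) ρ then 1 else 0) +
      (if IsGreatest (D.levelSet (D.theta ρ)) ρ then 1 else 0) := by
  have hpi := Real.pi_pos
  have hτ0 : 0 < D.τ := by rw [hτ]; positivity
  obtain ⟨n, hn, hn2⟩ := exists_int_of_zero hζ h
  have hs : ζ * T.η = 1 ∨ ζ * T.η = -1 := by
    rcases hζ with rfl | rfl <;> rcases T.η_eq with h | h <;> rw [h] <;> norm_num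
  have hγ : T.γ = Real.pi / 2 := γ_eq_pi_div_two hτ hρ hs hn hi
  have hstart := EquationData.start_le_theta hτ0 hρ
  obtain ⟨N, hN, hNε⟩ : ∃ N : ℕ, D.theta ρ = ((N : ℝ) - T.J) * Real.pi - Real.pi / 2 ∧
      ε * ζ = T.σ * (-1) ^ (N + T.J) * (-T.η) := by
    have key : ∃ l : ℤ, D.theta ρ = l * Real.pi - Real.pi / 2 ∧
        ε * ζ = T.σ * (-1) ^ l * (-T.η) := by
      rcases hs with hs | hs
      · refine ⟨n + 1, by rw [hn, hs, hγ]; push_cast; ring, ?_⟩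
        have : ζ = T.η := by
          rcases hζ with rfl | rfl <;> rcases T.η_eq with h | h <;> rw [h] at hs ⊢ <;> linarith
        rw [hn2, zpow_add_one₀ (by norm_num), this]
        ring
      · refine ⟨n, by rw [hn, hs, hγ]; ring, ?_⟩
        have : ζ = -T.η := by
          rcases hζ with rfl | rfl <;> rcases T.η_eq with h | h <;> rw [h] at hs ⊢ <;> linarith
        rw [hn2, this]
    obtain ⟨l, hl, hl2⟩ := key
    have hlJ : 0 ≤ l + T.J := by
      have h2 : -((T.J : ℝ) + 1) < l := by
        rw [hτ, hl] at hstart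
        nlinarith
      have h3 : -((T.J : ℤ) + 1) < l := by exact_mod_cast h2
      omega
    obtain ⟨N, hN⟩ := Int.eq_ofNat_of_zero_le hlJ
    have hlN : l = (N : ℤ) - T.J := by omega
    refine ⟨N, by rw [hl, hlN]; push_cast; ring, by rw [hl2, hlN, neg_one_zpow_sub]⟩
  -- On the imaginary axis only the product εζ is determined by the point.
  have hroot : ∀ k, root (T.eps k) (T.zeta k) ρ (D.angle ρ) = root ε ζ ρ (D.angle ρ) ↔
      T.eps k * T.zeta k = ε * ζ := fun k => by
    have hsq : √ρ ≠ 0 := (Real.sqrt_pos.2 hρ).ne'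
    rw [hi, root_pi (T.zeta_eq k), root_pi hζ, mul_left_inj' I_ne_zero, ofReal_inj,
      mul_left_inj' hsq]
  rcases Nat.eq_zero_or_pos N with hN0 | hN0
  · have hnl : ¬ IsLeast (D.levelSet (D.theta ρ)) ρ := by
      have : D.theta ρ = -(D.τ * Real.pi) := by rw [hN, hτ, hN0]; push_cast; ring
      rw [this]
      exact EquationData.not_isLeast_start hτ0
    refine encard_pair_ite (a := 0) (b := 2 * N + 1) (by omega) ?_ ?_ ?_
    · simp [indices, hnl]
    · rw [indices, Set.mem_ofPred_eq, sel_odd' hγ, hγ, ← hN, hroot, eps_odd, zeta_odd, hNε]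
      simp
    · rintro k ⟨hk, hsel, -⟩
      right
      have hth := hsel.theta
      rw [hN] at hth
      obtain ⟨l, rfl | rfl⟩ := exists_eq_odd_or_even hk
      · rw [lev_odd, hγ, sub_left_inj] at hth
        have := mul_right_cancel₀ hpi.ne' hth
        have : (N : ℝ) = l := by linarith
        have : N = l := by exact_mod_cast this
        omega
      · rw [lev_even, hγ] at hth
        have h1 : ((N : ℝ) - T.J) * Real.pi = ((l : ℝ) + 1 - T.J) * Real.pi := by linarith
        have := mul_right_cancel₀ hpi.ne' h1
        have : (N : ℝ) = l + 1 := by linarith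
        have : N = l + 1 := by exact_mod_cast this
        omega
  · obtain ⟨M, rfl⟩ : ∃ M, N = M + 1 := ⟨N - 1, by omega⟩
    have hN' : D.theta ρ = ((M : ℝ) - T.J) * Real.pi + Real.pi / 2 := by
      rw [hN]; push_cast; ring
    refine encard_pair_ite (a := 2 * M + 2) (b := 2 * (M + 1) + 1) (by omega) ?_ ?_ ?_
    · rw [indices, Set.mem_ofPred_eq, sel_even' hγ, hγ, ← hN', hroot, eps_even, zeta_even, hNε]
      have : T.σ * (-1) ^ (M + T.J) * T.η = T.σ * (-1) ^ (M + 1 + T.J) * -T.η := by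
        rw [add_right_comm, pow_succ]; ring
      simp [this]
    · rw [indices, Set.mem_ofPred_eq, sel_odd' hγ, hγ, ← hN, hroot, eps_odd, zeta_odd, hNε]
      simp
    · rintro k ⟨hk, hsel, -⟩
      have hth := hsel.theta
      obtain ⟨l, rfl | rfl⟩ := exists_eq_odd_or_even hk
      · right
        rw [hN, lev_odd, hγ, sub_left_inj] at hth
        have := mul_right_cancel₀ hpi.ne' hth
        have : ((M + 1 : ℕ) : ℝ) = l := by linarith
        have : M + 1 = l := by exact_mod_cast this
        omega
      · left
        rw [hN', lev_even, hγ, add_left_inj] at hth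
        have := mul_right_cancel₀ hpi.ne' hth
        have : (M : ℝ) = l := by linarith
        have : M = l := by exact_mod_cast this
        omega

/-- A zero is listed as often as its multiplicity says. -/
lemma encard_indices {ε ζ ρ : ℝ} (hε : ε = 1 ∨ ε = -1) (hζ : ζ = 1 ∨ ζ = -1) (hρ : 0 < ρ)
    (hτ : D.τ = T.J + 1 / 2) (ha : D.Active ρ)
    (h : exp ((ζ * D.theta ρ : ℝ) * I) = ε * T.c) :
    (T.indices D ρ (root ε ζ ρ (D.angle ρ))).encard =
      analyticOrderAt (D.charFun T.c T.J) (root ε ζ ρ (D.angle ρ)) := by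
  have h0 : D.charFun T.c T.J (root ε ζ ρ (D.angle ρ)) = 0 :=
    (EquationData.charFun_root_eq_zero_iff hε hζ hρ (D.angle_mem ρ) hτ T.norm_c).2 ⟨rfl, ha, h⟩
  rcases D.angle_cases ρ with hi | hi | hi
  · rw [encard_indices_of_angle_eq_zero hζ hρ hτ hi h,
      EquationData.analyticOrderAt_charFun_of_edge hε hζ hρ hτ (Or.inl hi) ha h0]
  · rw [encard_indices_of_angle_eq_pi hζ hρ hτ hi h,
      EquationData.analyticOrderAt_charFun_of_edge hε hζ hρ hτ (Or.inr hi) ha h0]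
  · obtain ⟨k, hk⟩ := indices_of_interior hε hζ hρ hτ hi h
    rw [hk, Set.encard_singleton,
      EquationData.analyticOrderAt_charFun_of_interior hε hζ hρ hτ hi h0]

end Counting

end Frame

end MeromorphicZeros

/-! ### The list of zeros and the signs of their coordinates -/

namespace MeromorphicZeros
open scoped Topology

namespace EquationData

variable {ι κ : Type*} {D : EquationData ι κ} {c : ℂ} {J : ℕ}

lemma analyticOrderAt_charFun_cases (hτ : D.τ = J + 1 / 2) (hc : ‖c‖ = 1) (w : ℂ) :
    analyticOrderAt (D.charFun c J) w ≤ 2 ∧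
      (w.re ≠ 0 → w.im ≠ 0 → analyticOrderAt (D.charFun c J) w ≤ 1) := by
  by_cases h0 : D.charFun c J w = 0
  swap
  · rw [(analyticAt_charFun w).analyticOrderAt_eq_zero.2 h0]
    simp
  have hw : w ≠ 0 := by rintro rfl; simp [charFun_zero] at h0
  obtain ⟨ε, ζ, ρ, φ, hε, hζ, hρ, hφ, rfl⟩ := exists_eq_root hw
  obtain ⟨rfl, ha, -⟩ := (charFun_root_eq_zero_iff hε hζ hρ hφ hτ hc).1 h0
  by_cases hi : D.angle ρ ∈ Set.Ioo 0 Real.pi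
  · rw [analyticOrderAt_charFun_of_interior hε hζ hρ hτ hi h0]
    exact ⟨one_le_two, fun _ _ => le_rfl⟩
  have hi' : D.angle ρ = 0 ∨ D.angle ρ = Real.pi := by
    rcases D.angle_cases ρ with h | h | h
    exacts [Or.inl h, Or.inr h, absurd h hi]
  constructor
  · rw [analyticOrderAt_charFun_of_edge hε hζ hρ hτ hi' ha h0, ← one_add_one_eq_two]
    gcongr <;> split_ifs <;> simp
  · intro h1 h2
    rcases hi' with h | h <;> rw [h] at h1 h2
    · rw [root_im hζ] at h2
      simp at h2
    · rw [root_re hζ] at h1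
      simp at h1

end EquationData

namespace Frame

variable {ι κ : Type*} (T : Frame) (D : EquationData ι κ)

open Classical in
/-- The square of the modulus of the `k`-th zero. -/
noncomputable def rad (k : ℕ) : ℝ := if h : ∃ ρ, T.Sel D k ρ then h.choose else 1

/-- The `k`-th zero. -/
noncomputable def zero (k : ℕ) : ℂ :=
  root (T.eps k) (T.zeta k) (T.rad D k) (D.angle (T.rad D k))

variable {T D}

lemma sel_rad {k : ℕ} (h : ∃ ρ, T.Sel D k ρ) : T.Sel D k (T.rad D k) := by
  rw [rad, dif_pos h]
  exact h.choose_spec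

variable (T D) in
lemma norm_zero (k : ℕ) : ‖T.zero D k‖ = √(T.rad D k) := norm_root (T.eps_eq k)

variable (T D) in
lemma zero_re (k : ℕ) :
    (T.zero D k).re = T.eps k * √(T.rad D k) * Real.cos (D.angle (T.rad D k) / 2) :=
  root_re (T.zeta_eq k)

variable (T D) in
lemma zero_im (k : ℕ) :
    (T.zero D k).im = T.eps k * T.zeta k * √(T.rad D k) * Real.sin (D.angle (T.rad D k) / 2) :=
  root_im (T.zeta_eq k)

lemma sqrt_rad_pos {k : ℕ} (h : ∃ ρ, T.Sel D k ρ) : 0 < √(T.rad D k) :=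
  Real.sqrt_pos.2 (sel_rad h).pos

/-- The modulus of a zero determines the radius, and the radius with an index determines the entry.
The entries equal to w are thus those counted by `indices`. -/
lemma isZeroList {F : ℂ → ℂ} {ω : ℕ∞} (hτ : D.τ = T.J + 1 / 2)
    (hF : ∀ w, zeroMult F w = analyticOrderAt (D.charFun T.c T.J) w)
    (hω : ∀ k : ℕ, 1 ≤ k → ((∃ ρ, T.Sel D k ρ) ↔ (k : ℕ∞) ≤ ω)) :
    IsZeroList F ω (T.zero D) := by
  intro w
  rw [hF]
  have hzero : ∀ k : ℕ, 1 ≤ k → (k : ℕ∞) ≤ ω → D.charFun T.c T.J (T.zero D k) = 0 :=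
    fun k hk hkω => Sel.charFun_eq_zero hk hτ (sel_rad ((hω k hk).2 hkω))
  by_cases h0 : D.charFun T.c T.J w = 0
  swap
  · rw [(EquationData.analyticAt_charFun w).analyticOrderAt_eq_zero.2 h0, Set.encard_eq_zero,
      Set.eq_empty_iff_forall_notMem]
    rintro k ⟨hk, hkω, rfl⟩
    exact h0 (hzero k hk hkω)
  have hw : w ≠ 0 := by rintro rfl; simp [EquationData.charFun_zero] at h0
  obtain ⟨ε, ζ, ρ, φ, hε, hζ, hρ, hφ, rfl⟩ := exists_eq_root hw
  obtain ⟨rfl, ha, he⟩ :=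
    (EquationData.charFun_root_eq_zero_iff hε hζ hρ hφ hτ T.norm_c).1 h0
  rw [← encard_indices hε hζ hρ hτ ha he]
  congr 1
  ext k
  constructor
  · rintro ⟨hk, hkω, hz⟩
    have hsel := sel_rad ((hω k hk).2 hkω)
    have hn := congrArg norm hz
    rw [norm_zero, norm_root hε] at hn
    have hr : T.rad D k = ρ := (Real.sqrt_inj hsel.pos.le hρ.le).1 hn
    rw [zero, hr] at hz
    exact ⟨hk, hr ▸ hsel, hz⟩
  · rintro ⟨hk, hsel, hz⟩
    have hex : ∃ ρ, T.Sel D k ρ := ⟨ρ, hsel⟩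
    refine ⟨hk, (hω k hk).1 hex, ?_⟩
    rw [zero, (sel_rad hex).unique hsel, hz]

lemma Sel.angle_ne_zero {k : ℕ} {ρ : ℝ} (h : T.Sel D k ρ) (hγ : T.γ ≠ 0) : D.angle ρ ≠ 0 := by
  refine fun h0 => hγ (γ_eq_zero h.pos (neg_one_pow_eq_or ℝ k)
    (n := (((k - 1) / 2 : ℕ) : ℤ) - T.J) ?_ h0)
  rw [h.theta, lev]
  push_cast
  rfl

lemma Sel.angle_ne_pi {k : ℕ} {ρ : ℝ} (h : T.Sel D k ρ) (hτ : D.τ = T.J + 1 / 2)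
    (hγ : T.γ ≠ Real.pi / 2) : D.angle ρ ≠ Real.pi := by
  refine fun h0 => hγ (γ_eq_pi_div_two hτ h.pos (neg_one_pow_eq_or ℝ k)
    (n := (((k - 1) / 2 : ℕ) : ℤ) - T.J) ?_ h0)
  rw [h.theta, lev]
  push_cast
  rfl

lemma cos_half_angle_nonneg (ρ : ℝ) : 0 ≤ Real.cos (D.angle ρ / 2) :=
  Real.cos_nonneg_of_mem_Icc
    ⟨by linarith [(D.angle_mem ρ).1, Real.pi_pos], by linarith [(D.angle_mem ρ).2]⟩

lemma sin_half_angle_nonneg (ρ : ℝ) : 0 ≤ Real.sin (D.angle ρ / 2) :=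
  Real.sin_nonneg_of_nonneg_of_le_pi (by linarith [(D.angle_mem ρ).1])
    (by linarith [(D.angle_mem ρ).2, Real.pi_pos])

lemma Sel.cos_pos {k : ℕ} {ρ : ℝ} (h : T.Sel D k ρ) (hτ : D.τ = T.J + 1 / 2)
    (hγ : T.γ ≠ Real.pi / 2) : 0 < Real.cos (D.angle ρ / 2) := by
  have hm := D.angle_mem ρ
  have := lt_of_le_of_ne hm.2 (h.angle_ne_pi hτ hγ)
  exact Real.cos_pos_of_mem_Ioo ⟨by linarith [hm.1, Real.pi_pos], by linarith⟩

lemma Sel.sin_pos {k : ℕ} {ρ : ℝ} (h : T.Sel D k ρ) (hγ : T.γ ≠ 0) :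
    0 < Real.sin (D.angle ρ / 2) := by
  have hm := D.angle_mem ρ
  have := lt_of_le_of_ne hm.1 (h.angle_ne_zero hγ).symm
  exact Real.sin_pos_of_pos_of_lt_pi (by linarith) (by linarith [hm.2, Real.pi_pos])

lemma eps_mul_eps (k : ℕ) : T.eps k * T.eps k = 1 := by
  rcases T.eps_eq k with h | h <;> rw [h] <;> norm_num

lemma zeta_mul_zeta (k : ℕ) : T.zeta k * T.zeta k = 1 := by
  rcases T.zeta_eq k with h | h <;> rw [h] <;> norm_num

lemma eps_mul_zero_re_pos {k : ℕ} (h : ∃ ρ, T.Sel D k ρ) (hτ : D.τ = T.J + 1 / 2)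
    (hγ : T.γ ≠ Real.pi / 2) : 0 < T.eps k * (T.zero D k).re := by
  have := mul_pos (sqrt_rad_pos h) ((sel_rad h).cos_pos hτ hγ)
  rw [zero_re]
  linear_combination this - √(T.rad D k) * Real.cos (D.angle (T.rad D k) / 2) * T.eps_mul_eps k

lemma eps_mul_zero_im_pos {k : ℕ} (h : ∃ ρ, T.Sel D k ρ) (hγ : T.γ ≠ 0) :
    0 < T.eps k * T.zeta k * (T.zero D k).im := by
  have := mul_pos (sqrt_rad_pos h) ((sel_rad h).sin_pos hγ)
  have h2 := T.eps_mul_eps k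
  have h3 := T.zeta_mul_zeta k
  have : T.eps k * T.zeta k * (T.zero D k).im =
      √(T.rad D k) * Real.sin (D.angle (T.rad D k) / 2) := by
    rw [zero_im]
    linear_combination √(T.rad D k) * Real.sin (D.angle (T.rad D k) / 2) * (h2 + T.eps k ^ 2 * h3)
  rwa [this]

lemma norm_lt_norm {k l : ℕ} (hk : ∃ ρ, T.Sel D k ρ) (hl : ∃ ρ, T.Sel D l ρ)
    (h : T.lev k < T.lev l) : ‖T.zero D k‖ < ‖T.zero D l‖ := by
  rw [norm_zero, norm_zero]
  have h1 := sel_rad hk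
  have h2 := sel_rad hl
  exact Real.sqrt_lt_sqrt h1.pos.le
    (EquationData.lt_of_theta_lt h2.pos (by rwa [h1.theta, h2.theta]))

/-- Consecutive levels differ alternately by 2γ and π − 2γ. -/
lemma lev_lt_lev_succ (hγ : 0 < T.γ) (hγ' : T.γ < Real.pi / 2) {k : ℕ} (hk : 1 ≤ k) :
    T.lev k < T.lev (k + 1) := by
  obtain ⟨m, rfl | rfl⟩ := exists_eq_odd_or_even hk
  · rw [show 2 * m + 1 + 1 = 2 * m + 2 by ring, lev_odd, lev_even]
    linarith
  · rw [show 2 * m + 2 + 1 = 2 * (m + 1) + 1 by ring, lev_odd, lev_even]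
    push_cast
    linarith

variable (T) in
lemma zeta_succ (k : ℕ) : T.zeta (k + 1) = -T.zeta k := by
  rw [zeta, zeta, pow_succ]
  ring

variable (T) in
lemma eps_succ_of_odd (m : ℕ) : T.eps (2 * m + 1 + 1) = T.eps (2 * m + 1) := by
  rw [show 2 * m + 1 + 1 = 2 * m + 2 by ring, eps_odd, eps_even]

variable (T) in
lemma eps_succ_of_even (m : ℕ) : T.eps (2 * m + 2 + 1) = -T.eps (2 * m + 2) := by
  rw [show 2 * m + 2 + 1 = 2 * (m + 1) + 1 by ring, eps_odd, eps_even, add_right_comm, pow_succ]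
  ring

variable (T) in
lemma eps_one : T.eps 1 = T.σ * (-1) ^ T.J := by
  have := T.eps_odd 0
  simpa using this

variable (T) in
lemma zeta_one : T.zeta 1 = -T.η := T.zeta_odd 0

variable (T) in
lemma c_re : T.c.re = T.σ * Real.cos T.γ := by
  rw [c, re_ofReal_mul, exp_ofReal_mul_I_re]
  rcases T.η_eq with h | h <;> rw [h] <;> simp

variable (T) in
lemma c_im : T.c.im = T.σ * T.η * Real.sin T.γ := by
  rw [c, im_ofReal_mul, exp_ofReal_mul_I_im]
  rcases T.η_eq with h | h <;> rw [h] <;> simp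

lemma σ_mul_σ : T.σ * T.σ = 1 := by rcases T.σ_eq with h | h <;> rw [h] <;> norm_num

variable (T) in
lemma c_sq_im : (T.c ^ 2).im = T.η * (2 * (Real.sin T.γ * Real.cos T.γ)) := by
  rw [pow_two, mul_im, c_re, c_im]
  linear_combination 2 * T.η * Real.sin T.γ * Real.cos T.γ * σ_mul_σ (T := T)

lemma sin_γ_pos (h : T.γ ≠ 0) : 0 < Real.sin T.γ :=
  Real.sin_pos_of_pos_of_lt_pi (lt_of_le_of_ne T.γ_nonneg h.symm)
    (by linarith [T.γ_le, Real.pi_pos])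

lemma cos_γ_pos (h : T.γ ≠ Real.pi / 2) : 0 < Real.cos T.γ :=
  Real.cos_pos_of_mem_Ioo ⟨by linarith [T.γ_nonneg, Real.pi_pos], lt_of_le_of_ne T.γ_le h⟩

lemma first_re_pos (h : ∃ ρ, T.Sel D 1 ρ) (hτ : D.τ = T.J + 1 / 2) (hγ : T.γ ≠ Real.pi / 2) :
    0 < (-1) ^ T.J * T.c.re * (T.zero D 1).re := by
  have h1 := mul_pos (cos_γ_pos hγ) (eps_mul_zero_re_pos h hτ hγ)
  rw [eps_one] at h1
  rw [c_re]
  linarith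

lemma first_im_neg (h : ∃ ρ, T.Sel D 1 ρ) (hγ : T.γ ≠ 0) :
    (-1) ^ T.J * T.c.im * (T.zero D 1).im < 0 := by
  have h1 := mul_pos (sin_γ_pos hγ) (eps_mul_zero_im_pos h hγ)
  rw [eps_one, zeta_one] at h1
  rw [c_im]
  linarith

lemma zero_re_mul_zero_im (k : ℕ) : (T.zero D k).re * (T.zero D k).im = T.zeta k *
    (√(T.rad D k) ^ 2 * (Real.cos (D.angle (T.rad D k) / 2) *
      Real.sin (D.angle (T.rad D k) / 2))) := by
  rw [zero_re, zero_im]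
  linear_combination T.zeta k * √(T.rad D k) ^ 2 * Real.cos (D.angle (T.rad D k) / 2) *
      Real.sin (D.angle (T.rad D k) / 2) * T.eps_mul_eps k

lemma zeta_mul_re_mul_im_pos {k : ℕ} (h : ∃ ρ, T.Sel D k ρ) (hτ : D.τ = T.J + 1 / 2)
    (hγ : T.γ ≠ 0) (hγ' : T.γ ≠ Real.pi / 2) :
    0 < T.zeta k * ((T.zero D k).re * (T.zero D k).im) := by
  have h1 := sqrt_rad_pos h
  have h2 := (sel_rad h).cos_pos hτ hγ'
  have h3 := (sel_rad h).sin_pos hγ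
  rw [zero_re_mul_zero_im, ← mul_assoc, zeta_mul_zeta, one_mul]
  positivity

lemma exists_sel_and_succ {ω : ℕ∞} (hω : ∀ k : ℕ, 1 ≤ k → ((∃ ρ, T.Sel D k ρ) ↔ (k : ℕ∞) ≤ ω))
    {k : ℕ} (hk : 1 ≤ k) (h : ((k + 1 : ℕ) : ℕ∞) ≤ ω) :
    (∃ ρ, T.Sel D k ρ) ∧ ∃ ρ, T.Sel D (k + 1) ρ :=
  ⟨(hω k hk).2 ((Nat.cast_le.2 k.le_succ).trans h), (hω (k + 1) (by omega)).2 h⟩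

end Frame

end MeromorphicZeros

/-! ### The four distributions -/

namespace MeromorphicZeros
open scoped Topology

lemma IsZeroList.exists_of_zeroMult_ne_zero {F : ℂ → ℂ} {ω : ℕ∞} {z : ℕ → ℂ}
    (h : IsZeroList F ω z) {w : ℂ} (hw : zeroMult F w ≠ 0) :
    ∃ k : ℕ, 1 ≤ k ∧ (k : ℕ∞) ≤ ω ∧ z k = w := by
  rw [← h w, Set.encard_ne_zero] at hw
  exact hw

namespace Frame

variable {ι κ : Type*} {T : Frame} {D : EquationData ι κ} {F : ℂ → ℂ} {ω : ℕ∞}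

lemma simple_of_interior (hτ : D.τ = T.J + 1 / 2)
    (hF : ∀ w, zeroMult F w = analyticOrderAt (D.charFun T.c T.J) w)
    (hω : ∀ k : ℕ, 1 ≤ k → ((∃ ρ, T.Sel D k ρ) ↔ (k : ℕ∞) ≤ ω))
    (hγ : T.γ ≠ 0) (hγ' : T.γ ≠ Real.pi / 2) (w : ℂ) : zeroMult F w ≤ 1 := by
  by_cases h0 : zeroMult F w = 0
  · rw [h0]; exact zero_le_one
  obtain ⟨k, hk, hkω, rfl⟩ := (isZeroList hτ hF hω).exists_of_zeroMult_ne_zero h0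
  have h := zeta_mul_re_mul_im_pos ((hω k hk).2 hkω) hτ hγ hγ'
  rw [hF]
  refine (EquationData.analyticOrderAt_charFun_cases hτ T.norm_c _).2 ?_ ?_ <;>
    intro h0 <;> simp [h0] at h

lemma im_sq_ne_zero {k : ℕ} (h : ∃ ρ, T.Sel D k ρ) (hτ : D.τ = T.J + 1 / 2)
    (hγ : T.γ ≠ 0) (hγ' : T.γ ≠ Real.pi / 2) : (T.zero D k ^ 2).im ≠ 0 := by
  have h := zeta_mul_re_mul_im_pos h hτ hγ hγ'
  intro h0
  rw [pow_two, mul_im] at h0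
  have : (T.zero D k).re * (T.zero D k).im = 0 := by linarith
  simp [this] at h

/-- From one index to the next ζ always changes sign, while ε changes only from even to odd indices.
With ζ = −1 at odd indices this is a counterclockwise walk through the quadrants. -/
lemma distribution₁ (hτ : D.τ = T.J + 1 / 2)
    (hF : ∀ w, zeroMult F w = analyticOrderAt (D.charFun T.c T.J) w)
    (hω : ∀ k : ℕ, 1 ≤ k → ((∃ ρ, T.Sel D k ρ) ↔ (k : ℕ∞) ≤ ω))
    (hγ : T.γ ≠ 0) (hγ' : T.γ ≠ Real.pi / 2) (hη : T.η = 1) :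
    Distribution₁ F T.c T.J ω (T.zero D) := by
  have hγ0 := lt_of_le_of_ne T.γ_nonneg hγ.symm
  have hγ1 := lt_of_le_of_ne T.γ_le hγ'
  have hone := exists_sel_one hτ
  constructor
  · exact simple_of_interior hτ hF hω hγ hγ'
  · rw [norm_zero]; exact sqrt_rad_pos hone
  · intro k hk hkω
    obtain ⟨h1, h2⟩ := exists_sel_and_succ hω hk hkω
    exact norm_lt_norm h1 h2 (lev_lt_lev_succ hγ0 hγ1 hk)
  · exact fun k hk hkω => im_sq_ne_zero ((hω k hk).2 hkω) hτ hγ hγ'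
  · intro k hk hkω
    obtain ⟨h1, h2⟩ := exists_sel_and_succ hω hk hkω
    have a1 := eps_mul_zero_re_pos h1 hτ hγ'
    have a2 := eps_mul_zero_im_pos h1 hγ
    have b1 := eps_mul_zero_re_pos h2 hτ hγ'
    have b2 := eps_mul_zero_im_pos h2 hγ
    rw [zeta_succ] at b2
    simp only [Q₁, Q₂, Q₃, Q₄, Set.mem_ofPred_eq]
    obtain ⟨m, rfl | rfl⟩ := exists_eq_odd_or_even hk
    · rw [eps_succ_of_odd] at b1 b2
      rw [zeta_odd, hη] at a2 b2
      rcases T.eps_eq (2 * m + 1) with he | he <;> rw [he] at a1 a2 b1 b2 <;>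
        refine ⟨?_, ?_, ?_, ?_⟩ <;> rintro ⟨h3, h4⟩ <;> constructor <;> linarith
    · rw [eps_succ_of_even] at b1 b2
      rw [zeta_even, hη] at a2 b2
      rcases T.eps_eq (2 * m + 2) with he | he <;> rw [he] at a1 a2 b1 b2 <;>
        refine ⟨?_, ?_, ?_, ?_⟩ <;> rintro ⟨h3, h4⟩ <;> constructor <;> linarith
  · exact first_re_pos hone hτ hγ'
  · have := zeta_mul_re_mul_im_pos hone hτ hγ hγ'
    rw [zeta_one, hη] at this
    linarith

/-- The same sign pattern with ζ = 1 at odd indices walks clockwise. -/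
lemma distribution₂ (hτ : D.τ = T.J + 1 / 2)
    (hF : ∀ w, zeroMult F w = analyticOrderAt (D.charFun T.c T.J) w)
    (hω : ∀ k : ℕ, 1 ≤ k → ((∃ ρ, T.Sel D k ρ) ↔ (k : ℕ∞) ≤ ω))
    (hγ : T.γ ≠ 0) (hγ' : T.γ ≠ Real.pi / 2) (hη : T.η = -1) :
    Distribution₂ F T.c T.J ω (T.zero D) := by
  have hγ0 := lt_of_le_of_ne T.γ_nonneg hγ.symm
  have hγ1 := lt_of_le_of_ne T.γ_le hγ'
  have hone := exists_sel_one hτ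
  constructor
  · exact simple_of_interior hτ hF hω hγ hγ'
  · rw [norm_zero]; exact sqrt_rad_pos hone
  · intro k hk hkω
    obtain ⟨h1, h2⟩ := exists_sel_and_succ hω hk hkω
    exact norm_lt_norm h1 h2 (lev_lt_lev_succ hγ0 hγ1 hk)
  · exact fun k hk hkω => im_sq_ne_zero ((hω k hk).2 hkω) hτ hγ hγ'
  · intro k hk hkω
    obtain ⟨h1, h2⟩ := exists_sel_and_succ hω hk hkω
    have a1 := eps_mul_zero_re_pos h1 hτ hγ'
    have a2 := eps_mul_zero_im_pos h1 hγ
    have b1 := eps_mul_zero_re_pos h2 hτ hγ'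
    have b2 := eps_mul_zero_im_pos h2 hγ
    rw [zeta_succ] at b2
    simp only [Q₁, Q₂, Q₃, Q₄, Set.mem_ofPred_eq]
    obtain ⟨m, rfl | rfl⟩ := exists_eq_odd_or_even hk
    · rw [eps_succ_of_odd] at b1 b2
      rw [zeta_odd, hη] at a2 b2
      rcases T.eps_eq (2 * m + 1) with he | he <;> rw [he] at a1 a2 b1 b2 <;>
        refine ⟨?_, ?_, ?_, ?_⟩ <;> rintro ⟨h3, h4⟩ <;> constructor <;> linarith
    · rw [eps_succ_of_even] at b1 b2
      rw [zeta_even, hη] at a2 b2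
      rcases T.eps_eq (2 * m + 2) with he | he <;> rw [he] at a1 a2 b1 b2 <;>
        refine ⟨?_, ?_, ?_, ?_⟩ <;> rintro ⟨h3, h4⟩ <;> constructor <;> linarith
  · exact first_im_neg hone hγ
  · have := zeta_mul_re_mul_im_pos hone hτ hγ hγ'
    rw [zeta_one, hη] at this
    linarith

lemma sign_eq_neg_sign {e x y : ℝ} (he : e = 1 ∨ e = -1) (hx : 0 < e * x) (hy : 0 < -e * y) :
    SignType.sign x = -SignType.sign y := by
  rcases he with rfl | rfl
  · rw [sign_pos (by linarith), sign_neg (by linarith), neg_neg]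
  · rw [sign_neg (by linarith), sign_pos (by linarith)]

/-- The indices 2m + 1 and 2m + 2 share a level. Equal radii give conjugate entries, a real double
zero included. Different radii put a constant stretch of the phase on the real axis; angle π would
require γ = π/2, so both entries are real, with the same ε. -/
lemma distribution₃ (hτ : D.τ = T.J + 1 / 2)
    (hF : ∀ w, zeroMult F w = analyticOrderAt (D.charFun T.c T.J) w)
    (hω : ∀ k : ℕ, 1 ≤ k → ((∃ ρ, T.Sel D k ρ) ↔ (k : ℕ∞) ≤ ω))
    (hγ : T.γ = 0) (hη : T.η = 1) : Distribution₃ F T.c T.J ω (T.zero D) := by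
  have hpi := Real.pi_pos
  have hγ' : T.γ ≠ Real.pi / 2 := by rw [hγ]; positivity
  have hγ'' : T.γ < Real.pi / 2 := by rw [hγ]; positivity
  have hone := exists_sel_one hτ
  have hpair : ∀ k : ℕ, 1 ≤ k → ((2 * k : ℕ) : ℕ∞) ≤ ω →
      ∃ m, 2 * k - 1 = 2 * m + 1 ∧ 2 * k = 2 * m + 2 ∧
        T.Sel D (2 * m + 1) (T.rad D (2 * m + 1)) ∧ T.Sel D (2 * m + 2) (T.rad D (2 * m + 2)) := by
    intro k hk hkω
    obtain ⟨m, rfl⟩ : ∃ m, k = m + 1 := ⟨k - 1, by omega⟩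
    obtain ⟨h1, h2⟩ := exists_sel_and_succ hω (k := 2 * m + 1) (by omega) hkω
    exact ⟨m, by omega, by ring, sel_rad h1, sel_rad h2⟩
  have hnext : ∀ k : ℕ, 1 ≤ k → ((2 * k + 1 : ℕ) : ℕ∞) ≤ ω →
      ∃ m, 2 * k = 2 * m + 2 ∧ (∃ ρ, T.Sel D (2 * m + 2) ρ) ∧ ∃ ρ, T.Sel D (2 * m + 2 + 1) ρ := by
    intro k hk hkω
    obtain ⟨m, rfl⟩ : ∃ m, k = m + 1 := ⟨k - 1, by omega⟩
    exact ⟨m, by ring, exists_sel_and_succ hω (k := 2 * m + 2) (by omega) hkω⟩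
  have hno : ∀ w : ℂ, w.re = 0 → zeroMult F w = 0 := by
    intro w hw
    by_contra h0
    obtain ⟨k, hk, hkω, rfl⟩ := (isZeroList hτ hF hω).exists_of_zeroMult_ne_zero h0
    have := eps_mul_zero_re_pos ((hω k hk).2 hkω) hτ hγ'
    rw [hw, mul_zero] at this
    exact this.false
  constructor
  · rw [norm_zero]; exact sqrt_rad_pos hone
  · intro k hk hkω
    obtain ⟨m, e1, e2, h1, h2⟩ := hpair k hk hkω
    rw [e1, e2, norm_zero, norm_zero]
    refine Real.sqrt_le_sqrt (((sel_odd hγ'' m _).1 h1).2 ?_)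
    have := ((sel_even hγ'' m _).1 h2).1
    rw [hγ, sub_zero]
    rwa [hγ, add_zero] at this
  · intro k hk hkω
    obtain ⟨m, e, h1, h2⟩ := hnext k hk hkω
    rw [e]
    refine norm_lt_norm h1 h2 ?_
    rw [show 2 * m + 2 + 1 = 2 * (m + 1) + 1 by ring, lev_odd, lev_even, hγ]
    push_cast
    linarith
  · exact hno
  · intro w _
    rw [hF]
    exact (EquationData.analyticOrderAt_charFun_cases hτ T.norm_c w).1
  · intro w hw
    by_cases h0 : w.re = 0
    · rw [hno w h0]; exact zero_le_one
    rw [hF]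
    exact (EquationData.analyticOrderAt_charFun_cases hτ T.norm_c w).2 h0 hw
  · intro k hk hkω
    obtain ⟨m, e1, e2, h1, h2⟩ := hpair k hk hkω
    rw [e1, e2, norm_zero, norm_zero]
    intro h
    have hr := (Real.sqrt_inj h1.pos.le h2.pos.le).1 h
    rw [zero, zero, conj_root, hr, eps_odd, eps_even, zeta_odd, zeta_even]
  · intro k hk hkω
    obtain ⟨m, e1, e2, h1, h2⟩ := hpair k hk hkω
    rw [e1, e2, norm_zero, norm_zero]
    intro h
    have hne : T.rad D (2 * m + 1) ≠ T.rad D (2 * m + 2) := fun he => by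
      rw [he] at h
      exact h.false
    have hth : D.theta (T.rad D (2 * m + 1)) = D.theta (T.rad D (2 * m + 2)) := by
      rw [h1.theta, h2.theta, lev_odd, lev_even, hγ, sub_zero, add_zero]
    obtain ⟨ha, hb⟩ := EquationData.angle_of_theta_eq h1.pos h2.pos hne hth
    have ha1 := hb.resolve_right (h1.angle_ne_pi hτ hγ')
    have ha2 := ha.symm.trans ha1
    have hz1 : T.zero D (2 * m + 1) = ((T.eps (2 * m + 1) * √(T.rad D (2 * m + 1)) : ℝ) : ℂ) := by
      rw [zero, root, ha1]
      simp
    have hz2 : T.zero D (2 * m + 2) = ((T.eps (2 * m + 2) * √(T.rad D (2 * m + 2)) : ℝ) : ℂ) := by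
      rw [zero, root, ha2]
      simp
    have hs1 := Real.sqrt_pos.2 h1.pos
    have hs2 := Real.sqrt_pos.2 h2.pos
    have he : T.eps (2 * m + 2) = T.eps (2 * m + 1) := T.eps_succ_of_odd m
    rw [hz1, hz2, he]
    rcases T.eps_eq (2 * m + 1) with he | he <;> rw [he]
    · rw [arg_ofReal_of_nonneg (by linarith), arg_ofReal_of_nonneg (by linarith)]
      simp
    · rw [arg_ofReal_of_neg (by linarith), arg_ofReal_of_neg (by linarith)]
      simp
  · intro k hk hkω
    obtain ⟨m, e, h1, h2⟩ := hnext k hk hkω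
    have a := eps_mul_zero_re_pos h1 hτ hγ'
    have b := eps_mul_zero_re_pos h2 hτ hγ'
    rw [eps_succ_of_even] at b
    rw [e]
    exact sign_eq_neg_sign (T.eps_eq _) a b
  · exact first_re_pos hone hτ hγ'
  · rw [zero_re_mul_zero_im, zeta_one, hη]
    have h1 := cos_half_angle_nonneg (D := D) (T.rad D 1)
    have h2 := sin_half_angle_nonneg (D := D) (T.rad D 1)
    have : 0 ≤ √(T.rad D 1) ^ 2 * (Real.cos (D.angle (T.rad D 1) / 2) *
      Real.sin (D.angle (T.rad D 1) / 2)) := by positivity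
    linarith

lemma arg_mul_I_of_pos {x : ℝ} (hx : 0 < x) : arg (x * I) = Real.pi / 2 := by
  rw [arg_real_mul I hx, arg_I]

lemma arg_mul_I_of_neg {x : ℝ} (hx : x < 0) : arg (x * I) = -(Real.pi / 2) := by
  have : (x : ℂ) * I = ((-x : ℝ) : ℂ) * (-I) := by push_cast; ring
  rw [this, arg_real_mul _ (by linarith), arg_neg_I]

/-- Here 2m + 2 and 2m + 3 share a level, and constant stretches lie at angle π. The first zero
stands alone at the starting level, as the upper end of the initial stretch. -/
lemma distribution₄ (hτ : D.τ = T.J + 1 / 2)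
    (hF : ∀ w, zeroMult F w = analyticOrderAt (D.charFun T.c T.J) w)
    (hω : ∀ k : ℕ, 1 ≤ k → ((∃ ρ, T.Sel D k ρ) ↔ (k : ℕ∞) ≤ ω))
    (hγ : T.γ = Real.pi / 2) (hη : T.η = 1) : Distribution₄ F T.c T.J ω (T.zero D) := by
  have hpi := Real.pi_pos
  have hτ0 : 0 < D.τ := by rw [hτ]; positivity
  have hγ' : T.γ ≠ 0 := by rw [hγ]; positivity
  have hone := exists_sel_one hτ
  have hpair : ∀ k : ℕ, 1 ≤ k → ((2 * k : ℕ) : ℕ∞) ≤ ω →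
      ∃ m, 2 * k - 1 = 2 * m + 1 ∧ 2 * k = 2 * m + 1 + 1 ∧
        (∃ ρ, T.Sel D (2 * m + 1) ρ) ∧ ∃ ρ, T.Sel D (2 * m + 1 + 1) ρ := by
    intro k hk hkω
    obtain ⟨m, rfl⟩ : ∃ m, k = m + 1 := ⟨k - 1, by omega⟩
    exact ⟨m, by omega, by ring, exists_sel_and_succ hω (k := 2 * m + 1) (by omega) hkω⟩
  have hnext : ∀ k : ℕ, 1 ≤ k → ((2 * k + 1 : ℕ) : ℕ∞) ≤ ω →
      ∃ m, 2 * k = 2 * m + 2 ∧ T.Sel D (2 * m + 2) (T.rad D (2 * m + 2)) ∧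
        T.Sel D (2 * m + 2 + 1) (T.rad D (2 * m + 2 + 1)) := by
    intro k hk hkω
    obtain ⟨m, rfl⟩ : ∃ m, k = m + 1 := ⟨k - 1, by omega⟩
    obtain ⟨h1, h2⟩ := exists_sel_and_succ hω (k := 2 * m + 2) (by omega) hkω
    exact ⟨m, by ring, sel_rad h1, sel_rad h2⟩
  have hlev : ∀ m : ℕ, T.lev (2 * m + 2 + 1) = T.lev (2 * m + 2) := fun m => by
    rw [show 2 * m + 2 + 1 = 2 * (m + 1) + 1 by ring, lev_odd, lev_even, hγ]
    push_cast
    ring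
  have hno : ∀ w : ℂ, w.im = 0 → zeroMult F w = 0 := by
    intro w hw
    by_contra h0
    obtain ⟨k, hk, hkω, rfl⟩ := (isZeroList hτ hF hω).exists_of_zeroMult_ne_zero h0
    have := eps_mul_zero_im_pos ((hω k hk).2 hkω) hγ'
    rw [hw, mul_zero] at this
    exact this.false
  constructor
  · rw [norm_zero]; exact sqrt_rad_pos hone
  · intro k hk hkω
    obtain ⟨m, e1, e2, h1, h2⟩ := hpair k hk hkω
    rw [e1, e2]
    refine norm_lt_norm h1 h2 ?_
    rw [show 2 * m + 1 + 1 = 2 * m + 2 by ring, lev_odd, lev_even, hγ]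
    linarith
  · intro k hk hkω
    obtain ⟨m, e, h1, h2⟩ := hnext k hk hkω
    rw [e, norm_zero, norm_zero]
    refine Real.sqrt_le_sqrt (((sel_even' hγ m _).1 h1).2 ?_)
    have := h2.mem
    rwa [hlev, lev_even] at this
  · exact hno
  · intro w _
    rw [hF]
    exact (EquationData.analyticOrderAt_charFun_cases hτ T.norm_c w).1
  · intro w hw
    by_cases h0 : w.im = 0
    · rw [hno w h0]; exact zero_le_one
    rw [hF]
    exact (EquationData.analyticOrderAt_charFun_cases hτ T.norm_c w).2 hw h0
  · intro k hk hkω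
    obtain ⟨m, e, h1, h2⟩ := hnext k hk hkω
    rw [e, norm_zero, norm_zero]
    intro h
    have hr := (Real.sqrt_inj h1.pos.le h2.pos.le).1 h
    rw [zero, zero, conj_root, hr, eps_succ_of_even, T.zeta_succ (2 * m + 2), neg_neg, root, root]
    push_cast
    ring
  · intro k hk hkω
    obtain ⟨m, e, h1, h2⟩ := hnext k hk hkω
    rw [e, norm_zero, norm_zero]
    intro h
    have hne : T.rad D (2 * m + 2) ≠ T.rad D (2 * m + 2 + 1) := fun he => by
      rw [he] at h
      exact h.false
    have hth : D.theta (T.rad D (2 * m + 2)) = D.theta (T.rad D (2 * m + 2 + 1)) := by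
      rw [h1.theta, h2.theta, hlev]
    obtain ⟨ha, hb⟩ := EquationData.angle_of_theta_eq h1.pos h2.pos hne hth
    have ha1 := hb.resolve_left (h1.angle_ne_zero hγ')
    have ha2 := ha.symm.trans ha1
    have hs1 := Real.sqrt_pos.2 h1.pos
    have hs2 := Real.sqrt_pos.2 h2.pos
    rw [zero, zero, ha1, ha2, root_pi (T.zeta_eq _), root_pi (T.zeta_eq _), eps_succ_of_even,
      T.zeta_succ (2 * m + 2), zeta_even, hη]
    rcases T.eps_eq (2 * m + 2) with he | he <;> rw [he]
    · rw [arg_mul_I_of_pos (by linarith), arg_mul_I_of_pos (by linarith)]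
      simp
    · rw [arg_mul_I_of_neg (by linarith), arg_mul_I_of_neg (by linarith)]
      simp
  · intro k hk hkω
    obtain ⟨m, e1, e2, h1, h2⟩ := hpair k hk hkω
    have a := eps_mul_zero_im_pos h1 hγ'
    have b := eps_mul_zero_im_pos h2 hγ'
    rw [eps_succ_of_odd, zeta_succ, zeta_odd, hη] at b
    rw [zeta_odd, hη] at a
    rw [e1, e2]
    refine sign_eq_neg_sign (e := -T.eps (2 * m + 1)) ?_ (by linarith) (by linarith)
    rcases T.eps_eq (2 * m + 1) with he | he <;> rw [he] <;> norm_num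
  · exact first_im_neg hone hγ'
  · have h := sel_rad hone
    have hth : D.theta (T.rad D 1) = -(D.τ * Real.pi) := by
      rw [h.theta, hτ, T.lev_odd 0, hγ]
      push_cast
      ring
    -- An interior angle would make the starting level set a single point, giving it a least
    -- element.
    have hi : D.angle (T.rad D 1) = Real.pi := by
      rcases D.angle_cases (T.rad D 1) with hi | hi | hi
      · exact absurd hi (h.angle_ne_zero hγ')
      · exact hi
      · have := (EquationData.levelSet_of_interior h.pos hi).1
        rw [hth] at this
        exact absurd this (EquationData.not_isLeast_start hτ0)
    rw [zero_re, hi, Real.cos_pi_div_two, mul_zero]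

/-- The condition `hT` normalises η to 1 when c is real or imaginary, where the sign of the product
of its coordinates carries no information. -/
theorem zeroLocalization (hτ : D.τ = T.J + 1 / 2)
    (hF : ∀ w, zeroMult F w = analyticOrderAt (D.charFun T.c T.J) w)
    (hT : T.η = 1 ∨ T.γ ≠ 0 ∧ T.γ ≠ Real.pi / 2) : ZeroLocalization F T.c T.J := by
  obtain ⟨ω, hω⟩ := exists_enat_of_initial (V := fun k => ∃ ρ, T.Sel D k ρ)
    fun k hk h => exists_sel_of_succ hτ hk h
  refine ⟨ω, T.zero D, by exact_mod_cast (hω 1 le_rfl).1 (exists_sel_one hτ),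
    isZeroList hτ hF hω, fun h => ?_, fun h => ?_, fun h => ?_, fun h => ?_⟩
  · rw [c_sq_im] at h
    have hγ : T.γ ≠ 0 := fun h0 => by simp [h0] at h
    have hγ' : T.γ ≠ Real.pi / 2 := fun h0 => by simp [h0] at h
    refine distribution₁ hτ hF hω hγ hγ' (T.η_eq.resolve_right fun h1 => ?_)
    have := mul_pos (sin_γ_pos hγ) (cos_γ_pos hγ')
    rw [h1] at h
    linarith
  · rw [c_sq_im] at h
    have hγ : T.γ ≠ 0 := fun h0 => by simp [h0] at h
    have hγ' : T.γ ≠ Real.pi / 2 := fun h0 => by simp [h0] at h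
    refine distribution₂ hτ hF hω hγ hγ' (T.η_eq.resolve_left fun h1 => ?_)
    have := mul_pos (sin_γ_pos hγ) (cos_γ_pos hγ')
    rw [h1] at h
    linarith
  · have hγ : T.γ = 0 := by
      by_contra hγ
      rw [c_im] at h
      have := sin_γ_pos hγ
      rcases T.σ_eq with h1 | h1 <;> rcases T.η_eq with h2 | h2 <;> rw [h1, h2] at h <;> linarith
    exact distribution₃ hτ hF hω hγ (hT.resolve_right fun h => h.1 hγ)
  · have hγ : T.γ = Real.pi / 2 := by
      by_contra hγ
      rw [c_re] at h
      have := cos_γ_pos hγ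
      rcases T.σ_eq with h1 | h1 <;> rw [h1] at h <;> linarith
    exact distribution₄ hτ hF hω hγ (hT.resolve_right fun h => h.2 hγ)

/-- Applies the polar form of square roots to c itself; for imaginary c the sign ζ is absorbed into
σ. -/
lemma exists_frame {c : ℂ} (hc : ‖c‖ = 1) (J : ℕ) :
    ∃ T : Frame, T.c = c ∧ T.J = J ∧ (T.η = 1 ∨ T.γ ≠ 0 ∧ T.γ ≠ Real.pi / 2) := by
  have hpi := Real.pi_pos
  have hc0 : c ≠ 0 := by rw [← norm_ne_zero_iff, hc]; exact one_ne_zero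
  obtain ⟨ε, ζ, ρ, φ, hε, hζ, hρ, hφ, rfl⟩ := exists_eq_root hc0
  rw [norm_root hε] at hc
  have h1 : 0 ≤ φ / 2 := by linarith [hφ.1]
  have h2 : φ / 2 ≤ Real.pi / 2 := by linarith [hφ.2]
  by_cases h0 : φ = 0
  · exact ⟨⟨J, ε, 1, φ / 2, hε, Or.inl rfl, h1, h2⟩, by simp [Frame.c, root, hc, h0], rfl,
      Or.inl rfl⟩
  by_cases hp : φ = Real.pi
  · refine ⟨⟨J, ε * ζ, 1, φ / 2, ?_, Or.inl rfl, h1, h2⟩, ?_, rfl, Or.inl rfl⟩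
    · rcases hε with rfl | rfl <;> rcases hζ with rfl | rfl <;> norm_num
    · have hr := root_pi (ε := ε) (ρ := ρ) hζ
      rw [← hp] at hr
      rw [hr, hc]
      change ((ε * ζ : ℝ) : ℂ) * exp ((1 * (φ / 2) : ℝ) * I) = _
      rw [mul_one, one_mul, exp_mul_I, ← ofReal_cos, ← ofReal_sin, hp, Real.cos_pi_div_two,
        Real.sin_pi_div_two]
      simp
  · refine ⟨⟨J, ε, ζ, φ / 2, hε, hζ, h1, h2⟩, by simp [Frame.c, root, hc], rfl, Or.inr ⟨?_, ?_⟩⟩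
    · exact fun h => h0 (by simpa using h)
    · exact fun h => hp (by linarith [show φ / 2 = Real.pi / 2 from h])

end Frame

end MeromorphicZeros

/-! ### From the meromorphic function to the entire one, and the linear case -/

namespace MeromorphicZeros
open scoped Topology

/-- Φ and the denominator C have no common zero. Where C ≠ 0 the orders agree; where C = 0 the
function has a pole, whose truncated order 0 is the order of Φ. -/
lemma zeroMult_eq_analyticOrderAt {F Φ C e : ℂ → ℂ} {w : ℂ} (hC : AnalyticAt ℂ C w)
    (hC0 : ∀ᶠ z in 𝓝[≠] w, C z ≠ 0) (he : AnalyticAt ℂ e w) (he0 : e w ≠ 0)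
    (hΦ : AnalyticAt ℂ Φ w) (h : C w = 0 → Φ w ≠ 0)
    (heq : F =ᶠ[𝓝[≠] w] fun z => e z * Φ z * (C z)⁻¹) :
    zeroMult F w = analyticOrderAt Φ w := by
  have h1 : meromorphicOrderAt F w = meromorphicOrderAt Φ w + -meromorphicOrderAt C w := by
    rw [meromorphicOrderAt_congr heq]
    have e1 : (fun z => e z * Φ z * (C z)⁻¹) = e * Φ * C⁻¹ := rfl
    rw [e1, meromorphicOrderAt_mul (he.meromorphicAt.mul hΦ.meromorphicAt) hC.meromorphicAt.inv,
      meromorphicOrderAt_mul he.meromorphicAt hΦ.meromorphicAt, meromorphicOrderAt_inv,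
      he.meromorphicOrderAt_eq, he.analyticOrderAt_eq_zero.2 he0]
    simp
  rw [zeroMult, h1, hΦ.meromorphicOrderAt_eq, hC.meromorphicOrderAt_eq]
  by_cases hw : C w = 0
  · rw [hΦ.analyticOrderAt_eq_zero.2 (h hw)]
    have hfin : analyticOrderAt C w ≠ ⊤ := by
      intro htop
      rw [analyticOrderAt_eq_top] at htop
      obtain ⟨z, hz1, hz2⟩ := (hC0.and (htop.filter_mono nhdsWithin_le_nhds)).exists
      exact hz1 hz2
    obtain ⟨n, hn⟩ := ENat.ne_top_iff_exists.1 hfin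
    rw [← hn]
    have : ((-(n : ℤ) : ℤ)).toNat = 0 := by omega
    simp only [ENat.map_zero, Nat.cast_zero, ENat.map_natCast]
    change WithTop.map Int.toNat (((0 : ℤ) + -(n : ℤ) : ℤ) : WithTop ℤ) = _
    rw [zero_add, WithTop.map_coe, this]
    rfl
  · rw [hC.analyticOrderAt_eq_zero.2 hw]
    cases hn : analyticOrderAt Φ w with
    | top => rfl
    | coe n =>
      change WithTop.map Int.toNat (((n : ℤ) + -((0 : ℕ) : ℤ) : ℤ) : WithTop ℤ) = _
      rw [WithTop.map_coe]
      simp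
      rfl

lemma zeroProd_ne_zero_of_im_ne_zero {ι : Type*} {d : ι → ℝ} (hd : ∀ i, 0 < d i)
    (hs : Summable fun i => (d i)⁻¹) {u : ℂ} (hu : u.im ≠ 0) : zeroProd d u ≠ 0 := by
  rw [zeroProd_ne_zero_iff hs]
  intro i h
  have := congrArg Complex.im h
  rw [add_im, one_im, div_ofReal_im, zero_add, zero_im, div_eq_zero_iff] at this
  exact this.elim hu (hd i).ne'

/-- Zeros of one product are negative, so at the opposite point every factor of the other exceeds 1.
-/
lemma zeroProd_neg_ne_zero_of_eq_zero {ι κ : Type*} {d : ι → ℝ} {e : κ → ℝ} (hd : ∀ i, 0 < d i)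
    (he : ∀ i, 0 < e i) (hs : Summable fun i => (d i)⁻¹) (hs' : Summable fun i => (e i)⁻¹)
    {u : ℂ} (h : zeroProd d u = 0) : zeroProd e (-u) ≠ 0 := by
  have h1 : ¬ ∀ i, 1 + u / (d i : ℂ) ≠ 0 := fun h2 => (zeroProd_ne_zero_iff hs).2 h2 h
  push Not at h1
  obtain ⟨i, hi⟩ := h1
  have hdi : (d i : ℂ) ≠ 0 := ofReal_ne_zero.2 (hd i).ne'
  have hu : -u = (d i : ℝ) := by
    field_simp at hi
    linear_combination -hi
  rw [zeroProd_ne_zero_iff hs']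
  intro k hk
  rw [hu] at hk
  have h3 : (1 + d i / e k : ℝ) = 0 := by exact_mod_cast hk
  have := div_pos (hd i) (he k)
  linarith

/-- The distribution of the zero of `1 + d w`. -/
lemma zeroLocalization_linear {F : ℂ → ℂ} {d c : ℂ} (hd : d ≠ 0) (hc : c = -(d / (‖d‖ : ℂ)))
    (hF : ∀ w, zeroMult F w = analyticOrderAt (fun w => 1 + d * w) w) :
    ZeroLocalization F c 0 := by
  have hr : 0 < ‖d‖ := norm_pos_iff.2 hd
  set w₀ : ℂ := -d⁻¹ with hw₀
  have hroot : 1 + d * w₀ = 0 := by rw [hw₀]; field_simp; ring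
  have horder : ∀ w, zeroMult F w = if w = w₀ then 1 else 0 := by
    intro w
    have ha : AnalyticAt ℂ (fun w => 1 + d * w) w := by fun_prop
    rw [hF]
    split_ifs with h
    · rw [h] at ha ⊢
      refine (ha.analyticOrderAt_eq_natCast (n := 1)).2 ⟨fun _ => d, by fun_prop, hd, ?_⟩
      refine Eventually.of_forall fun z => ?_
      rw [smul_eq_mul]
      linear_combination hroot
    · refine ha.analyticOrderAt_eq_zero.2 fun h0 => h ?_
      exact mul_left_cancel₀ hd (by linear_combination h0 - hroot)
  have hle : ∀ w, zeroMult F w ≤ 1 := fun w => by rw [horder]; split_ifs <;> simp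
  -- The zero is w₀ = −1/d and c is a positive multiple of its conjugate, so every claim becomes a
  -- sign statement about w₀ alone.
  have hcw : c = ((‖d‖ : ℝ) : ℂ) * starRingEnd ℂ w₀ := by
    have : (‖d‖ : ℂ) ≠ 0 := ofReal_ne_zero.2 hr.ne'
    have hcd : starRingEnd ℂ d ≠ 0 := (map_ne_zero _).2 hd
    rw [hc, hw₀, map_neg, map_inv₀]
    field_simp
    rw [← conj_mul']
    ring
  have hre : c.re = ‖d‖ * w₀.re := by rw [hcw, re_ofReal_mul, conj_re]
  have him : c.im = -(‖d‖ * w₀.im) := by rw [hcw, im_ofReal_mul, conj_im]; ring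
  have hsq : (c ^ 2).im = -(2 * ‖d‖ ^ 2) * (w₀.re * w₀.im) := by
    rw [pow_two, mul_im, hre, him]; ring
  have hnorm : 0 < ‖w₀‖ := norm_pos_iff.2 (neg_ne_zero.2 (inv_ne_zero hd))
  have hω : ∀ n : ℕ, (n : ℕ∞) ≤ 1 → n ≤ 1 := fun n hn => by exact_mod_cast hn
  have hre0 : ∀ {x y : ℝ}, x * y ≠ 0 → x ≠ 0 ∧ y ≠ 0 := fun h => mul_ne_zero_iff.1 h
  have him0 : w₀.im = 0 → w₀.re ≠ 0 := fun h h' => hnorm.ne' (by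
    rw [show w₀ = 0 from Complex.ext h' h, norm_zero])
  have hneg : -(2 * ‖d‖ ^ 2) < 0 := by nlinarith
  refine ⟨1, fun _ => w₀, le_rfl, ?_, fun h => ?_, fun h => ?_, fun h => ?_, fun h => ?_⟩
  · intro w
    rw [horder]
    split_ifs with h
    · rw [h]
      have : {k : ℕ | 1 ≤ k ∧ (k : ℕ∞) ≤ 1 ∧ w₀ = w₀} = {1} := by
        ext k
        simp only [and_true, Set.mem_ofPred_eq, Set.mem_singleton_iff]
        exact ⟨fun hk => le_antisymm (hω k hk.2) hk.1, by rintro rfl; simp⟩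
      rw [this, Set.encard_singleton]
    · rw [Set.encard_eq_zero, Set.eq_empty_iff_forall_notMem]
      exact fun k hk => h hk.2.2.symm
  · have hprod : w₀.re * w₀.im < 0 := by
      by_contra! h0
      rw [hsq] at h
      nlinarith
    obtain ⟨h1, h2⟩ := mul_ne_zero_iff.1 hprod.ne
    constructor
    · exact hle
    · exact hnorm
    · exact fun k hk hk' => absurd (hω _ hk') (by omega)
    · intro k _ _
      rw [pow_two, mul_im]
      intro h0
      linarith
    · exact fun k hk hk' => absurd (hω _ hk') (by omega)
    · rw [hre]
      have := mul_pos hr (mul_self_pos.2 h1)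
      linarith
    · exact hprod
  · have hprod : 0 < w₀.re * w₀.im := by
      by_contra! h0
      rw [hsq] at h
      nlinarith
    obtain ⟨h1, h2⟩ := mul_ne_zero_iff.1 hprod.ne'
    constructor
    · exact hle
    · exact hnorm
    · exact fun k hk hk' => absurd (hω _ hk') (by omega)
    · intro k _ _
      rw [pow_two, mul_im]
      intro h0
      linarith
    · exact fun k hk hk' => absurd (hω _ hk') (by omega)
    · rw [him]
      have := mul_pos hr (mul_self_pos.2 h2)
      linarith
    · exact hprod
  · have h0 : w₀.im = 0 := by
      rw [him, neg_eq_zero] at h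
      exact (mul_eq_zero.1 h).resolve_left hr.ne'
    have h1 := him0 h0
    constructor
    · exact hnorm
    · exact fun k hk hk' => absurd (hω _ hk') (by omega)
    · exact fun k hk hk' => absurd (hω _ hk') (by omega)
    · intro w hw
      rw [horder, if_neg]
      rintro rfl
      exact h1 hw
    · exact fun w _ => (hle w).trans one_le_two
    · exact fun w _ => hle w
    · exact fun k hk hk' => absurd (hω _ hk') (by omega)
    · exact fun k hk hk' => absurd (hω _ hk') (by omega)
    · exact fun k hk hk' => absurd (hω _ hk') (by omega)
    · rw [hre]
      have := mul_pos hr (mul_self_pos.2 h1)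
      linarith
    · rw [h0, mul_zero]
  · have h0 : w₀.re = 0 := by
      rw [hre] at h
      exact (mul_eq_zero.1 h).resolve_left hr.ne'
    have h1 : w₀.im ≠ 0 := fun h1 => him0 h1 h0
    constructor
    · exact hnorm
    · exact fun k hk hk' => absurd (hω _ hk') (by omega)
    · exact fun k hk hk' => absurd (hω _ hk') (by omega)
    · intro w hw
      rw [horder, if_neg]
      rintro rfl
      exact h1 hw
    · exact fun w _ => (hle w).trans one_le_two
    · exact fun w _ => hle w
    · exact fun k hk hk' => absurd (hω _ hk') (by omega)
    · exact fun k hk hk' => absurd (hω _ hk') (by omega)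
    · exact fun k hk hk' => absurd (hω _ hk') (by omega)
    · rw [him]
      have := mul_pos hr (mul_self_pos.2 h1)
      linarith
    · exact h0

lemma tprod_one_sub_div {ι : Type*} (d : ι → ℝ) (u : ℂ) :
    ∏' i, (1 - u / (d i : ℂ)) = zeroProd d (-u) :=
  tprod_congr fun i => by rw [neg_div, sub_eq_add_neg]

lemma summable_sumElim_inv {ι κ : Type*} {d : ι → ℝ} {e : κ → ℝ}
    (hd : Summable fun i => (d i)⁻¹) (he : Summable fun i => (e i)⁻¹) :
    Summable fun i => (Sum.elim d e i)⁻¹ :=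
  Summable.sum (fun i => (Sum.elim d e i)⁻¹) hd he

lemma differentiable_zeroProd_sq {ι : Type*} {d : ι → ℝ} (hd : ∀ i, 0 < d i)
    (hs : Summable fun i => (d i)⁻¹) : Differentiable ℂ fun z : ℂ => zeroProd d (z ^ 2) :=
  (differentiable_zeroProd hd hs).comp (differentiable_id.pow 2)

lemma differentiable_zeroProd_neg_sq {ι : Type*} {d : ι → ℝ} (hd : ∀ i, 0 < d i)
    (hs : Summable fun i => (d i)⁻¹) : Differentiable ℂ fun z : ℂ => zeroProd d (-z ^ 2) :=
  (differentiable_zeroProd hd hs).comp (differentiable_id.pow 2).neg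

lemma eventually_denominator_ne_zero {ι κ : Type*} {α : ι → ℝ} {β : κ → ℝ} (hα : ∀ i, 0 < α i)
    (hβ : ∀ i, 0 < β i) (hαs : Summable fun i => (α i)⁻¹) (hβs : Summable fun i => (β i)⁻¹)
    (n : ℕ) (w : ℂ) :
    ∀ᶠ z in 𝓝[≠] w, z ^ n * (zeroProd β (-z ^ 2) * zeroProd α (z ^ 2)) ≠ 0 := by
  have hC : Differentiable ℂ fun z : ℂ => z ^ n * (zeroProd β (-z ^ 2) * zeroProd α (z ^ 2)) :=
    (differentiable_id.pow _).mul
      ((differentiable_zeroProd_neg_sq hβ hβs).mul (differentiable_zeroProd_sq hα hαs))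
  refine (hC.analyticAt w).eventually_eq_zero_or_eventually_ne_zero.resolve_left fun h => ?_
  have hall := (hC.differentiableOn (s := Set.univ).analyticOnNhd
    isOpen_univ).eqOn_zero_of_preconnected_of_eventuallyEq_zero isPreconnected_univ
    (Set.mem_univ w) h
  -- The square of 1 + I is 2I, not real, so the denominator cannot vanish at this point.
  have h1 := hall (Set.mem_univ (1 + I))
  have hsq : (1 + I) ^ 2 = 2 * I := by linear_combination I_sq
  have hne : (1 + I : ℂ) ≠ 0 := fun h => by simpa using congrArg Complex.re h
  simp only [hsq] at h1
  refine mul_ne_zero (pow_ne_zero _ hne) (mul_ne_zero ?_ ?_) h1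
  · exact zeroProd_ne_zero_of_im_ne_zero hβ hβs (by simp)
  · exact zeroProd_ne_zero_of_im_ne_zero hα hαs (by simp)

/-- The multiplicities of the zeros of `f(z²) + z g(z²)` are those of an entire function. -/
lemma zeroMult_eq {ι₁ ι₂ ι₃ ι₄ : Type*} {b : ι₁ → ℝ} {a : ι₂ → ℝ} {β : ι₃ → ℝ} {α : ι₄ → ℝ}
    (hb : ∀ μ, 0 < b μ) (ha : ∀ ν, 0 < a ν) (hβ : ∀ m, 0 < β m) (hα : ∀ n, 0 < α n)
    (hbs : Summable fun μ => (b μ)⁻¹) (has : Summable fun ν => (a ν)⁻¹)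
    (hβs : Summable fun m => (β m)⁻¹) (hαs : Summable fun n => (α n)⁻¹)
    {f₀ g₀ : ℂ} (hf₀ : f₀ ≠ 0) (hg₀ : g₀ ≠ 0) {j k : ℕ}
    {E : ℂ → ℂ} (hE : Differentiable ℂ E) {f g F : ℂ → ℂ}
    (hf : ∀ z, f z = f₀ * z ^ (-(k : ℤ)) * exp (E z) * (zeroProd b z / zeroProd β (-z)))
    (hg : ∀ z, g z = g₀ * z ^ j * exp (E z) * (zeroProd a (-z) / zeroProd α z))
    (hF : F =ᶠ[codiscrete ℂ] fun z => f (z ^ 2) + z * g (z ^ 2)) (w : ℂ) :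
    zeroMult F w = analyticOrderAt (fun w => zeroProd (Sum.elim b α) (w ^ 2) +
      g₀ / f₀ * w ^ (2 * (j + k) + 1) * zeroProd (Sum.elim a β) (-w ^ 2)) w := by
  have hbα : ∀ i, 0 < Sum.elim b α i := Sum.rec hb hα
  have haβ : ∀ i, 0 < Sum.elim a β i := Sum.rec ha hβ
  have hbαs := summable_sumElim_inv hbs hαs
  have haβs := summable_sumElim_inv has hβs
  have hC : Differentiable ℂ fun z : ℂ =>
      z ^ (2 * k) * (zeroProd β (-z ^ 2) * zeroProd α (z ^ 2)) :=
    (differentiable_id.pow _).mul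
      ((differentiable_zeroProd_neg_sq hβ hβs).mul (differentiable_zeroProd_sq hα hαs))
  have hC0 := eventually_denominator_ne_zero hα hβ hαs hβs (2 * k) w
  have hΦ : Differentiable ℂ fun w : ℂ => zeroProd (Sum.elim b α) (w ^ 2) +
      g₀ / f₀ * w ^ (2 * (j + k) + 1) * zeroProd (Sum.elim a β) (-w ^ 2) :=
    (differentiable_zeroProd_sq hbα hbαs).add
      (((differentiable_const _).mul (by fun_prop)).mul (differentiable_zeroProd_neg_sq haβ haβs))
  have hexp : Differentiable ℂ fun z : ℂ => f₀ * exp (E (z ^ 2)) :=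
    (differentiable_const _).mul ((hE.comp
      (by fun_prop : Differentiable ℂ fun z : ℂ => z ^ 2)).cexp)
  refine zeroMult_eq_analyticOrderAt (hC.analyticAt w) hC0 (hexp.analyticAt w)
    (mul_ne_zero hf₀ (exp_ne_zero _)) (hΦ.analyticAt w) ?_ ?_
  · intro hw
    by_cases hw0 : w = 0
    · simp [hw0, zeroProd_zero]
    have hgw : g₀ / f₀ * w ^ (2 * (j + k) + 1) ≠ 0 :=
      mul_ne_zero (div_ne_zero hg₀ hf₀) (pow_ne_zero _ hw0)
    rcases mul_eq_zero.1 ((mul_eq_zero.1 hw).resolve_left (pow_ne_zero _ hw0)) with h | h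
    · have h1 : zeroProd (Sum.elim a β) (-w ^ 2) = 0 := by
        rw [zeroProd_sumElim has hβs, h, mul_zero]
      have h2 := zeroProd_neg_ne_zero_of_eq_zero haβ hbα haβs hbαs h1
      rw [neg_neg] at h2
      rwa [h1, mul_zero, add_zero]
    · have h1 : zeroProd (Sum.elim b α) (w ^ 2) = 0 := by
        rw [zeroProd_sumElim hbs hαs, h, mul_zero]
      have h2 := zeroProd_neg_ne_zero_of_eq_zero hbα haβ hbαs haβs h1
      rw [h1, zero_add]
      exact mul_ne_zero hgw h2
  · have hFw : F =ᶠ[𝓝[≠] w] fun z => f (z ^ 2) + z * g (z ^ 2) := by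
      have := mem_codiscreteWithin_iff_forall_mem_nhdsNE.1 hF w (Set.mem_univ w)
      rwa [Set.compl_univ, Set.union_empty] at this
    have hz0 : ∀ᶠ z in 𝓝[≠] w, z ≠ 0 := by
      by_cases hw0 : w = 0
      · rw [hw0]; exact self_mem_nhdsWithin
      · exact nhdsWithin_le_nhds (isOpen_ne.mem_nhds hw0)
    filter_upwards [hFw, hC0, hz0] with z h1 h2 h3
    rw [h1, hf, hg, zeroProd_sumElim hbs hαs, zeroProd_sumElim has hβs, zpow_neg, zpow_natCast]
    have h4 : z ^ (2 * k) ≠ 0 := pow_ne_zero _ h3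
    obtain ⟨h5, h6⟩ := mul_ne_zero_iff.1 (mul_ne_zero_iff.1 h2).2
    rw [← pow_mul, ← pow_mul]
    field_simp
    ring

end MeromorphicZeros

/-! ### The main theorem -/

theorem mainTheorem4
    {ι₁ ι₂ ι₃ ι₄ : Type*} (b : ι₁ → ℝ) (a : ι₂ → ℝ) (β : ι₃ → ℝ) (α : ι₄ → ℝ)
    (hb : ∀ μ, 0 < b μ) (ha : ∀ ν, 0 < a ν) (hβ : ∀ m, 0 < β m) (hα : ∀ n, 0 < α n)
    (hbs : Summable fun μ => (b μ)⁻¹) (has : Summable fun ν => (a ν)⁻¹)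
    (hβs : Summable fun m => (β m)⁻¹) (hαs : Summable fun n => (α n)⁻¹)
    (f₀ g₀ : ℂ) (hf₀ : f₀ ≠ 0) (hg₀ : g₀ ≠ 0) (j k : ℕ)
    (hne : j + k ≠ 0 → Nonempty ι₁ ∨ Nonempty ι₂ ∨ Nonempty ι₃ ∨ Nonempty ι₄)
    (E : ℂ → ℂ) (hE : Differentiable ℂ E) (f g F : ℂ → ℂ)
    (hf : ∀ z, f z = f₀ * z ^ (-(k : ℤ)) * Complex.exp (E z) *
      ((∏' μ, (1 + z / (b μ : ℂ))) / (∏' m, (1 - z / (β m : ℂ)))))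
    (hg : ∀ z, g z = g₀ * z ^ j * Complex.exp (E z) *
      ((∏' ν, (1 - z / (a ν : ℂ))) / (∏' n, (1 + z / (α n : ℂ)))))
    (hFm : MeromorphicOn F Set.univ)
    (hF : F =ᶠ[Filter.codiscrete ℂ] fun z => f (z ^ 2) + z * g (z ^ 2))
    (c : ℂ) (hc : c = -(g₀ * (‖f₀‖ : ℂ) / (f₀ * (‖g₀‖ : ℂ)))) :
    MeromorphicZeros.ZeroLocalization F c (j + k) := by
  have hF' := MeromorphicZeros.zeroMult_eq hb ha hβ hα hbs has hβs hαs hf₀ hg₀ (j := j) (k := k)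
    hE (fun z => by rw [hf, MeromorphicZeros.tprod_one_sub_div]; rfl)
    (fun z => by rw [hg, MeromorphicZeros.tprod_one_sub_div]; rfl) hF
  have hfn : (‖f₀‖ : ℂ) ≠ 0 := Complex.ofReal_ne_zero.2 (norm_ne_zero_iff.2 hf₀)
  have hgn : (‖g₀‖ : ℂ) ≠ 0 := Complex.ofReal_ne_zero.2 (norm_ne_zero_iff.2 hg₀)
  -- If some factor is present, the phase argument applies with P built from b, α and Q from a, β.
  -- Otherwise j + k = 0 and the function is linear.
  by_cases hall : Nonempty (ι₁ ⊕ ι₄) ∨ Nonempty (ι₂ ⊕ ι₃)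
  · let D : MeromorphicZeros.EquationData (ι₁ ⊕ ι₄) (ι₂ ⊕ ι₃) :=
      { p := Sum.elim b α
        q := Sum.elim a β
        K := ‖g₀‖ / ‖f₀‖
        τ := (j + k : ℕ) + 1 / 2
        p_pos := Sum.rec hb hα
        q_pos := Sum.rec ha hβ
        p_summable := MeromorphicZeros.summable_sumElim_inv hbs hαs
        q_summable := MeromorphicZeros.summable_sumElim_inv has hβs
        K_pos := div_pos (norm_pos_iff.2 hg₀) (norm_pos_iff.2 hf₀)
        nonempty := hall }
    have hcn : ‖c‖ = 1 := by
      rw [hc, norm_neg, norm_div, norm_mul, norm_mul, Complex.norm_real, Complex.norm_real,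
        norm_norm, norm_norm, mul_comm, div_self]
      exact mul_ne_zero (norm_ne_zero_iff.2 hf₀) (norm_ne_zero_iff.2 hg₀)
    obtain ⟨T, rfl, hJ, hT⟩ := MeromorphicZeros.Frame.exists_frame hcn (j + k)
    rw [← hJ]
    refine MeromorphicZeros.Frame.zeroLocalization (D := D) (by rw [hJ]) (fun w => ?_) hT
    rw [hF', hJ]
    congr 1
    funext z
    change _ = MeromorphicZeros.zeroProd (Sum.elim b α) (z ^ 2) -
      T.c * ((‖g₀‖ / ‖f₀‖ : ℝ) : ℂ) * z ^ (2 * (j + k) + 1) *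
        MeromorphicZeros.zeroProd (Sum.elim a β) (-z ^ 2)
    -- The normalisation of c is chosen so that cK = −g₀/f₀.
    have hcK : T.c * ((‖g₀‖ / ‖f₀‖ : ℝ) : ℂ) = -(g₀ / f₀) := by
      rw [hc, Complex.ofReal_div]
      field_simp
    rw [hcK]
    ring
  · push Not at hall
    obtain ⟨h14, h23⟩ := hall
    have hjk : j + k = 0 := by
      by_contra h
      rcases hne h with h | h | h | h
      · exact h14.false (Sum.inl h.some)
      · exact h23.false (Sum.inl h.some)
      · exact h23.false (Sum.inr h.some)
      · exact h14.false (Sum.inr h.some)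
    rw [hjk]
    refine MeromorphicZeros.zeroLocalization_linear (d := g₀ / f₀) (div_ne_zero hg₀ hf₀) ?_
      fun w => ?_
    · rw [hc, norm_div, Complex.ofReal_div]
      field_simp
    · rw [hF']
      congr 1
      funext z
      rw [hjk, MeromorphicZeros.zeroProd, MeromorphicZeros.zeroProd, tprod_empty, tprod_empty]
      ring
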